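/- \textsc{Path Contraction With Constrained Ends} is the following problem: given a connected finite simple undirected graph $G$, two disjoint subsets $X,Y\subseteq V(G)$ and an integer $k\ge 0$, decide whether one can contract at most $k$ edges of $G$ to obtain a path with witness structure $(W_1,\dots,W_\ell)$ such that $X\subseteq W_1$ and $Y\subseteq W_\ell$. Here $\ell\ge 1$, and a path witness structure is a partition $(W_1,\dots,W_\ell)$ of $V(G)$ into nonempty sets such that every $G[W_i]$ is connected and, for $i\ne j$, there is an edge of $G$ between $W_i$ and $W_j$ if and only if $|i-j|=1$; at most $k$ edges are contracted if there is a set $F\subseteq E(G)$ with $|F|\le k$ which is the union of the edge sets of spanning trees of $G[W_1],\dots,G[W_\ell]$. \textbf{Theorem.} \textsc{Path Contraction With Constrained Ends} admits an algorithm running in time $\mathcal O^*(2^{k-|X|-|Y|})$. That is, there are a program of a random access machine with logarithmic cost and constants $C,c$ such that, for every instance $(G,X,Y,k)$ with $n=|V(G)|$, the program halts within time $C\,n^{c}\,2^{\max(0,\,k-|X|-|Y|)}$ and correctly outputs whether $(G,X,Y,k)$ is a yes-instance. -/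

import Mathlib

/-! ### Contractions, witness structures and the decision problem -/

namespace PathContraction

/-- `G` is contractible to `H` via the onto map `ψ`. The witness set of `h` is the fibre
`ψ ⁻¹' {h}`: it is nonempty and induces a connected subgraph, and two different witness sets are
joined by an edge of `G` exactly when the corresponding vertices of `H` are adjacent. -/
structure ContractibleVia {V U : Type*} (G : SimpleGraph V) (H : SimpleGraph U) (ψ : V → U) :
    Prop where
  onto : Function.Surjective ψ
  connected : ∀ h : U, (G.induce (ψ ⁻¹' {h})).Connected
  adj_iff : ∀ h h' : U, h ≠ h' →
    ((∃ u ∈ ψ ⁻¹' {h}, ∃ v ∈ ψ ⁻¹' {h'}, G.Adj u v) ↔ H.Adj h h')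

/-- `F` is a union of edge sets of spanning trees, one spanning tree of `G[ψ ⁻¹' {h}]` for each
witness set `ψ ⁻¹' {h}`; contracting the edges in `F` contracts every witness set to one vertex. -/
structure IsUnionOfSpanningTrees {V U : Type*} (G : SimpleGraph V) (ψ : V → U)
    (F : Set (Sym2 V)) : Prop where
  subset_edges : F ⊆ G.edgeSet
  inside : ∀ e ∈ F, ∃ h : U, ∀ v ∈ e, v ∈ ψ ⁻¹' {h}
  spanning : ∀ h : U, ((SimpleGraph.fromEdgeSet F).induce (ψ ⁻¹' {h})).IsTree

/-- `G` is `k`-contractible to `H` with the witness structure given by `ψ`: the graph `H` arises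
by contracting a set `F` of at most `k` edges. -/
def KContractibleVia {V U : Type*} (k : ℕ) (G : SimpleGraph V) (H : SimpleGraph U) (ψ : V → U) :
    Prop :=
  ContractibleVia G H ψ ∧
    ∃ F : Set (Sym2 V), F.Finite ∧ IsUnionOfSpanningTrees G ψ F ∧ F.ncard ≤ k

/-- The question asked by Path Contraction With Constrained Ends: can one contract at most `k`
edges of `G` to obtain a path (here on `m + 1 ≥ 1` vertices `0, …, m`) whose first witness set
contains `X` and whose last witness set contains `Y`? -/
def ConstrainedEnds {V : Type*} (G : SimpleGraph V) (X Y : Finset V) (k : ℕ) : Prop :=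
  ∃ (m : ℕ) (ψ : V → Fin (m + 1)),
    KContractibleVia k G (SimpleGraph.pathGraph (m + 1)) ψ ∧
      (X : Set V) ⊆ ψ ⁻¹' {0} ∧ (Y : Set V) ⊆ ψ ⁻¹' {Fin.last m}

end PathContraction

/-! ### Random access machines with logarithmic cost -/

namespace RAM

/-- A state: the contents of the registers (a program mentions only finitely many of them) and of
the memory cells, all of them natural numbers. -/
structure State where
  reg : ℕ → ℕ
  mem : ℕ → ℕ

/-- The arithmetical operations; subtraction is truncated at `0`, division rounds down. -/
inductive Op where
  | add
  | sub
  | mul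
  | div

/-- The value of an arithmetical operation. -/
def Op.apply : Op → ℕ → ℕ → ℕ
  | .add, a, b => a + b
  | .sub, a, b => a - b
  | .mul, a, b => a * b
  | .div, a, b => a / b

/-- Random access machine programs, in structured form. -/
inductive Program where
  /-- do nothing -/
  | skip
  /-- `const r c`: put the number `c` into register `r` -/
  | const (r c : ℕ)
  /-- `arith o r a b`: apply `o` to registers `a` and `b`, and put the result into register `r` -/
  | arith (o : Op) (r a b : ℕ)
  /-- `load r a`: copy the memory cell whose address is in register `a` to register `r` -/
  | load (r a : ℕ)
  /-- `store a b`: copy register `b` to the memory cell whose address is in register `a` -/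
  | store (a b : ℕ)
  /-- `seq p q`: run `p`, then `q` -/
  | seq (p q : Program)
  /-- `cond r p q`: run `p` if register `r` is not zero, and `q` otherwise -/
  | cond (r : ℕ) (p q : Program)
  /-- `loop r p`: as long as register `r` is not zero, run `p` -/
  | loop (r : ℕ) (p : Program)

/-- Write `x` into register `r`. -/
def State.setReg (s : State) (r x : ℕ) : State :=
  { s with reg := Function.update s.reg r x }

/-- Write `x` into memory cell `a`. -/
def State.setMem (s : State) (a x : ℕ) : State :=
  { s with mem := Function.update s.mem a x }

/-- `Exec p s t s'`: the program `p`, started in state `s`, halts in state `s'` after time `t`.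
The cost is logarithmic: each executed instruction or test costs `1` plus the binary lengths of
the numbers and of the memory addresses it handles. -/
inductive Exec : Program → State → ℕ → State → Prop where
  | skip (s : State) : Exec .skip s 1 s
  | const (r c : ℕ) (s : State) : Exec (.const r c) s (1 + c.size) (s.setReg r c)
  | arith (o : Op) (r a b : ℕ) (s : State) :
      Exec (.arith o r a b) s (1 + (s.reg a).size + (s.reg b).size)
        (s.setReg r (o.apply (s.reg a) (s.reg b)))
  | load (r a : ℕ) (s : State) :
      Exec (.load r a) s (1 + (s.reg a).size + (s.mem (s.reg a)).size)
        (s.setReg r (s.mem (s.reg a)))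
  | store (a b : ℕ) (s : State) :
      Exec (.store a b) s (1 + (s.reg a).size + (s.reg b).size)
        (s.setMem (s.reg a) (s.reg b))
  | seq {p q : Program} {s s' s'' : State} {t t' : ℕ} :
      Exec p s t s' → Exec q s' t' s'' → Exec (.seq p q) s (t + t') s''
  | cond_true {r : ℕ} {p q : Program} {s s' : State} {t : ℕ} :
      s.reg r ≠ 0 → Exec p s t s' → Exec (.cond r p q) s (1 + (s.reg r).size + t) s'
  | cond_false {r : ℕ} {p q : Program} {s s' : State} {t : ℕ} :
      s.reg r = 0 → Exec q s t s' → Exec (.cond r p q) s (1 + (s.reg r).size + t) s'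
  | loop_done {r : ℕ} {p : Program} {s : State} :
      s.reg r = 0 → Exec (.loop r p) s (1 + (s.reg r).size) s
  | loop_next {r : ℕ} {p : Program} {s s' s'' : State} {t t' : ℕ} :
      s.reg r ≠ 0 → Exec p s t s' → Exec (.loop r p) s' t' s'' →
        Exec (.loop r p) s (1 + (s.reg r).size + t + t') s''

/-- The machine is deterministic: final state and running time are determined by the program and
the initial state. -/
theorem Exec.deterministic {p : Program} {s s₁ s₂ : State} {t₁ t₂ : ℕ}
    (h₁ : Exec p s t₁ s₁) (h₂ : Exec p s t₂ s₂) : t₁ = t₂ ∧ s₁ = s₂ := by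
  induction h₁ generalizing t₂ s₂ with
  | skip | const | arith | load | store => cases h₂; exact ⟨rfl, rfl⟩
  | seq _ _ ih ih' =>
    cases h₂ with
    | seq g g' =>
      obtain ⟨rfl, rfl⟩ := ih g
      obtain ⟨rfl, rfl⟩ := ih' g'
      exact ⟨rfl, rfl⟩
  | cond_true h _ ih =>
    cases h₂ with
    | cond_true _ g => obtain ⟨rfl, rfl⟩ := ih g; exact ⟨rfl, rfl⟩
    | cond_false h' _ => exact absurd h' h
  | cond_false h _ ih =>
    cases h₂ with
    | cond_true h' _ => exact absurd h h'
    | cond_false _ g => obtain ⟨rfl, rfl⟩ := ih g; exact ⟨rfl, rfl⟩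
  | loop_done h =>
    cases h₂ with
    | loop_done => exact ⟨rfl, rfl⟩
    | loop_next h' => exact absurd h h'
  | loop_next h _ _ ih ih' =>
    cases h₂ with
    | loop_done h' => exact absurd h' h
    | loop_next _ g g' =>
      obtain ⟨rfl, rfl⟩ := ih g
      obtain ⟨rfl, rfl⟩ := ih' g'
      exact ⟨rfl, rfl⟩

end RAM

namespace PathContraction

open Classical in
/-- The initial state for the instance `(G, X, Y, k)`, where `G` has vertices `0, …, n - 1`.
Register `0` holds `n`, register `1` holds `k`; memory holds the adjacency matrix of `G`, row by
row, in cells `0, …, n² - 1`, the indicator vector of `X` in the next `n` cells, and that of `Y`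
in the `n` cells after these. Everything else is `0`. -/
noncomputable def inputState {n : ℕ} (G : SimpleGraph (Fin n)) (X Y : Finset (Fin n)) (k : ℕ) :
    RAM.State where
  reg := fun r => if r = 0 then n else if r = 1 then k else 0
  mem := fun a =>
    if (∃ u v : Fin n, a = u.val * n + v.val ∧ G.Adj u v) ∨
        (∃ u ∈ X, a = n * n + u.val) ∨ (∃ u ∈ Y, a = n * n + n + u.val)
    then 1 else 0

end PathContraction

/-! ### A structured language on top of random access machines -/

namespace RAM

/-! Contracting to a path on `m + 1` vertices amounts to placing the vertices on levels `0, …, m`: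
every level is nonempty and connected, edges stay inside a level or join consecutive ones, and any
two consecutive levels are joined. Spanning trees of the levels have `n - (m + 1)` edges altogether,
so the budget reads `n ≤ m + 1 + k` (`constrainedEnds_iff`).

The algorithm is dynamic programming over the unions `P` of the first `ρ` levels, with marks in a
table indexed by `P` and `ρ`. A union `P` is recovered from little data. Its last level `W` is grown
from one vertex `v` (from `X`, if it is the first level and `X` is nonempty): whenever a new
neighbour of the present set is met, one bit says whether it joins or stays out. The earlier levels
form the component of a vertex `u` outside `W`. The next level is grown in the same way, with
further bits, from the neighbourhood of `P`. Vertices of `X` and `Y` are never decided by a bit.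
Each round tries all `v`, `u` and all bit sequences below a bound `R`.

How large must `R` be? Let `D` be the set of vertices decided by bits while one level and its
successor of a solution are grown. It avoids `X` and `Y` and lies on four consecutive levels. No
vertex is paid for twice: a neighbour on the next level that was kept out of `W` belongs to the
neighbourhood of `P`, where the second growth starts. Every level other than these four, the first
and the last has a vertex outside `D ∪ X ∪ Y`, so `|D| + |X| + |Y| + (m + 1) ≤ n + 6`, and hence
`|D| ≤ k + 6 - |X| - |Y|` (`Layering.card_le`, `Layering.found`). Thus `R = 2 ^ (k + 6) / 2 ^ (|X| +
|Y|)` suffices. Conversely all marks are justified (`Sound`), and a marked union with connected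
complement yields levels (`Solvable.constrainedEnds`).

For the machine, sets are binary numbers and the program is written in a small structured language,
compiled by `Stmt.exec`. After an initial part the registers and memory cells are kept below `64 * 2
^ (4 * n)`, so they have length `O(n)`, and `Stmt.cost_le` reads the time off the program text. The
loop over bit sequences is not nested in itself, so `R` enters to the first power. -/

/-- The registers from this one on hold intermediate results of expressions, and are `0` between
two statements. -/
abbrev scratch : ℕ := 40

/-- The register that holds the cap for the values of variables. -/
abbrev capReg : ℕ := 2

/-- Expressions: registers, constants, arithmetic, memory cells, and truncation at the value of
the register `capReg`. -/
inductive Expr where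
  | var (r : ℕ)
  | lit (c : ℕ)
  | op (o : Op) (a b : Expr)
  | ld (a : Expr)
  | cap (a : Expr)

theorem Exec.bound {p : Program} {s s' s'' : State} {t T : ℕ} (h : Exec p s t s') (hs : s' = s'')
    (ht : t ≤ T) : ∃ t ≤ T, Exec p s t s'' :=
  ⟨t, ht, hs ▸ h⟩

namespace Expr

@[simp] def eval (s : State) : Expr → ℕ
  | var r => s.reg r
  | lit c => c
  | op o a b => o.apply (a.eval s) (b.eval s)
  | ld a => s.mem (a.eval s)
  | cap a => min (a.eval s) (s.reg capReg)

/-- The code that evaluates an expression into register `d`, using registers from `d` on. -/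
def code : Expr → ℕ → Program
  -- The machine has no copy instruction; register `d + 1` holds `0`, so adding it copies.
  | var r, d => .arith .add d r (d + 1)
  | lit c, d => .const d c
  | op o a b, d => .seq (a.code d) (.seq (b.code (d + 1))
      (.seq (.arith o d d (d + 1)) (.const (d + 1) 0)))
  | ld a, d => .seq (a.code d) (.load d d)
  -- Truncated subtraction gives `a - (a - c) = min a c`.
  | cap a, d => .seq (a.code d) (.seq (.arith .sub (d + 1) d capReg)
      (.seq (.arith .sub d d (d + 1)) (.const (d + 1) 0)))

/-- All registers mentioned are variables. -/
def wf : Expr → Bool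
  | var r => decide (r < scratch)
  | lit _ => true
  | op _ a b => a.wf && b.wf
  | ld a => a.wf
  | cap a => a.wf

def cost (s : State) : Expr → ℕ
  | var r => 1 + (s.reg r).size
  | lit c => 1 + c.size
  | op _ a b => a.cost s + b.cost s + (2 + (a.eval s).size + (b.eval s).size)
  | ld a => a.cost s + (1 + (a.eval s).size + (s.mem (a.eval s)).size)
  | cap a => a.cost s + (3 + 3 * (a.eval s).size + (s.reg capReg).size)

end Expr

namespace State

/-- The scratch registers from `d` on are `0`. -/
def Clean (d : ℕ) (s : State) : Prop := ∀ r, d ≤ r → s.reg r = 0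

@[simp] theorem reg_setReg (s : State) (r x r' : ℕ) :
    (s.setReg r x).reg r' = if r' = r then x else s.reg r' := by
  simp [setReg, Function.update_apply]

@[simp] theorem mem_setReg (s : State) (r x : ℕ) : (s.setReg r x).mem = s.mem := rfl

@[simp] theorem reg_setMem (s : State) (a x : ℕ) : (s.setMem a x).reg = s.reg := rfl

@[simp] theorem mem_setMem (s : State) (a x a' : ℕ) :
    (s.setMem a x).mem a' = if a' = a then x else s.mem a' := by
  simp [setMem, Function.update_apply]

@[ext] theorem ext' {s t : State} (h : ∀ r, s.reg r = t.reg r) (h' : ∀ a, s.mem a = t.mem a) :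
    s = t := by
  cases s; cases t; simp only [mk.injEq]; exact ⟨funext h, funext h'⟩

end State

theorem Expr.eval_setReg {e : Expr} {s : State} {d x : ℕ} (he : e.wf) (hd : scratch ≤ d) :
    e.eval (s.setReg d x) = e.eval s := by
  induction e with
  | var r =>
    have : r < scratch := by simpa [wf] using he
    have : r ≠ d := by omega
    simp [this]
  | lit c => rfl
  | op o a b iha ihb =>
    simp only [wf, Bool.and_eq_true] at he
    simp [iha he.1, ihb he.2]
  | ld a iha => simp [iha he]
  | cap a iha =>
    have : capReg ≠ d := by unfold capReg; unfold scratch at hd; omega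
    simp only [eval, iha he, State.reg_setReg, if_neg this]

theorem Expr.cost_setReg {e : Expr} {s : State} {d x : ℕ} (he : e.wf) (hd : scratch ≤ d) :
    e.cost (s.setReg d x) = e.cost s := by
  induction e with
  | var r =>
    have : r < scratch := by simpa [wf] using he
    have : r ≠ d := by omega
    simp [this, cost]
  | lit c => rfl
  | op o a b iha ihb =>
    simp only [wf, Bool.and_eq_true] at he
    simp [cost, iha he.1, ihb he.2, eval_setReg he.1 hd, eval_setReg he.2 hd]
  | ld a iha =>
    simp only [cost, iha he, eval_setReg (e := a) he hd, State.mem_setReg]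
  | cap a iha =>
    have : capReg ≠ d := by unfold capReg; unfold scratch at hd; omega
    simp only [cost, iha he, eval_setReg (e := a) he hd, State.reg_setReg, if_neg this]

/-- Every case resets register `d + 1` to `0`, so only `d` changes and cleanliness is available
again for the next subexpression. -/
theorem Expr.exec {e : Expr} (he : e.wf) : ∀ {d : ℕ} {s : State}, scratch ≤ d → s.Clean d →
    ∃ t ≤ e.cost s, Exec (e.code d) s t (s.setReg d (e.eval s)) := by
  induction e with
  | var r =>
    intro d s hd hs
    refine (Exec.arith .add d r (d + 1) s).bound ?_ ?_
    · simp [Op.apply, hs (d + 1) (by omega)]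
    · simp [cost, hs (d + 1) (by omega)]
  | lit c =>
    intro d s hd hs
    exact ⟨_, le_rfl, Exec.const d c s⟩
  | op o a b iha ihb =>
    intro d s hd hs
    simp only [wf, Bool.and_eq_true] at he
    obtain ⟨t₁, h₁, e₁⟩ := iha he.1 hd hs
    have hs' : (s.setReg d (a.eval s)).Clean (d + 1) := by
      intro r hr
      have : r ≠ d := by omega
      simp [this, hs r (by omega)]
    obtain ⟨t₂, h₂, e₂⟩ := ihb he.2 (by omega : scratch ≤ d + 1) hs'
    rw [eval_setReg he.2 hd] at e₂
    rw [cost_setReg he.2 hd] at h₂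
    have e₃ := Exec.arith o d d (d + 1) ((s.setReg d (a.eval s)).setReg (d + 1) (b.eval s))
    have e₄ := Exec.const (d + 1) 0 (((s.setReg d (a.eval s)).setReg (d + 1) (b.eval s)).setReg d
      (o.apply (((s.setReg d (a.eval s)).setReg (d + 1) (b.eval s)).reg d)
        (((s.setReg d (a.eval s)).setReg (d + 1) (b.eval s)).reg (d + 1))))
    refine Exec.bound (Exec.seq e₁ (Exec.seq e₂ (Exec.seq e₃ e₄))) ?_ ?_
    · ext r
      · by_cases h : r = d + 1
        · simp [h, hs (d + 1) (by omega)]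
        · by_cases h' : r = d <;> simp [h, h']
      · simp
    · simp [cost]
      omega
  | ld a iha =>
    intro d s hd hs
    obtain ⟨t₁, h₁, e₁⟩ := iha he hd hs
    refine Exec.bound (Exec.seq e₁ (Exec.load d d _)) ?_ ?_
    · ext r
      · by_cases h : r = d <;> simp [h]
      · rfl
    · simp [cost]
      omega
  | cap a iha =>
    intro d s hd hs
    obtain ⟨t₁, h₁, e₁⟩ := iha he hd hs
    have hc : capReg ≠ d := by unfold capReg; unfold scratch at hd; omega
    have hc' : capReg ≠ d + 1 := by unfold capReg; unfold scratch at hd; omega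
    refine Exec.bound (Exec.seq e₁ (Exec.seq (Exec.arith .sub (d + 1) d capReg _)
        (Exec.seq (Exec.arith .sub d d (d + 1) _) (Exec.const (d + 1) 0 _)))) ?_ ?_
    · ext r
      · by_cases h : r = d + 1
        · simp [h, hs (d + 1) (by omega)]
        · by_cases h' : r = d
          · simp only [State.reg_setReg, h', if_true, Op.apply, hc, if_false, eval]
            simp
            omega
          · simp [h, h']
      · simp
    · simp only [cost, State.reg_setReg, if_true, if_neg hc, Op.apply]
      have : (a.eval s - s.reg capReg).size ≤ (a.eval s).size := Nat.size_le_size (Nat.sub_le _ _)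
      simp
      omega

/-! ### Statements: semantics, time and compilation. -/

/-- `iter f m s` applies `f (m - 1)`, …, `f 0` to `s`, in this order. -/
def iter {σ : Type*} (f : ℕ → σ → σ) : ℕ → σ → σ
  | 0, s => s
  | m + 1, s => iter f m (f m s)

/-- Statements. `loop i c p` runs `p` for the values `m - 1`, …, `0` of register `i`, where `m` is
the value of register `c` in the beginning. -/
inductive Stmt where
  | skip
  | asg (r : ℕ) (e : Expr)
  | sto (a e : Expr)
  | seq (p q : Stmt)
  | ite (e : Expr) (p q : Stmt)
  | loop (i c : ℕ) (p : Stmt)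

namespace Stmt

def run : Stmt → State → State
  | skip, s => s
  | asg r e, s => s.setReg r (e.eval s)
  | sto a e, s => s.setMem (a.eval s) (e.eval s)
  | seq p q, s => q.run (p.run s)
  | ite e p q, s => if e.eval s ≠ 0 then p.run s else q.run s
  | loop i c p, s => iter (fun m s => p.run (s.setReg i m)) (s.reg c) (s.setReg i (s.reg c))

/-- The time that the rounds of a loop take. -/
def iterCost {σ : Type*} (f : ℕ → σ → σ) (g : ℕ → σ → ℕ) : ℕ → σ → ℕ
  | 0, _ => 0
  | m + 1, s => g m s + iterCost f g m (f m s)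

def cost : Stmt → State → ℕ
  | skip, _ => 1
  | asg _ e, s => e.cost s + (2 + (e.eval s).size)
  | sto a e, s => a.cost s + e.cost s + (3 + (a.eval s).size + (e.eval s).size)
  | seq p q, s => p.cost s + q.cost (p.run s)
  | ite e p q, s => e.cost s + (2 + (e.eval s).size) +
      if e.eval s ≠ 0 then p.cost s else q.cost s
  -- A round pays `1 + (m + 1).size` for the test and `5 + (m + 1).size` for the three instructions
  -- that decrement the counter. The initial `2 + (s.reg c).size` covers the copy of the count and
  -- the final test.
  | loop i c p, s => 2 + (s.reg c).size + iterCost (fun m s => p.run (s.setReg i m))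
      (fun m s => 6 + 2 * (m + 1).size + p.cost (s.setReg i m)) (s.reg c)
      (s.setReg i (s.reg c))

def code : Stmt → Program
  | skip => .skip
  | asg r e => .seq (e.code scratch)
      (.seq (.arith .add r scratch (scratch + 1)) (.const scratch 0))
  | sto a e => .seq (a.code scratch) (.seq (e.code (scratch + 1))
      (.seq (.store scratch (scratch + 1))
        (.seq (.const scratch 0) (.const (scratch + 1) 0))))
  | seq p q => .seq p.code q.code
  | ite e p q => .seq (e.code scratch)
      (.cond scratch (.seq (.const scratch 0) p.code) q.code)
  | loop i c p => .seq (.arith .add i c scratch)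
      (.loop i (.seq (.seq (.const scratch 1) (.seq (.arith .sub i i scratch) (.const scratch 0)))
        p.code))

/-- Does the statement write into register `r`? -/
def writes : Stmt → ℕ → Bool
  | skip, _ => false
  | asg r _, x => x == r
  | sto _ _, _ => false
  | seq p q, x => p.writes x || q.writes x
  | ite _ p q, x => p.writes x || q.writes x
  | loop i _ p, x => x == i || p.writes x

/-- All registers mentioned are variables, and loops do not change their counters. -/
def wf : Stmt → Bool
  | skip => true
  | asg r e => decide (r < scratch) && e.wf
  | sto a e => a.wf && e.wf
  | seq p q => p.wf && q.wf
  | ite e p q => e.wf && p.wf && q.wf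
  | loop i c p => decide (i < scratch) && decide (c < scratch) && !p.writes i && p.wf

/-- Does the statement leave the memory as it is? -/
def pure : Stmt → Bool
  | skip => true
  | asg _ _ => true
  | sto _ _ => false
  | seq p q => p.pure && q.pure
  | ite _ p q => p.pure && q.pure
  | loop _ _ p => p.pure

end Stmt

/-- Rounds run downwards, so the invariant is indexed by the number of rounds still to come. -/
theorem iter_induction {σ : Type*} {f : ℕ → σ → σ} (I : ℕ → σ → Prop) {m : ℕ} {s : σ}
    (h₀ : I m s) (h : ∀ j < m, ∀ s, I (j + 1) s → I j (f j s)) : I 0 (iter f m s) := by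
  induction m generalizing s with
  | zero => exact h₀
  | succ m ih => exact ih (h m (by omega) s h₀) fun j hj => h j (by omega)

theorem iter_invariant {σ : Type*} {f : ℕ → σ → σ} (I : σ → Prop) {m : ℕ} {s : σ}
    (h₀ : I s) (h : ∀ j < m, ∀ s, I s → I (f j s)) : I (iter f m s) :=
  iter_induction (fun _ => I) h₀ h

/-- A frame rule whose hypothesis is decided from the program text. -/
theorem Stmt.run_reg {p : Stmt} {r : ℕ} (h : p.writes r = false) (s : State) :
    (p.run s).reg r = s.reg r := by
  induction p generalizing s with
  | skip => rfl
  | asg r' e =>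
    have : r ≠ r' := by simpa [writes] using h
    simp [run, this]
  | sto a e => rfl
  | seq p q ihp ihq =>
    simp only [writes, Bool.or_eq_false_iff] at h
    simp [run, ihp h.1, ihq h.2]
  | ite e p q ihp ihq =>
    simp only [writes, Bool.or_eq_false_iff] at h
    simp only [run]
    split
    · exact ihp h.1 s
    · exact ihq h.2 s
  | loop i c p ih =>
    simp only [writes, Bool.or_eq_false_iff] at h
    have hi : r ≠ i := by simpa using h.1
    exact iter_invariant (fun s' : State => s'.reg r = s.reg r) (by simp [hi]) fun j _ s' hs' => by
      rw [ih h.2]; simp [hi, hs']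

theorem Stmt.run_mem {p : Stmt} (h : p.pure) (s : State) : (p.run s).mem = s.mem := by
  induction p generalizing s with
  | skip => rfl
  | asg r' e => rfl
  | sto a e => simp [pure] at h
  | seq p q ihp ihq =>
    simp only [pure, Bool.and_eq_true] at h
    simp [run, ihp h.1, ihq h.2]
  | ite e p q ihp ihq =>
    simp only [pure, Bool.and_eq_true] at h
    simp only [run]
    split
    · exact ihp h.1 s
    · exact ihq h.2 s
  | loop i c p ih =>
    exact iter_invariant (fun s' : State => s'.mem = s.mem) (by simp) fun j _ s' hs' => by
      rw [ih h]; simp [hs']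

theorem Stmt.writes_lt {p : Stmt} (h : p.wf) {r : ℕ} (hr : scratch ≤ r) :
    p.writes r = false := by
  induction p with
  | skip => rfl
  | asg r' e =>
    simp only [wf, Bool.and_eq_true, decide_eq_true_eq] at h
    simp only [writes, beq_eq_false_iff_ne]
    omega
  | sto a e => rfl
  | seq p q ihp ihq =>
    simp only [wf, Bool.and_eq_true] at h
    simp [writes, ihp h.1, ihq h.2]
  | ite e p q ihp ihq =>
    simp only [wf, Bool.and_eq_true] at h
    simp [writes, ihp h.1.2, ihq h.2]
  | loop i c p ih =>
    simp only [wf, Bool.and_eq_true, decide_eq_true_eq] at h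
    simp only [writes, ih h.2, Bool.or_false, beq_eq_false_iff_ne]
    omega

theorem Stmt.clean_run {p : Stmt} (h : p.wf) {s : State} (hs : s.Clean scratch) :
    (p.run s).Clean scratch := fun r hr => by
  rw [run_reg (writes_lt h hr), hs r hr]

theorem State.Clean.setReg {s : State} {d : ℕ} (hs : s.Clean d) {r : ℕ} (hr : r < d) (x : ℕ) :
    (s.setReg r x).Clean d := fun r' hr' => by
  simp [show r' ≠ r by omega, hs r' hr']

theorem Stmt.exec {p : Stmt} (hp : p.wf) {s : State} (hs : s.Clean scratch) :
    ∃ t ≤ p.cost s, Exec p.code s t (p.run s) := by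
  induction p generalizing s with
  | skip => exact ⟨1, le_rfl, Exec.skip s⟩
  | asg r e =>
    simp only [wf, Bool.and_eq_true, decide_eq_true_eq] at hp
    obtain ⟨t, ht, h⟩ := Expr.exec hp.2 le_rfl hs
    refine Exec.bound (Exec.seq h (Exec.seq (Exec.arith .add r scratch (scratch + 1) _)
        (Exec.const scratch 0 _))) ?_ ?_
    · ext r'
      · by_cases h1 : r' = scratch
        · simp [h1, run, hs scratch le_rfl, show scratch ≠ r by omega]
        · by_cases h2 : r' = r
          · subst h2
            simp [run, h1, Op.apply, hs (scratch + 1) (by omega)]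
          · simp [run, h1, h2]
      · simp [run]
    · simp [cost, hs (scratch + 1) (by omega)]
      omega
  | sto a e =>
    simp only [wf, Bool.and_eq_true] at hp
    obtain ⟨t₁, h₁, e₁⟩ := Expr.exec hp.1 le_rfl hs
    have hs' : (s.setReg scratch (a.eval s)).Clean (scratch + 1) := by
      intro r hr
      simp [show r ≠ scratch by omega, hs r (by omega)]
    obtain ⟨t₂, h₂, e₂⟩ := Expr.exec hp.2 (by omega : scratch ≤ scratch + 1) hs'
    rw [Expr.eval_setReg hp.2 le_rfl] at e₂
    rw [Expr.cost_setReg hp.2 le_rfl] at h₂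
    refine Exec.bound (Exec.seq e₁ (Exec.seq e₂ (Exec.seq (Exec.store scratch (scratch + 1) _)
        (Exec.seq (Exec.const scratch 0 _) (Exec.const (scratch + 1) 0 _))))) ?_ ?_
    · ext r'
      · by_cases h1 : r' = scratch
        · simp [h1, run, hs scratch le_rfl]
        · by_cases h2 : r' = scratch + 1
          · simp [h2, run, hs (scratch + 1) (by omega)]
          · simp [h1, h2, run]
      · simp [run]
    · simp [cost]
      omega
  | seq p q ihp ihq =>
    simp only [wf, Bool.and_eq_true] at hp
    obtain ⟨t₁, h₁, e₁⟩ := ihp hp.1 hs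
    obtain ⟨t₂, h₂, e₂⟩ := ihq hp.2 (clean_run hp.1 hs)
    exact ⟨_, Nat.add_le_add h₁ h₂, Exec.seq e₁ e₂⟩
  | ite e p q ihp ihq =>
    simp only [wf, Bool.and_eq_true] at hp
    obtain ⟨t, ht, h⟩ := Expr.exec hp.1.1 le_rfl hs
    by_cases he : e.eval s = 0
    · obtain ⟨t₂, h₂, e₂⟩ := ihq hp.2 hs
      have h0 : s.setReg scratch (e.eval s) = s := by
        ext r
        · by_cases hr : r = scratch
          · simp [hr, he, hs scratch le_rfl]
          · simp [hr]
        · rfl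
      rw [h0] at h
      refine Exec.bound (Exec.seq h (Exec.cond_false (hs scratch le_rfl) e₂)) ?_ ?_
      · simp [run, he]
      · simp [cost, he, hs scratch le_rfl]
        omega
    · obtain ⟨t₂, h₂, e₂⟩ := ihp hp.1.2 hs
      have h0 : (s.setReg scratch (e.eval s)).setReg scratch 0 = s := by
        ext r
        · by_cases hr : r = scratch
          · simp [hr, hs scratch le_rfl]
          · simp [hr]
        · rfl
      have e₃ := Exec.const scratch 0 (s.setReg scratch (e.eval s))
      rw [h0] at e₃
      refine Exec.bound (Exec.seq h (Exec.cond_true (by simpa using he) (Exec.seq e₃ e₂))) ?_ ?_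
      · simp [run, he]
      · simp [cost, he]
        omega
  | loop i c p ih =>
    simp only [wf, Bool.and_eq_true, decide_eq_true_eq] at hp
    obtain ⟨⟨⟨hi, hc⟩, hw⟩, hp⟩ := hp
    have hw : p.writes i = false := by simpa using hw
    -- The counter is decremented before the body, which does not write it; hence between rounds it
    -- equals the number of rounds left.
    have rounds : ∀ (m : ℕ) (s : State), s.Clean scratch → s.reg i = m →
        ∃ t ≤ 1 + iterCost (fun m s => p.run (s.setReg i m))
          (fun m s => 6 + 2 * (m + 1).size + p.cost (s.setReg i m)) m s,
          Exec (.loop i (.seq (.seq (.const scratch 1)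
            (.seq (.arith .sub i i scratch) (.const scratch 0))) p.code)) s t
            (iter (fun m s => p.run (s.setReg i m)) m s) := by
      intro m
      induction m with
      | zero =>
        intro s hs h0
        exact ⟨_, by simp [h0, iterCost], Exec.loop_done h0⟩
      | succ m ihm =>
        intro s hs hm
        have hs' : (s.setReg i m).Clean scratch := hs.setReg hi m
        obtain ⟨t₁, h₁, e₁⟩ := ih hp hs'
        obtain ⟨t₂, h₂, e₂⟩ := ihm (p.run (s.setReg i m)) (clean_run hp hs')
          (by rw [run_reg hw]; simp)
        have e₃ := Exec.seq (Exec.const scratch 1 s) (Exec.seq (Exec.arith .sub i i scratch _)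
          (Exec.const scratch 0 _))
        have hd : (((s.setReg scratch 1).setReg i (Op.sub.apply ((s.setReg scratch 1).reg i)
            ((s.setReg scratch 1).reg scratch))).setReg scratch 0) = s.setReg i m := by
          ext r
          · by_cases h1 : r = scratch
            · simp [h1, show scratch ≠ i by omega, hs scratch le_rfl]
            · by_cases h2 : r = i
              · simp [h2, show i ≠ scratch by omega, Op.apply, hm]
              · simp [h1, h2]
          · rfl
        rw [hd] at e₃
        refine ⟨_, ?_, Exec.loop_next (by omega) (Exec.seq e₃ e₁) e₂⟩
        simp [iterCost, hm, show i ≠ scratch by omega]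
        have : Nat.size 1 = 1 := by decide
        omega
    have h0 := Exec.arith .add i c scratch s
    rw [show Op.add.apply (s.reg c) (s.reg scratch) = s.reg c by
      simp [Op.apply, hs scratch le_rfl]] at h0
    obtain ⟨t, ht, h⟩ := rounds (s.reg c) (s.setReg i (s.reg c)) (hs.setReg hi _) (by simp)
    refine ⟨_, ?_, Exec.seq h0 h⟩
    simp [cost, hs scratch le_rfl]
    omega

end RAM

/-! ### Static bounds for the running time -/

namespace RAM

/-- All registers and memory cells have binary length at most `L`. -/
structure State.Short (L : ℕ) (s : State) : Prop where
  pos : 1 ≤ L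
  reg : ∀ r, (s.reg r).size ≤ L
  mem : ∀ a, (s.mem a).size ≤ L

theorem State.Short.mono {L L' : ℕ} {s : State} (h : s.Short L) (hL : L ≤ L') : s.Short L' :=
  ⟨h.pos.trans hL, fun r => (h.reg r).trans hL, fun a => (h.mem a).trans hL⟩

theorem State.Short.setReg {L : ℕ} {s : State} (h : s.Short L) (r : ℕ) {x : ℕ}
    (hx : x.size ≤ L) : (s.setReg r x).Short L :=
  ⟨h.pos, fun r' => by rw [reg_setReg]; split; exacts [hx, h.reg r'], h.mem⟩

theorem State.Short.setMem {L : ℕ} {s : State} (h : s.Short L) (a : ℕ) {x : ℕ}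
    (hx : x.size ≤ L) : (s.setMem a x).Short L :=
  ⟨h.pos, h.reg, fun a' => by rw [mem_setMem]; split; exacts [hx, h.mem a']⟩

theorem Op.size_apply (o : Op) (a b : ℕ) : (o.apply a b).size ≤ a.size + b.size + 1 := by
  cases o with
  | add =>
    rw [Nat.size_le]
    have ha := Nat.lt_size_self a
    have hb := Nat.lt_size_self b
    have h₁ : 2 ^ a.size ≤ 2 ^ (a.size + b.size) := Nat.pow_le_pow_right (by omega) (by omega)
    have h₂ : 2 ^ b.size ≤ 2 ^ (a.size + b.size) := Nat.pow_le_pow_right (by omega) (by omega)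
    rw [pow_succ]
    show a + b < _
    omega
  | sub => exact (Nat.size_le_size (Nat.sub_le a b)).trans (by omega)
  | mul =>
    refine (Nat.size_le.2 ?_).trans (Nat.le_succ _)
    rw [pow_add]
    exact Nat.mul_lt_mul'' (Nat.lt_size_self a) (Nat.lt_size_self b)
  | div => exact (Nat.size_le_size (Nat.div_le_self a b)).trans (by omega)

namespace Expr

/-- Bounds the length of the value relative to the lengths of registers and cells. -/
def len : Expr → ℕ
  | var _ => 1
  | lit c => c + 1
  | op _ a b => a.len + b.len + 1
  | ld _ => 1
  | cap a => a.len

/-- Bounds the time of the evaluation relative to the lengths of registers and cells. -/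
def weight : Expr → ℕ
  | var _ => 2
  | lit c => c + 1
  | op _ a b => a.weight + b.weight + (2 + a.len + b.len)
  | ld a => a.weight + (2 + a.len)
  | cap a => a.weight + (4 + 3 * a.len)

/-- The value is at most `1` or the largest of the values in registers and cells. -/
def capped : Expr → Bool
  | var _ => true
  | lit c => decide (c ≤ 1)
  | op .div a _ => a.capped
  | op .sub a _ => a.capped
  | op _ _ _ => false
  | ld _ => true
  | cap _ => true

theorem size_lit_le (c : ℕ) : c.size ≤ c :=
  Nat.size_le.2 Nat.lt_two_pow_self

theorem size_eval_le {L : ℕ} {s : State} (h : s.Short L) (e : Expr) :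
    (e.eval s).size ≤ e.len * L := by
  induction e with
  | var r => simpa [len] using h.reg r
  | lit c =>
    have := size_lit_le c
    have := h.pos
    simp only [eval, len]
    nlinarith
  | op o a b iha ihb =>
    have := o.size_apply (a.eval s) (b.eval s)
    have := h.pos
    simp only [eval, len]
    nlinarith
  | ld a => simpa [len] using h.mem _
  | cap a ih => exact (Nat.size_le_size (min_le_left _ _)).trans ih

theorem cost_le {L : ℕ} {s : State} (h : s.Short L) (e : Expr) : e.cost s ≤ e.weight * L := by
  have hp := h.pos
  induction e with
  | var r => have := h.reg r; simp only [cost, weight]; omega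
  | lit c =>
    have := size_lit_le c
    simp only [cost, weight]
    nlinarith
  | op o a b iha ihb =>
    have := size_eval_le h a
    have := size_eval_le h b
    simp only [cost, weight]
    nlinarith
  | ld a iha =>
    have := size_eval_le h a
    have := h.mem (a.eval s)
    simp only [cost, weight]
    nlinarith
  | cap a iha =>
    have := size_eval_le h a
    have := h.reg capReg
    simp only [cost, weight]
    nlinarith

theorem eval_le_of_capped {N : ℕ} {s : State} (hN : 1 ≤ N) (hr : ∀ r, s.reg r ≤ N)
    (hm : ∀ a, s.mem a ≤ N) {e : Expr} (he : e.capped) : e.eval s ≤ N := by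
  induction e with
  | var r => exact hr r
  | lit c => exact le_trans (by simpa [capped] using he) hN
  | op o a b iha ihb =>
    cases o with
    | add => simp [capped] at he
    | mul => simp [capped] at he
    | sub => exact (Nat.sub_le _ _).trans (iha he)
    | div => exact (Nat.div_le_self _ _).trans (iha he)
  | ld a => exact hm _
  | cap a => exact (min_le_right _ _).trans (hr _)

end Expr

/-- All registers and memory cells are bounded by the value of the register `capReg`. -/
structure State.Capped (s : State) : Prop where
  pos : 1 ≤ s.reg capReg
  reg : ∀ r, s.reg r ≤ s.reg capReg
  mem : ∀ a, s.mem a ≤ s.reg capReg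

theorem State.Capped.short {s : State} (h : s.Capped) : s.Short (s.reg capReg).size :=
  ⟨Nat.size_pos.2 h.pos, fun r => Nat.size_le_size (h.reg r), fun a => Nat.size_le_size (h.mem a)⟩

theorem State.Capped.setReg {s : State} (h : s.Capped) {r x : ℕ} (hr : r ≠ capReg)
    (hx : x ≤ s.reg capReg) : (s.setReg r x).Capped := by
  have : (s.setReg r x).reg capReg = s.reg capReg := by simp [hr.symm]
  refine ⟨by rw [this]; exact h.pos, fun r' => ?_, fun a => by rw [this]; exact h.mem a⟩
  rw [this, reg_setReg]
  split
  exacts [hx, h.reg r']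

theorem State.Capped.setMem {s : State} (h : s.Capped) {a x : ℕ}
    (hx : x ≤ s.reg capReg) : (s.setMem a x).Capped := by
  refine ⟨h.pos, h.reg, fun a' => ?_⟩
  rw [mem_setMem]
  split
  exacts [hx, h.mem a']

namespace Stmt

/-- Only capped values are assigned, only registers from `m` on are changed, and the numbers of
rounds of the loops are in registers below `m` from the list `cs`. -/
def capped (m : ℕ) (cs : List ℕ) : Stmt → Bool
  | skip => true
  | asg r e => decide (m ≤ r) && e.capped
  | sto _ e => e.capped
  | seq p q => p.capped m cs && q.capped m cs
  | ite _ p q => p.capped m cs && q.capped m cs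
  | loop i c p => decide (m ≤ i) && decide (c < m) && cs.contains c && p.capped m cs

/-- The exponent in the bound for the time, if a loop with count in register `c` contributes
`d c`. -/
def degree (d : ℕ → ℕ) : Stmt → ℕ
  | skip => 0
  | asg _ _ => 0
  | sto _ _ => 0
  | seq p q => max (p.degree d) (q.degree d)
  | ite _ p q => max (p.degree d) (q.degree d)
  | loop _ c p => d c + p.degree d

/-- The constant factor in the bound for the time. -/
def coeff : Stmt → ℕ
  | skip => 1
  | asg _ e => e.weight + (2 + e.len)
  | sto a e => a.weight + e.weight + (3 + a.len + e.len)
  | seq p q => p.coeff + q.coeff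
  | ite e p q => e.weight + (2 + e.len) + (p.coeff + q.coeff)
  | loop _ _ p => p.coeff + 11

theorem writes_of_capped {m : ℕ} {cs : List ℕ} {p : Stmt} (hp : p.capped m cs) {r : ℕ}
    (hr : r < m) :
    p.writes r = false := by
  induction p with
  | skip => rfl
  | asg r' e =>
    simp only [capped, Bool.and_eq_true, decide_eq_true_eq] at hp
    simp only [writes, beq_eq_false_iff_ne]
    omega
  | sto a e => rfl
  | seq p q ihp ihq =>
    simp only [capped, Bool.and_eq_true] at hp
    simp [writes, ihp hp.1, ihq hp.2]
  | ite e p q ihp ihq =>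
    simp only [capped, Bool.and_eq_true] at hp
    simp [writes, ihp hp.1, ihq hp.2]
  | loop i c p ih =>
    simp only [capped, Bool.and_eq_true, decide_eq_true_eq] at hp
    simp only [writes, ih hp.2, Bool.or_false, beq_eq_false_iff_ne]
    omega

/-- Loop counters are the only values written without an explicit check, and they stay at most the
loop count, itself a register value. -/
theorem capped_run {m : ℕ} {cs : List ℕ} (hm : capReg < m) {p : Stmt} (hp : p.capped m cs)
    {s : State}
    (hs : s.Capped) : (p.run s).Capped := by
  induction p generalizing s with
  | skip => exact hs
  | asg r e =>
    simp only [capped, Bool.and_eq_true, decide_eq_true_eq] at hp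
    exact hs.setReg (by omega) (Expr.eval_le_of_capped hs.pos hs.reg hs.mem hp.2)
  | sto a e => exact hs.setMem (Expr.eval_le_of_capped hs.pos hs.reg hs.mem hp)
  | seq p q ihp ihq =>
    simp only [capped, Bool.and_eq_true] at hp
    exact ihq hp.2 (ihp hp.1 hs)
  | ite e p q ihp ihq =>
    simp only [capped, Bool.and_eq_true] at hp
    simp only [run]
    split
    · exact ihp hp.1 hs
    · exact ihq hp.2 hs
  | loop i c p ih =>
    simp only [capped, Bool.and_eq_true, decide_eq_true_eq] at hp
    have hi : i ≠ capReg := by omega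
    refine (iter_invariant (fun s' : State => s'.Capped ∧ s'.reg capReg = s.reg capReg)
      ⟨hs.setReg hi (hs.reg c), by simp [hi.symm]⟩ ?_).1
    rintro j hj s' ⟨h₁, h₂⟩
    refine ⟨ih hp.2 (h₁.setReg hi ?_), ?_⟩
    · rw [h₂]
      exact hj.le.trans (hs.reg c)
    · rw [run_reg (writes_of_capped hp.2 hm)]
      simp [hi.symm, h₂]

theorem iterCost_le {σ : Type*} {f : ℕ → σ → σ} {g : ℕ → σ → ℕ} (I : ℕ → σ → Prop) {T m : ℕ}
    {s : σ} (h₀ : I m s) (h : ∀ j < m, ∀ s, I (j + 1) s → I j (f j s) ∧ g j s ≤ T) :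
    iterCost f g m s ≤ m * T := by
  induction m generalizing s with
  | zero => simp [iterCost]
  | succ m ih =>
    have h₁ := h m (by omega) s h₀
    have h₂ := ih h₁.1 fun j hj => h j (by omega)
    simp only [iterCost]
    rw [Nat.succ_mul]
    omega

/-- All registers and cells stay below the cap, so an elementary statement costs at most its
coefficient times the length of the cap. The count registers lie below `m` and never change, so a
loop on `c` contributes the factor `n ^ d c * R ^ d' c` throughout. Two exponents are kept in order
to separate the polynomial factor from the number `R` of bit sequences. -/
theorem cost_le {m n R : ℕ} {cs : List ℕ} (hm : capReg < m) (hn : 1 ≤ n) (hR : 1 ≤ R) (d d' : ℕ → ℕ)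
    {p : Stmt} (hp : p.capped m cs) {s : State} (hs : s.Capped)
    (hd : ∀ c ∈ cs, c < m → s.reg c ≤ n ^ d c * R ^ d' c) :
    p.cost s ≤ p.coeff * (n ^ p.degree d * R ^ p.degree d') * (s.reg capReg).size := by
  have mono : ∀ {a b a' b' : ℕ}, a ≤ b → a' ≤ b' → n ^ a * R ^ a' ≤ n ^ b * R ^ b' := fun h h' =>
    Nat.mul_le_mul (Nat.pow_le_pow_right hn h) (Nat.pow_le_pow_right hR h')
  have two : ∀ p q : Stmt, ∀ {x y L : ℕ},
      x ≤ p.coeff * (n ^ p.degree d * R ^ p.degree d') * L →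
      y ≤ q.coeff * (n ^ q.degree d * R ^ q.degree d') * L →
      x + y ≤ (p.coeff + q.coeff) * (n ^ (max (p.degree d) (q.degree d)) *
        R ^ (max (p.degree d') (q.degree d'))) * L := by
    intro p q x y L hx hy
    rw [add_mul, add_mul]
    refine Nat.add_le_add (hx.trans ?_) (hy.trans ?_) <;>
      exact Nat.mul_le_mul_right _ (Nat.mul_le_mul_left _ (mono (by simp) (by simp)))
  induction p generalizing s with
  | skip => simpa [cost, coeff, degree] using hs.short.pos
  | asg r e =>
    have h₁ := Expr.cost_le hs.short e
    have h₂ := Expr.size_eval_le hs.short e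
    have := hs.short.pos
    simp only [cost, coeff, degree, pow_zero, mul_one]
    nlinarith
  | sto a e =>
    have h₁ := Expr.cost_le hs.short e
    have h₂ := Expr.size_eval_le hs.short e
    have h₃ := Expr.cost_le hs.short a
    have h₄ := Expr.size_eval_le hs.short a
    have := hs.short.pos
    simp only [cost, coeff, degree, pow_zero, mul_one]
    nlinarith
  | seq p q ihp ihq =>
    simp only [capped, Bool.and_eq_true] at hp
    have h₁ := ihp hp.1 hs hd
    have h₂ := ihq hp.2 (capped_run hm hp.1 hs)
      (fun c hc hm => by rw [run_reg (writes_of_capped hp.1 hm)]; exact hd c hc hm)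
    rw [run_reg (writes_of_capped hp.1 hm)] at h₂
    exact two p q h₁ h₂
  | ite e p q ihp ihq =>
    simp only [capped, Bool.and_eq_true] at hp
    have h₁ := ihp hp.1 hs hd
    have h₂ := ihq hp.2 hs hd
    have h₃ := Expr.cost_le hs.short e
    have h₄ := Expr.size_eval_le hs.short e
    have h₅ := two p q h₁ h₂
    have h₆ := hs.short.pos
    simp only [cost, coeff, degree]
    have h₇ : (if e.eval s ≠ 0 then p.cost s else q.cost s) ≤ p.cost s + q.cost s := by
      split <;> omega
    set D := n ^ (max (p.degree d) (q.degree d)) * R ^ (max (p.degree d') (q.degree d'))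
    have h₈ : 1 ≤ D := Nat.mul_pos (Nat.pow_pos hn) (Nat.pow_pos hR)
    have h₉ : (e.weight + (2 + e.len)) * (s.reg capReg).size ≤
        (e.weight + (2 + e.len)) * D * (s.reg capReg).size :=
      Nat.mul_le_mul_right _ (Nat.le_mul_of_pos_right _ h₈)
    have h₁₀ : e.cost s + (2 + (e.eval s).size) ≤
        (e.weight + (2 + e.len)) * (s.reg capReg).size := by nlinarith
    calc _ ≤ (e.weight + (2 + e.len)) * D * (s.reg capReg).size +
          (p.coeff + q.coeff) * D * (s.reg capReg).size :=
        Nat.add_le_add (h₁₀.trans h₉) (h₇.trans h₅)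
      _ = _ := by ring
  | loop i c p ih =>
    simp only [capped, Bool.and_eq_true, decide_eq_true_eq] at hp
    have hi : i ≠ capReg := by omega
    set L := (s.reg capReg).size with hL
    set D := n ^ p.degree d * R ^ p.degree d' with hD
    have hD₁ : 1 ≤ D := Nat.mul_pos (Nat.pow_pos hn) (Nat.pow_pos hR)
    have hL₁ : 1 ≤ L := hs.short.pos
    have hDL : 1 ≤ D * L := Nat.mul_pos hD₁ hL₁
    -- Beside its body a round costs at most `6 + 2 * L ≤ 8 * L`; the `2 + L ≤ 3 * L` outside the
    -- rounds completes the `11` in `coeff`.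
    have key := iterCost_le (f := fun m s => p.run (s.setReg i m))
      (g := fun m s => 6 + 2 * (m + 1).size + p.cost (s.setReg i m)) (m := s.reg c)
      (s := s.setReg i (s.reg c)) (T := (p.coeff + 8) * (D * L))
      (fun _ (s' : State) => s'.Capped ∧ ∀ r < m, s'.reg r = s.reg r)
      ⟨hs.setReg hi (hs.reg c), fun r hr => by simp [show r ≠ i by omega]⟩ ?_
    · have h₁ : s.reg c * ((p.coeff + 8) * (D * L)) ≤
          (p.coeff + 8) * (n ^ d c * R ^ d' c * (D * L)) := by
        calc _ ≤ n ^ d c * R ^ d' c * ((p.coeff + 8) * (D * L)) :=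
              Nat.mul_le_mul_right _ (hd c (by simpa using hp.1.2) hp.1.1.2)
          _ = _ := by ring
      have h₂ : L ≤ n ^ d c * R ^ d' c * (D * L) :=
        (Nat.le_mul_of_pos_left L hD₁).trans
          (Nat.le_mul_of_pos_left _ (Nat.mul_pos (Nat.pow_pos hn) (Nat.pow_pos hR)))
      have h₃ : (s.reg c).size ≤ L := hs.short.reg c
      simp only [cost, coeff, degree]
      calc _ ≤ 2 + L + (p.coeff + 8) * (n ^ d c * R ^ d' c * (D * L)) := by omega
        _ ≤ (p.coeff + 11) * (n ^ d c * R ^ d' c * (D * L)) := by nlinarith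
        _ = _ := by rw [hD]; ring
    · rintro j hj s' ⟨h₁, h₂⟩
      have hcap : s'.reg capReg = s.reg capReg := h₂ _ hm
      have hj' : j + 1 ≤ s'.reg capReg := by rw [hcap]; exact le_trans hj (hs.reg c)
      have h₃ := h₁.setReg (r := i) (x := j) hi (by omega)
      refine ⟨⟨capped_run hm hp.2 h₃, fun r hr => ?_⟩, ?_⟩
      · rw [run_reg (writes_of_capped hp.2 hr)]
        simp [show r ≠ i by omega, h₂ r hr]
      · have h₄ := ih hp.2 h₃ (fun r hr hrm => by
          simpa [show r ≠ i by omega, h₂ r hrm] using hd r hr hrm)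
        have h₅ : ((s'.setReg i j).reg capReg).size = L := by
          simp [hi.symm, hcap, hL]
        rw [h₅, mul_assoc] at h₄
        have h₆ : (j + 1).size ≤ L := by
          rw [hL, ← hcap]; exact Nat.size_le_size hj'
        have h₇ : L ≤ D * L := Nat.le_mul_of_pos_left L hD₁
        nlinarith

end Stmt

theorem Expr.one_le_len (e : Expr) : 1 ≤ e.len := by
  induction e with
  | var | ld => exact le_rfl
  | lit | op => simp [len]
  | cap a ih => exact ih

namespace Stmt

theorem cost_asg_le {L : ℕ} {s : State} (h : s.Short L) (r : ℕ) (e : Expr)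
    {c : ℕ} (hc : (asg r e).coeff = c) : (asg r e).cost s ≤ c * L := by
  subst hc
  have h₁ := Expr.cost_le h e
  have h₂ := Expr.size_eval_le h e
  have := h.pos
  simp only [cost, coeff]
  nlinarith

theorem cost_sto_le {L : ℕ} {s : State} (h : s.Short L) (a e : Expr) :
    (sto a e).cost s ≤ (sto a e).coeff * L := by
  have h₁ := Expr.cost_le h e
  have h₂ := Expr.size_eval_le h e
  have h₃ := Expr.cost_le h a
  have h₄ := Expr.size_eval_le h a
  have := h.pos
  simp only [cost, coeff]
  nlinarith

end Stmt

theorem State.Short.asg {L l r : ℕ} {s s' : State} {e : Expr} (h : s.Short L)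
    (hs : (Stmt.asg r e).run s = s') (hl : e.len = l) : s'.Short (l * L) := by
  subst hs hl
  exact (h.mono (Nat.le_mul_of_pos_left L e.one_le_len)).setReg r (Expr.size_eval_le h e)

end RAM

/-! ### Sets of vertices as binary numbers -/

namespace PathContraction

open RAM

section Mask

variable {n : ℕ}

/-- The binary number whose digits are the indicator function of `S`. -/
def mask (S : Finset (Fin n)) : ℕ := ∑ i ∈ S, 2 ^ (i : ℕ)

@[simp] theorem mask_empty : mask (∅ : Finset (Fin n)) = 0 := rfl

@[simp] theorem mask_singleton (v : Fin n) : mask {v} = 2 ^ (v : ℕ) := by simp [mask]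

theorem mask_insert {S : Finset (Fin n)} {v : Fin n} (h : v ∉ S) :
    mask (insert v S) = mask S + 2 ^ (v : ℕ) := by
  rw [mask, Finset.sum_insert h, add_comm, mask]

theorem mask_union {S T : Finset (Fin n)} (h : Disjoint S T) :
    mask (S ∪ T) = mask S + mask T := Finset.sum_union h

theorem mask_univ : mask (Finset.univ : Finset (Fin n)) = 2 ^ n - 1 := by
  rw [mask, Fin.sum_univ_eq_sum_range (fun i => 2 ^ i), Nat.geomSum_eq le_rfl]
  simp

theorem mask_compl (S : Finset (Fin n)) : mask Sᶜ = 2 ^ n - 1 - mask S := by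
  have := mask_union (disjoint_compl_right (a := S))
  rw [Finset.union_compl, mask_univ] at this
  omega

theorem mask_lt (S : Finset (Fin n)) : mask S < 2 ^ n := by
  have := mask_union (disjoint_compl_right (a := S))
  rw [Finset.union_compl, mask_univ] at this
  have : 0 < 2 ^ n := Nat.two_pow_pos n
  omega

/-- Inserting elements in increasing order, each new `2 ^ a` exceeds the sum of the earlier powers.
It therefore leaves the digits below `a` alone and sets digit `a` without a carry. -/
theorem mask_digit (S : Finset (Fin n)) (v : Fin n) :
    mask S / 2 ^ (v : ℕ) % 2 = if v ∈ S then 1 else 0 := by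
  induction S using Finset.induction_on_max with
  | empty => simp
  | insert a S ha ih =>
    have hlt : mask S < 2 ^ (a : ℕ) := by
      calc mask S ≤ ∑ i ∈ Finset.range a, 2 ^ i := by
            rw [mask, ← Finset.sum_image (f := fun i => 2 ^ i) (g := fun i : Fin n => (i : ℕ))
              (fun x _ y _ h => Fin.ext h)]
            refine Finset.sum_le_sum_of_subset fun x hx => ?_
            obtain ⟨y, hy, rfl⟩ := Finset.mem_image.1 hx
            exact Finset.mem_range.2 (ha y hy)
        _ < 2 ^ (a : ℕ) := by
            rw [Nat.geomSum_eq le_rfl]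
            have : 0 < 2 ^ (a : ℕ) := Nat.two_pow_pos a
            simp
    have hS : a ∉ S := fun h => lt_irrefl a (ha a h)
    rw [mask_insert hS]
    rcases lt_trichotomy v a with h | h | h
    · obtain ⟨d, hd⟩ := Nat.exists_eq_add_of_lt (show (v : ℕ) < a from h)
      have : 2 ^ (a : ℕ) = 2 ^ (v : ℕ) * (2 * 2 ^ d) := by rw [hd]; ring
      rw [this, Nat.add_mul_div_left _ _ (Nat.two_pow_pos _), Nat.add_mul_mod_self_left, ih]
      simp [h.ne]
    · subst h
      rw [Nat.add_div_right _ (Nat.two_pow_pos _), Nat.div_eq_of_lt hlt]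
      simp
    · have h2 : 2 ^ (a : ℕ) * 2 ≤ 2 ^ (v : ℕ) := by
        rw [← pow_succ]; exact Nat.pow_le_pow_right (by omega) h
      rw [Nat.div_eq_of_lt (by omega)]
      have : v ∉ S := fun h' => lt_asymm h (ha v h')
      simp [h.ne', this]

theorem mask_injective : Function.Injective (mask : Finset (Fin n) → ℕ) := fun S T h => by
  ext v
  have h₁ := mask_digit S v
  rw [h, mask_digit] at h₁
  by_cases hS : v ∈ S <;> by_cases hT : v ∈ T <;> simp_all

end Mask

/-! ### Growing a set along a sequence of bits -/

/-- The rounds with the larger indices come first. -/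
theorem iter_add {σ : Type*} (f : ℕ → σ → σ) (a b : ℕ) (s : σ) :
    iter f (a + b) s = iter f a (iter (fun q => f (q + a)) b s) := by
  induction b generalizing s with
  | zero => rfl
  | succ b ih => rw [← add_assoc, iter, ih, iter, add_comm a b]

section Grow

open Classical

variable {n : ℕ}

/-- A set `inside`, some of its neighbours that have been decided to stay `outside`, and the bits
that will decide on further neighbours. -/
structure Growth (n : ℕ) where
  inside : Finset (Fin n)
  outside : Finset (Fin n)
  bits : ℕ

/-- The vertex `w` is up for decision, because of its neighbour `j`. -/
def Growth.Undecided (G : SimpleGraph (Fin n)) (A : Finset (Fin n)) (g : Growth n) (j w : Fin n) :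
    Prop :=
  G.Adj j w ∧ j ∈ g.inside ∧ w ∉ g.inside ∧ w ∉ g.outside ∧ w ∉ A

/-- A bit is consumed exactly when a vertex is decided, so the number of bits read is the increase
of `Growth.size`. -/
noncomputable def Growth.decide (G : SimpleGraph (Fin n)) (A : Finset (Fin n)) (j w : Fin n)
    (g : Growth n) : Growth n :=
  if g.Undecided G A j w then
    if g.bits % 2 = 1 then ⟨insert w g.inside, g.outside, g.bits / 2⟩
    else ⟨g.inside, insert w g.outside, g.bits / 2⟩
  else g

/-- The number of decided vertices. -/
def Growth.size (g : Growth n) : ℕ := g.inside.card + g.outside.card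

variable {G : SimpleGraph (Fin n)} {A S : Finset (Fin n)}

theorem Growth.size_decide (g : Growth n) (j w : Fin n) :
    (g.decide G A j w).size = g.size + if g.Undecided G A j w then 1 else 0 := by
  unfold decide
  split
  · rename_i h
    obtain ⟨-, -, h₁, h₂, -⟩ := h
    split <;> simp [size, Finset.card_insert_of_notMem, h₁, h₂] <;> omega
  · simp

/-- What holds for all results of growing `S`. -/
structure Growth.Valid (G : SimpleGraph (Fin n)) (A S : Finset (Fin n)) (b : ℕ) (g : Growth n) :
    Prop where
  subset : S ⊆ g.inside
  disjoint : Disjoint g.inside g.outside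
  outside : Disjoint g.outside A
  inside : ∀ w ∈ g.inside, w ∈ A → w ∈ S
  adj : ∀ w ∈ g.outside, ∃ j ∈ g.inside, G.Adj j w
  bits : g.bits ≤ b
  closure : ∀ Q : Finset (Fin n), S ⊆ Q → (∀ j ∈ Q, ∀ w, G.Adj j w → w ∉ A → w ∈ Q) →
    g.inside ⊆ Q

theorem Growth.Valid.decide {b : ℕ} {g : Growth n} (h : g.Valid G A S b) (j w : Fin n) :
    (g.decide G A j w).Valid G A S b := by
  unfold Growth.decide
  split
  · rename_i h'
    obtain ⟨h₁, h₂, h₃, h₄, h₅⟩ := h'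
    have hb : g.bits / 2 ≤ b := (Nat.div_le_self _ _).trans h.bits
    split
    · refine ⟨h.subset.trans (Finset.subset_insert _ _), ?_, h.outside, ?_, ?_, hb, ?_⟩
      · exact Finset.disjoint_insert_left.2 ⟨h₄, h.disjoint⟩
      · intro x hx hA
        rcases Finset.mem_insert.1 hx with rfl | hx
        exacts [absurd hA h₅, h.inside x hx hA]
      · intro x hx
        obtain ⟨y, hy, hxy⟩ := h.adj x hx
        exact ⟨y, Finset.mem_insert_of_mem hy, hxy⟩
      · intro Q hQ hQ'
        have := h.closure Q hQ hQ'
        exact Finset.insert_subset (hQ' j (this h₂) w h₁ h₅) this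
    · refine ⟨h.subset, ?_, ?_, h.inside, ?_, hb, h.closure⟩
      · exact Finset.disjoint_insert_right.2 ⟨h₃, h.disjoint⟩
      · exact Finset.disjoint_insert_left.2 ⟨h₅, h.outside⟩
      · intro x hx
        rcases Finset.mem_insert.1 hx with rfl | hx
        exacts [⟨j, h₂, h₁⟩, h.adj x hx]
  · exact h

theorem Growth.Valid.size_le {b : ℕ} {g : Growth n} (h : g.Valid G A S b) : g.size ≤ n := by
  rw [size, ← Finset.card_union_of_disjoint h.disjoint]
  simpa using Finset.card_le_univ (g.inside ∪ g.outside)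

variable [NeZero n]

/-- As `q` varies, `(q / n, q)` modulo `n` runs through all pairs of vertices with period `n * n`.
The `n * n * n` rounds of `grow` are thus `n` complete passes. -/
noncomputable def Growth.round (G : SimpleGraph (Fin n)) (A : Finset (Fin n)) (q : ℕ)
    (g : Growth n) : Growth n :=
  g.decide G A (Fin.ofNat n (q / n)) (Fin.ofNat n q)

/-- Grow `S`: every neighbour that is not in `A` is included or excluded, as the bits of `b`
tell. -/
noncomputable def grow (G : SimpleGraph (Fin n)) (A S : Finset (Fin n)) (b : ℕ) : Growth n :=
  iter (Growth.round G A) (n * n * n) ⟨S, ∅, b⟩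

theorem Growth.size_le_iter (m : ℕ) (g : Growth n) : g.size ≤ (iter (round G A) m g).size :=
  iter_invariant (fun g' : Growth n => g.size ≤ g'.size) le_rfl fun j _ g' h => by
    have := size_decide (G := G) (A := A) g' (Fin.ofNat n (j / n)) (Fin.ofNat n j)
    change g.size ≤ (g'.decide G A _ _).size
    omega

theorem Growth.iter_eq_self {m : ℕ} {g : Growth n}
    (h : (iter (round G A) m g).size = g.size) :
    iter (round G A) m g = g ∧
      ∀ q < m, ¬ g.Undecided G A (Fin.ofNat n (q / n)) (Fin.ofNat n q) := by
  induction m with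
  | zero => exact ⟨rfl, fun q hq => absurd hq (by omega)⟩
  | succ m ih =>
    have h₁ := size_le_iter (G := G) (A := A) m (round G A m g)
    have h₂ := size_decide (G := G) (A := A) g (Fin.ofNat n (m / n)) (Fin.ofNat n m)
    change (round G A m g).size = _ at h₂
    change (iter (round G A) m (round G A m g)).size = _ at h
    have h₃ : ¬ g.Undecided G A (Fin.ofNat n (m / n)) (Fin.ofNat n m) := by
      intro h'
      rw [if_pos h'] at h₂
      omega
    have h₄ : round G A m g = g := if_neg h₃
    rw [h₄] at h
    obtain ⟨h₅, h₆⟩ := ih h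
    refine ⟨by rw [iter, h₄, h₅], fun q hq => ?_⟩
    rcases Nat.lt_succ_iff_lt_or_eq.1 hq with h' | rfl
    exacts [h₆ q h', h₃]

theorem Growth.round_add (t q : ℕ) (g : Growth n) :
    round G A (q + n * n * t) g = round G A q g := by
  have h₁ : Fin.ofNat n ((q + n * n * t) / n) = Fin.ofNat n (q / n) := by
    apply Fin.ext
    rw [mul_assoc, Nat.add_mul_div_left _ _ (NeZero.pos n)]
    simp
  have h₂ : Fin.ofNat n (q + n * n * t) = Fin.ofNat n q := by
    apply Fin.ext
    simp [mul_assoc]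
  rw [round, round, h₁, h₂]

/-- A pass over all pairs either decides a vertex or changes nothing; in the latter case no pair is
undecided and the state is final. -/
theorem Growth.iter_saturated (t : ℕ) (g : Growth n) :
    (∀ j w, ¬ (iter (round G A) (n * n * t) g).Undecided G A j w) ∨
      g.size + t ≤ (iter (round G A) (n * n * t) g).size := by
  induction t generalizing g with
  | zero => right; simp [iter]
  | succ t ih =>
    rw [mul_add, mul_one, iter_add]
    rw [show (fun q => round G A (q + n * n * t)) = round G A from
      funext fun q => funext fun g => round_add t q g]
    by_cases h : (iter (round G A) (n * n) g).size = g.size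
    · obtain ⟨h₁, h₂⟩ := iter_eq_self h
      have h₃ : ∀ j w, ¬ g.Undecided G A j w := fun j w => by
        -- The pair `(j, w)` is examined in round `w + n * j` of the pass.
        have h₄ := h₂ (w + n * j) (by
          have := w.2
          have := j.2
          nlinarith)
        have h₅ : Fin.ofNat n ((w + n * j) / n) = j := by
          apply Fin.ext
          rw [Nat.add_mul_div_left _ _ (NeZero.pos n)]
          simp [Nat.div_eq_of_lt w.2]
        have h₆ : Fin.ofNat n (w + n * j) = w := by
          apply Fin.ext
          simp [Nat.mod_eq_of_lt w.2]
        rwa [h₅, h₆] at h₄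
      left
      rw [h₁, iter_invariant (fun g' => g' = g) rfl fun q _ g' hg' => by
        rw [hg']; exact if_neg (h₃ _ _)]
      exact h₃
    · have := size_le_iter (G := G) (A := A) (n * n) g
      refine (ih (iter (round G A) (n * n) g)).imp id fun h' => ?_
      omega

theorem grow_valid (b : ℕ) : (grow G A S b).Valid G A S b :=
  iter_invariant (fun g : Growth n => g.Valid G A S b)
    ⟨subset_rfl, by simp, by simp, fun w hw _ => hw, by simp, le_rfl, fun Q hQ _ => hQ⟩
    fun q _ g h => h.decide _ _

/-- If `n` passes did not saturate, at least `n` vertices would be decided; but a vertex `w`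
violating the claim is not among them. -/
theorem grow_saturated (b : ℕ) {j w : Fin n} (hj : j ∈ (grow G A S b).inside)
    (hw : G.Adj j w) :
    w ∈ (grow G A S b).inside ∨ w ∈ (grow G A S b).outside ∨ w ∈ A := by
  by_contra! h
  have hv := grow_valid (G := G) (A := A) (S := S) b
  rcases Growth.iter_saturated (G := G) (A := A) n ⟨S, ∅, b⟩ with h₁ | h₁
  · exact h₁ j w ⟨hw, hj, h.1, h.2.1, h.2.2⟩
  · have h₂ : (grow G A S b).size < n := by
      rw [Growth.size, ← Finset.card_union_of_disjoint hv.disjoint]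
      have : (grow G A S b).inside ∪ (grow G A S b).outside ⊂ Finset.univ :=
        Finset.ssubset_univ_iff.2 fun h' => by
          have := Finset.mem_univ w
          rw [← h', Finset.mem_union] at this
          tauto
      simpa using Finset.card_lt_card this
    change _ ≤ (grow G A S b).size at h₁
    omega

/-- Each question is answered by membership in `T`, and the answers are the binary digits of `b`,
least significant first. Exactly `d` bits are read, so any continuation `c` placed above them is
left over intact. -/
theorem Growth.exists_bits {T : Finset (Fin n)} (m : ℕ) (W O : Finset (Fin n)) (hW : W ⊆ T)
    (hO : Disjoint O T) :
    ∃ (W' O' : Finset (Fin n)) (d b : ℕ), b < 2 ^ d ∧ W' ⊆ T ∧ Disjoint O' T ∧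
      d + (W.card + O.card) = W'.card + O'.card ∧
      ∀ c, iter (round G A) m ⟨W, O, b + 2 ^ d * c⟩ = ⟨W', O', c⟩ := by
  induction m generalizing W O with
  | zero => exact ⟨W, O, 0, 0, by simp, hW, hO, by simp, by simp [iter]⟩
  | succ m ih =>
    set j : Fin n := Fin.ofNat n (m / n) with hj
    set w : Fin n := Fin.ofNat n m with hw
    by_cases h : G.Adj j w ∧ j ∈ W ∧ w ∉ W ∧ w ∉ O ∧ w ∉ A
    · have hu : ∀ c, Undecided G A ⟨W, O, c⟩ j w := fun _ => h
      by_cases hT : w ∈ T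
      · obtain ⟨W', O', d, b, h₁, h₂, h₃, h₄, h₅⟩ :=
          ih (insert w W) O (Finset.insert_subset hT hW) hO
        refine ⟨W', O', d + 1, 1 + 2 * b, by rw [pow_succ]; omega, h₂, h₃, ?_, fun c => ?_⟩
        · rw [Finset.card_insert_of_notMem h.2.2.1] at h₄
          omega
        · rw [iter, ← h₅ c, round, decide, if_pos (hu _)]
          have h₆ : 1 + 2 * b + 2 ^ (d + 1) * c = 1 + 2 * (b + 2 ^ d * c) := by ring
          have h₇ : (1 + 2 * (b + 2 ^ d * c)) % 2 = 1 := by omega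
          have h₈ : (1 + 2 * (b + 2 ^ d * c)) / 2 = b + 2 ^ d * c := by omega
          simp only [h₆, h₇, h₈, if_true, ← hw]
      · obtain ⟨W', O', d, b, h₁, h₂, h₃, h₄, h₅⟩ :=
          ih W (insert w O) hW (Finset.disjoint_insert_left.2 ⟨hT, hO⟩)
        refine ⟨W', O', d + 1, 2 * b, by rw [pow_succ]; omega, h₂, h₃, ?_, fun c => ?_⟩
        · rw [Finset.card_insert_of_notMem h.2.2.2.1] at h₄
          omega
        · rw [iter, ← h₅ c, round, decide, if_pos (hu _)]
          have h₆ : 2 * b + 2 ^ (d + 1) * c = 2 * (b + 2 ^ d * c) := by ring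
          have h₇ : (2 * (b + 2 ^ d * c)) % 2 ≠ 1 := by omega
          have h₈ : (2 * (b + 2 ^ d * c)) / 2 = b + 2 ^ d * c := by omega
          simp only [h₆, h₈, if_neg h₇, ← hw]
    · obtain ⟨W', O', d, b, h₁, h₂, h₃, h₄, h₅⟩ := ih W O hW hO
      refine ⟨W', O', d, b, h₁, h₂, h₃, h₄, fun c => ?_⟩
      rw [iter, ← h₅ c, round, decide]
      congr 1
      exact if_neg h

/-! ### Connectivity in terms of growing. -/

/-- The set `Z` induces a connected subgraph. -/
def Linked (G : SimpleGraph (Fin n)) (Z : Finset (Fin n)) : Prop :=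
  Z.Nonempty ∧ ∀ Q ⊆ Z, Q.Nonempty → (∀ j ∈ Q, ∀ w ∈ Z, G.Adj j w → w ∈ Q) → Q = Z

/-- A set that contains `S` and induces a connected subgraph can be grown from `S`. -/
theorem exists_grow {T : Finset (Fin n)} (hT : Linked G T) (hS : S ⊆ T) (hS' : S.Nonempty)
    (hA : ∀ w ∈ T, w ∈ A → w ∈ S) :
    ∃ (O : Finset (Fin n)) (d b : ℕ), b < 2 ^ d ∧ Disjoint O T ∧ Disjoint O A ∧
      (∀ w ∈ O, ∃ j ∈ T, G.Adj j w) ∧ d = (T \ S).card + O.card ∧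
      ∀ c, grow G A S (b + 2 ^ d * c) = ⟨T, O, c⟩ := by
  obtain ⟨W, O, d, b, hb, hW, hO, hd, h⟩ :=
    Growth.exists_bits (G := G) (A := A) (n * n * n) S ∅ hS (Finset.disjoint_empty_left T)
  have hv := grow_valid (G := G) (A := A) (S := S) (b + 2 ^ d * 0)
  have hs := fun j w => grow_saturated (G := G) (A := A) (S := S) (b + 2 ^ d * 0) (j := j) (w := w)
  rw [show grow G A S (b + 2 ^ d * 0) = ⟨W, O, 0⟩ from h 0] at hv hs
  -- By saturation the grown set is closed under neighbours in `T`: such a neighbour is not in `O`,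
  -- which misses `T`, and if it is in `A` it was in `S` from the start.
  have hWT : W = T := by
    refine hT.2 W hW (hS'.mono hv.subset) fun j hj w hw hjw => ?_
    rcases hs j w hj hjw with h' | h' | h'
    · exact h'
    · exact absurd hw (Finset.disjoint_left.1 hO h')
    · exact hv.subset (hA w hw h')
  subst hWT
  refine ⟨O, d, b, hb, hO, hv.outside, hv.adj, ?_, h⟩
  rw [Finset.card_sdiff_of_subset hS]
  have := Finset.card_le_card hS
  simp at hd
  omega

/-- Growing by zeros: the outside is the neighbourhood. -/
theorem grow_zero : (grow G A S 0).inside = S ∧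
    ∀ w, w ∈ (grow G A S 0).outside ↔ w ∉ S ∧ w ∉ A ∧ ∃ j ∈ S, G.Adj j w := by
  have h₁ : (grow G A S 0).inside = S :=
    (iter_invariant (fun g : Growth n => g.inside = S ∧ g.bits = 0) ⟨rfl, rfl⟩ (by
      rintro q - g ⟨h₁, h₂⟩
      unfold Growth.round Growth.decide
      split <;> simp [h₁, h₂])).1
  have hv := grow_valid (G := G) (A := A) (S := S) 0
  refine ⟨h₁, fun w => ⟨fun hw => ⟨?_, ?_, ?_⟩, ?_⟩⟩
  · rw [← h₁]
    exact Finset.disjoint_right.1 hv.disjoint hw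
  · exact Finset.disjoint_left.1 hv.outside hw
  · obtain ⟨j, hj, h⟩ := hv.adj w hw
    exact ⟨j, h₁ ▸ hj, h⟩
  · rintro ⟨h₂, h₃, j, hj, h⟩
    rw [← h₁] at hj h₂
    rcases grow_saturated 0 hj h with h' | h' | h'
    exacts [absurd h' h₂, h', absurd h' h₃]

/-- Growing by ones: nothing is left outside. -/
theorem grow_ones : (grow G A S (2 ^ n - 1)).outside = ∅ := by
  have h := iter_invariant (f := Growth.round G A) (m := n * n * n) (s := ⟨S, ∅, 2 ^ n - 1⟩)
    (fun g : Growth n => g.Valid G A S (2 ^ n - 1) ∧ g.outside = ∅ ∧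
      ∃ e, g.bits = 2 ^ e - 1 ∧ n ≤ g.size + e)
    ⟨⟨subset_rfl, by simp, by simp, fun w hw _ => hw, by simp, le_rfl, fun Q hQ _ => hQ⟩, rfl,
      n, rfl, by omega⟩ ?_
  · exact h.2.1
  · rintro q - g ⟨h₁, h₂, e, h₃, h₄⟩
    have h₅ := h₁.decide (Fin.ofNat n (q / n)) (Fin.ofNat n q)
    have h₆ := h₅.size_le
    have h₇ := Growth.size_decide (G := G) (A := A) g (Fin.ofNat n (q / n)) (Fin.ofNat n q)
    refine ⟨h₅, ?_⟩
    unfold Growth.round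
    by_cases hu : g.Undecided G A (Fin.ofNat n (q / n)) (Fin.ofNat n q)
    · rw [if_pos hu] at h₇
      -- Since a decision is still to be made, fewer than `n` vertices are decided; hence `e` is
      -- positive and the next bit is `1`.
      obtain ⟨e, rfl⟩ : ∃ e', e = e' + 1 := ⟨e - 1, by omega⟩
      have hpos : 0 < 2 ^ e := Nat.two_pow_pos e
      have h₈ : g.bits % 2 = 1 := by rw [h₃, pow_succ]; omega
      have h₉ : g.bits / 2 = 2 ^ e - 1 := by rw [h₃, pow_succ]; omega
      refine ⟨?_, e, ?_, ?_⟩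
      · rw [Growth.decide, if_pos hu, if_pos h₈, h₂]
      · rw [Growth.decide, if_pos hu, if_pos h₈, h₉]
      · omega
    · simp only [Growth.decide, if_neg hu]
      exact ⟨h₂, e, h₃, h₄⟩

/-- With everything outside `Z` avoided and every other neighbour accepted, growing from `z ∈ Z`
yields the component of `z` in `G[Z]`. This is the test that the program carries out. -/
theorem linked_iff_grow {Z : Finset (Fin n)} :
    Linked G Z ↔ ∃ z, (grow G Zᶜ {z} (2 ^ n - 1)).inside = Z := by
  constructor
  · rintro ⟨⟨z, hz⟩, h⟩
    have hv := grow_valid (G := G) (A := Zᶜ) (S := {z}) (2 ^ n - 1)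
    refine ⟨z, h _ ?_ ⟨z, hv.subset (by simp)⟩ ?_⟩
    · intro w hw
      by_contra hwZ
      have := hv.inside w hw (by simpa using hwZ)
      simp only [Finset.mem_singleton] at this
      exact hwZ (this ▸ hz)
    · intro j hj w hw hjw
      rcases grow_saturated _ hj hjw with h' | h' | h'
      · exact h'
      · simp [grow_ones] at h'
      · simp [hw] at h'
  · rintro ⟨z, h⟩
    have hv := grow_valid (G := G) (A := Zᶜ) (S := {z}) (2 ^ n - 1)
    have hz : z ∈ Z := h ▸ hv.subset (by simp)
    have hc := hv.closure
    rw [h] at hc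
    refine ⟨⟨z, hz⟩, fun Q hQ hne hcl => ?_⟩
    by_cases hzQ : z ∈ Q
    · refine subset_antisymm hQ (hc Q (by simpa using hzQ) fun j hj w hw hwZ => ?_)
      exact hcl j hj w (by simpa using hwZ) hw
    · obtain ⟨x, hx⟩ := hne
      -- The complement in `Z` of a closed set is closed too, and here it contains `z`.
      have := hc (Z \ Q) (by simp [hz, hzQ]) fun j hj w hw hwZ => by
        simp only [Finset.mem_sdiff, Finset.mem_compl, not_not] at hj hwZ ⊢
        exact ⟨hwZ, fun hwQ => hj.2 (hcl w hwQ j hj.1 hw.symm)⟩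
      exact absurd hx (Finset.mem_sdiff.1 (this (hQ hx))).2

/-- A connected set whose neighbours are all in `A` is found by growing from any of its
vertices. -/
theorem grow_component {Z : Finset (Fin n)} (hZ : Linked G Z) (hA : Disjoint Z A)
    (hN : ∀ j ∈ Z, ∀ w, G.Adj j w → w ∉ Z → w ∈ A) {u : Fin n} (hu : u ∈ Z) :
    (grow G A {u} (2 ^ n - 1)).inside = Z := by
  have hv := grow_valid (G := G) (A := A) (S := {u}) (2 ^ n - 1)
  refine hZ.2 _ (hv.closure Z (by simpa using hu) fun j hj w hjw hw => ?_)
    ⟨u, hv.subset (by simp)⟩ fun j hj w hw hjw => ?_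
  · by_contra h
    exact hw (hN j hj w hjw h)
  · rcases grow_saturated _ hj hjw with h' | h' | h'
    · exact h'
    · simp [grow_ones] at h'
    · exact absurd h' (Finset.disjoint_left.1 hA hw)

end Grow

end PathContraction

/-! ### The program -/

namespace RAM

@[simp] theorem Op.apply_add (a b : ℕ) : Op.add.apply a b = a + b := rfl
@[simp] theorem Op.apply_sub (a b : ℕ) : Op.sub.apply a b = a - b := rfl
@[simp] theorem Op.apply_mul (a b : ℕ) : Op.mul.apply a b = a * b := rfl
@[simp] theorem Op.apply_div (a b : ℕ) : Op.div.apply a b = a / b := rfl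

namespace Expr

instance : Add Expr := ⟨.op .add⟩
instance : Sub Expr := ⟨.op .sub⟩
instance : Mul Expr := ⟨.op .mul⟩
instance : Div Expr := ⟨.op .div⟩
instance : Mod Expr := ⟨fun a b => a - b * (a / b)⟩

@[simp] theorem eval_add (s : State) (a b : Expr) : (a + b).eval s = a.eval s + b.eval s := rfl
@[simp] theorem eval_sub (s : State) (a b : Expr) : (a - b).eval s = a.eval s - b.eval s := rfl
@[simp] theorem eval_mul (s : State) (a b : Expr) : (a * b).eval s = a.eval s * b.eval s := rfl
@[simp] theorem eval_div (s : State) (a b : Expr) : (a / b).eval s = a.eval s / b.eval s := rfl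
@[simp] theorem eval_mod (s : State) (a b : Expr) : (a % b).eval s = a.eval s % b.eval s :=
  (Nat.mod_eq_sub _ _).symm

end Expr

infixr:60 " ;; " => Stmt.seq

namespace Stmt

@[simp] theorem run_skip (s : State) : skip.run s = s := rfl
@[simp] theorem run_asg (r : ℕ) (e : Expr) (s : State) :
    (asg r e).run s = s.setReg r (e.eval s) := rfl
@[simp] theorem run_sto (a e : Expr) (s : State) :
    (sto a e).run s = s.setMem (a.eval s) (e.eval s) := rfl
@[simp] theorem run_seq (p q : Stmt) (s : State) : (p ;; q).run s = q.run (p.run s) := rfl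
@[simp] theorem run_ite (e : Expr) (p q : Stmt) (s : State) :
    (ite e p q).run s = if e.eval s ≠ 0 then p.run s else q.run s := rfl
theorem run_loop (i c : ℕ) (p : Stmt) (s : State) : (loop i c p).run s =
    iter (fun m s => p.run (s.setReg i m)) (s.reg c) (s.setReg i (s.reg c)) := rfl

end Stmt

end RAM

namespace PathContraction

open RAM RAM.Expr RAM.Stmt

local notation "rN" => (0 : ℕ)
local notation "rK" => (1 : ℕ)
local notation "rCap" => (2 : ℕ)
local notation "rCube" => (3 : ℕ)
local notation "rBits" => (4 : ℕ)
local notation "rTable" => (5 : ℕ)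
local notation "rFull" => (6 : ℕ)
local notation "rX" => (7 : ℕ)
local notation "rY" => (8 : ℕ)
local notation "rAns" => (9 : ℕ)
local notation "rRound" => (10 : ℕ)
local notation "rV" => (11 : ℕ)
local notation "rU" => (12 : ℕ)
local notation "rB" => (13 : ℕ)
local notation "gIn" => (14 : ℕ)
local notation "gOut" => (15 : ℕ)
local notation "gAvoid" => (16 : ℕ)
local notation "gBits" => (17 : ℕ)
local notation "gIdx" => (18 : ℕ)
local notation "lIdx" => (19 : ℕ)
local notation "lSet" => (20 : ℕ)
local notation "lFlag" => (21 : ℕ)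
local notation "mLeft" => (22 : ℕ)
local notation "mRight" => (23 : ℕ)
local notation "mFlag" => (24 : ℕ)
local notation "mIdx" => (25 : ℕ)
local notation "rP" => (26 : ℕ)
local notation "rW" => (27 : ℕ)
local notation "rRest" => (28 : ℕ)

/-- The power of `2` with the given exponent. -/
def powE (e : Expr) : Expr := .ld (.var rTable + e)

/-- The digit of `a` that belongs to the vertex `e`. -/
def digitE (a e : Expr) : Expr := a / powE e % .lit 2

/-- The vertex that is checked in the current round, together with its neighbour `neighbourE`. -/
def vertexE : Expr := .var gIdx % .var rN

def neighbourE : Expr := .var gIdx / .var rN % .var rN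

/-- The program for `grow`. -/
def growS : Stmt :=
  .asg gOut (.lit 0) ;;
  .loop gIdx rCube
    (.ite (.ld (neighbourE * .var rN + vertexE) * (digitE (.var gIn) neighbourE *
        ((.lit 1 - digitE (.var gIn) vertexE) * ((.lit 1 - digitE (.var gOut) vertexE) *
          (.lit 1 - digitE (.var gAvoid) vertexE)))))
      (.ite (.var gBits % .lit 2)
        (.asg gIn (.cap (.var gIn + powE vertexE)))
        (.asg gOut (.cap (.var gOut + powE vertexE))) ;;
      .asg gBits (.var gBits / .lit 2))
      .skip)

/-- Is the set in register `lSet` connected? -/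
def linkedS : Stmt :=
  .asg lFlag (.lit 0) ;;
  .loop lIdx rN
    (.asg gIn (powE (.var lIdx)) ;;
    .asg gAvoid (.var rFull - .var lSet) ;;
    .asg gBits (.var rFull) ;;
    growS ;;
    .ite (.lit 1 - ((.var gIn - .var lSet) + (.var lSet - .var gIn)))
      (.asg lFlag (.lit 1)) .skip)

/-- Do the sets in the registers `mLeft` and `mRight` meet? -/
def meetS : Stmt :=
  .asg mFlag (.lit 0) ;;
  .loop mIdx rN
    (.ite (digitE (.var mLeft) (.var mIdx) * digitE (.var mRight) (.var mIdx))
      (.asg mFlag (.lit 1)) .skip)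

/-- The address of the mark for the union of the first `ρ` sets being `P`. -/
def addrE (ρ P : Expr) : Expr :=
  .var rTable + .var rN + P * (.var rN + .lit 2) + ρ

/-- The number of the current round. -/
def roundE : Expr := .var rN - .var rRound

/-- Computes `prefixSet` from `v`, `u` and `b`. The bits left by the last bag are kept in `rRest`
for the next one. If `u` lies in the bag, the second growth starts from the empty set and the bag is
the whole prefix. -/
def decodeS : Stmt :=
  .ite (digitE (.var rX) (.var rV))
    (.asg gIn (.var rX) ;; .asg gAvoid (.var rY))
    (.asg gIn (powE (.var rV)) ;; .asg gAvoid (.cap (.var rX + .var rY))) ;;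
  .asg gBits (.var rB) ;;
  growS ;;
  .asg rRest (.var gBits) ;;
  .asg rW (.var gIn) ;;
  .asg gAvoid (.var rW) ;;
  .asg gBits (.var rFull) ;;
  .ite (digitE (.var rW) (.var rU)) (.asg gIn (.lit 0)) (.asg gIn (powE (.var rU))) ;;
  growS ;;
  .asg rP (.cap (.var rW + .var gIn))

/-- Inclusion of `X` in `P` is tested by letting `X` meet the complement of `P`. -/
def firstS : Stmt :=
  .asg lSet (.var rP) ;;
  linkedS ;;
  .asg mLeft (.var rP) ;;
  .asg mRight (.var rY) ;;
  meetS ;;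
  .ite (.var mFlag) (.asg lFlag (.lit 0)) .skip ;;
  .asg mLeft (.var rX) ;;
  .asg mRight (.var rFull - .var rP) ;;
  meetS ;;
  .ite (.var mFlag) (.asg lFlag (.lit 0)) .skip ;;
  .ite (.var lFlag) (.sto (addrE (.lit 1) (.var rP)) (.lit 1)) .skip

/-- Growing with zero bits leaves the neighbourhood of `P` in `gOut`. The outcome of the test
against `Y` remains in `mFlag` while the next bag is grown and tested. -/
def extendS : Stmt :=
  .asg gIn (.var rP) ;;
  .asg gAvoid (.lit 0) ;;
  .asg gBits (.lit 0) ;;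
  growS ;;
  .asg mLeft (.var gOut) ;;
  .asg mRight (.var rY) ;;
  meetS ;;
  .asg gIn (.var gOut) ;;
  .asg gAvoid (.cap (.var rP + .var rY)) ;;
  .asg gBits (.var rRest) ;;
  growS ;;
  .asg rW (.var gIn) ;;
  .asg lSet (.var rW) ;;
  linkedS ;;
  .ite (.var mFlag) (.asg lFlag (.lit 0)) .skip ;;
  .ite (.var lFlag) (.sto (addrE (roundE + .lit 1) (.var rP + .var rW)) (.lit 1)) .skip

/-- The complement of `P` is tried as the last set; the second factor is nonzero iff `n ≤ ρ + 1 +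
k`, where `ρ` is the current round. -/
def finishS : Stmt :=
  .asg lSet (.var rFull - .var rP) ;;
  linkedS ;;
  .ite (.var lFlag * (.lit 1 - (.var rN - (roundE + .lit 1 + .var rK))))
    (.asg rAns (.lit 1)) .skip

def bodyS : Stmt :=
  decodeS ;; firstS ;;
  .ite (.ld (addrE roundE (.var rP))) (extendS ;; finishS) .skip

/-- The main part of the program. -/
def mainS : Stmt :=
  -- The path with one vertex takes `n - 1` contractions.
  .asg rAns (.lit 1 - (.var rN - (.var rK + .lit 1))) ;;
  .loop rRound rN (.loop rV rN (.loop rU rN (.loop rB rBits bodyS)))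

/-- The first part of the program: the powers of `2`, and some constants. -/
def tableS : Stmt :=
  -- This is `min k n`: a larger budget does not help, and `2 ^ k` must have length polynomial in
  -- `n`.
  .asg rK (.var rK - (.var rK - .var rN)) ;;
  .asg rTable (.var rN * .var rN + (.var rN + .var rN)) ;;
  .asg rFull (.lit 1) ;;
  .loop gIdx rN
    (.sto (.var rTable + (.var rN - (.var gIdx + .lit 1))) (.var rFull) ;;
    .asg rFull (.var rFull + .var rFull)) ;;
  -- Here `rFull` is `2 ^ n`. The cap exceeds every value that occurs, yet has length linear in `n`.
  .asg rCap (.lit 64 * (.var rFull * .var rFull * (.var rFull * .var rFull))) ;;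
  .asg rFull (.var rFull - .lit 1) ;;
  .asg rCube (.var rN * .var rN * .var rN)

/-- The second part of the program: the numbers that encode `X` and `Y`, and the number of
sequences of bits. -/
def setsS : Stmt :=
  .asg rBits (.lit 1) ;;
  .loop gIdx rK (.asg rBits (.cap (.var rBits + .var rBits))) ;;
  -- The factor `2 ^ 6` pays for the six exceptional levels in `Layering.card_le`.
  .asg rBits (.cap (.var rBits * .lit 64)) ;;
  .loop gIdx rN
    (.ite (.ld (.var rN * .var rN + .var gIdx))
      (.asg rX (.cap (.var rX + powE (.var gIdx))) ;; .asg rBits (.var rBits / .lit 2)) .skip ;;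
    .ite (.ld (.var rN * .var rN + .var rN + .var gIdx))
      (.asg rY (.cap (.var rY + powE (.var gIdx))) ;; .asg rBits (.var rBits / .lit 2)) .skip)

def solveS : Stmt := tableS ;; setsS ;; mainS ;; .asg rN (.var rAns)

theorem solveS_wf : solveS.wf = true := by decide +kernel

theorem setsS_capped : setsS.capped 4 [0, 1] = true := by decide +kernel

theorem mainS_capped : mainS.capped 9 [0, 3, 4] = true := by decide +kernel

/-- Register `4` holds the number of bit sequences. Degree `1` says that loops over it are never
nested, so the exponential factor is not squared. -/
theorem mainS_degree : mainS.degree (fun c => if c = 4 then 1 else 0) = 1 := by decide +kernel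

/-! ### Correctness of the subprograms. -/

section Correct

open Classical

variable {n : ℕ} {G : SimpleGraph (Fin n)} {X Y : Finset (Fin n)} {k : ℕ} {s : State}

/-- The constants of the program have been computed. -/
structure Ready (G : SimpleGraph (Fin n)) (X Y : Finset (Fin n)) (k : ℕ) (s : State) : Prop where
  regN : s.reg rN = n
  regK : s.reg rK = k
  regCap : s.reg rCap = 64 * (2 ^ n) ^ 4
  regCube : s.reg rCube = n * n * n
  regTable : s.reg rTable = n * n + (n + n)
  regFull : s.reg rFull = 2 ^ n - 1
  regX : s.reg rX = mask X
  regY : s.reg rY = mask Y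
  adj : ∀ j w : Fin n, s.mem (j * n + w) = if G.Adj j w then 1 else 0
  table : ∀ v : Fin n, s.mem (n * n + (n + n) + v) = 2 ^ (v : ℕ)

/-- The constants live in registers below `9` and in the cells up to the end of the table of powers;
marks are stored behind them. -/
theorem Ready.of_eq (h : Ready G X Y k s) {s' : State} (hr : ∀ r < 9, s'.reg r = s.reg r)
    (hm : ∀ a < n * n + (n + n) + n, s'.mem a = s.mem a) : Ready G X Y k s' := by
  refine ⟨?_, ?_, ?_, ?_, ?_, ?_, ?_, ?_, fun j w => ?_, fun v => ?_⟩
  any_goals rw [hr _ (by norm_num)]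
  exacts [h.regN, h.regK, h.regCap, h.regCube, h.regTable, h.regFull, h.regX, h.regY,
    (hm _ (by have := j.2; have := w.2; nlinarith)).trans (h.adj j w),
    (hm _ (by have := v.2; omega)).trans (h.table v)]

theorem Ready.setReg (h : Ready G X Y k s) {r : ℕ} (hr : 9 ≤ r) (x : ℕ) :
    Ready G X Y k (s.setReg r x) :=
  h.of_eq (fun r' hr' => by simp [show r' ≠ r by omega]) fun _ _ => rfl

theorem Ready.setMem (h : Ready G X Y k s) {a : ℕ} (ha : n * n + (n + n) + n ≤ a) (x : ℕ) :
    Ready G X Y k (s.setMem a x) :=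
  h.of_eq (fun r' hr' => rfl) fun a' ha' => by simp [show a' ≠ a by omega]

theorem Ready.min_eq (h : Ready G X Y k s) {x : ℕ} (hx : x ≤ 2 ^ n) :
    min x (s.reg rCap) = x := by
  rw [h.regCap]
  have : 1 ≤ 2 ^ n := Nat.one_le_two_pow
  have : 2 ^ n ≤ (2 ^ n) ^ 4 := Nat.le_self_pow (by norm_num) _
  omega

theorem Ready.eval_powE (h : Ready G X Y k s) {e : Expr} {v : Fin n} (he : e.eval s = v) :
    (powE e).eval s = 2 ^ (v : ℕ) := by
  simp [powE, he, h.regTable, h.table]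

theorem Ready.eval_digitE (h : Ready G X Y k s) {a e : Expr} {S : Finset (Fin n)} {v : Fin n}
    (ha : a.eval s = mask S) (he : e.eval s = v) :
    (digitE a e).eval s = if v ∈ S then 1 else 0 := by
  simp [digitE, h.eval_powE he, ha, mask_digit]

/-- Simulation: a loop of the program runs in step with an iteration on sets. -/
theorem iter_rel {σ τ : Type*} {f : ℕ → σ → σ} {g : ℕ → τ → τ} (R : σ → τ → Prop) {m : ℕ}
    {s : σ} {t : τ} (h₀ : R s t) (h : ∀ j < m, ∀ s t, R s t → R (f j s) (g j t)) :
    R (iter f m s) (iter g m t) := by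
  induction m generalizing s t with
  | zero => exact h₀
  | succ m ih => exact ih (h m (by omega) s t h₀) fun j hj => h j (by omega)

theorem run_growS_reg {r : ℕ} (h : r ≠ gIn ∧ r ≠ gOut ∧ r ≠ gBits ∧ r ≠ gIdx) :
    (growS.run s).reg r = s.reg r :=
  run_reg (by simp [growS, writes, h]) s

@[simp] theorem run_growS_mem : (growS.run s).mem = s.mem := run_mem rfl s

theorem Ready.run_growS (h : Ready G X Y k s) : Ready G X Y k (growS.run s) :=
  h.of_eq (fun r hr => run_growS_reg (by omega)) fun _ _ => by rw [run_growS_mem]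

theorem run_growS [NeZero n] {S A : Finset (Fin n)} {b : ℕ} (h : Ready G X Y k s)
    (hS : s.reg gIn = mask S) (hA : s.reg gAvoid = mask A) (hb : s.reg gBits = b) :
    (growS.run s).reg gIn = mask (grow G A S b).inside ∧
      (growS.run s).reg gOut = mask (grow G A S b).outside ∧
      (growS.run s).reg gBits = (grow G A S b).bits := by
  refine (?_ : Ready G X Y k (growS.run s) ∧ (growS.run s).reg gAvoid = mask A ∧ _).2.2
  rw [growS, run_seq, run_asg, run_loop]
  have hc : ((s.setReg gOut ((Expr.lit 0).eval s)).reg rCube) = n * n * n := by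
    simp [h.regCube]
  rw [hc]
  refine iter_rel (fun (s : State) (g : Growth n) => Ready G X Y k s ∧ s.reg gAvoid = mask A ∧
    s.reg gIn = mask g.inside ∧ s.reg gOut = mask g.outside ∧ s.reg gBits = g.bits)
    ⟨(h.setReg (by norm_num) _).setReg (by norm_num) _, by simp [hA],
    by simp [hS], by simp, by simp [hb]⟩ ?_
  rintro q hq s g ⟨h, hA, hW, hO, hB⟩
  have h' : Ready G X Y k (s.setReg gIdx q) := h.setReg (by norm_num) _
  obtain ⟨j, hj⟩ : ∃ j, j = Fin.ofNat n (q / n) := ⟨_, rfl⟩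
  obtain ⟨w, hw⟩ : ∃ w, w = Fin.ofNat n q := ⟨_, rfl⟩
  have ej : neighbourE.eval (s.setReg gIdx q) = j := by
    simp [neighbourE, hj, h.regN]
  have ew : vertexE.eval (s.setReg gIdx q) = w := by
    simp [vertexE, hw, h.regN]
  have hW' : (Expr.var gIn).eval (s.setReg gIdx q) = mask g.inside := by simp [hW]
  have hO' : (Expr.var gOut).eval (s.setReg gIdx q) = mask g.outside := by simp [hO]
  have hA' : (Expr.var gAvoid).eval (s.setReg gIdx q) = mask A := by simp [hA]
  simp only [run_ite, eval_mul, eval_sub, h'.eval_digitE hW' ej, h'.eval_digitE hW' ew,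
    h'.eval_digitE hO' ew, h'.eval_digitE hA' ew, Growth.round, ← hj, ← hw, Growth.decide]
  have hadj : (Expr.ld (neighbourE * .var rN + vertexE)).eval (s.setReg gIdx q) =
      if G.Adj j w then 1 else 0 := by
    simp [ej, ew, h.regN, h.adj]
  have hcond : (Expr.ld (neighbourE * .var rN + vertexE)).eval (s.setReg gIdx q) *
      ((if j ∈ g.inside then 1 else 0) * (((Expr.lit 1).eval (s.setReg gIdx q) -
        (if w ∈ g.inside then 1 else 0)) * (((Expr.lit 1).eval (s.setReg gIdx q) -
        (if w ∈ g.outside then 1 else 0)) * ((Expr.lit 1).eval (s.setReg gIdx q) -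
        (if w ∈ A then 1 else 0))))) ≠ 0 ↔ g.Undecided G A j w := by
    rw [hadj, Growth.Undecided]
    by_cases h₁ : G.Adj j w <;> by_cases h₂ : j ∈ g.inside <;> by_cases h₃ : w ∈ g.inside <;>
      by_cases h₄ : w ∈ g.outside <;> by_cases h₅ : w ∈ A <;> simp [h₁, h₂, h₃, h₄, h₅]
  by_cases hu : g.Undecided G A j w
  · rw [if_pos (hcond.2 hu), if_pos hu]
    obtain ⟨-, -, h₁, h₂, -⟩ := hu
    have hB' : (Expr.var gBits % .lit 2).eval (s.setReg gIdx q) = g.bits % 2 := by simp [hB]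
    simp only [run_seq, run_ite, run_asg, hB']
    by_cases hbit : g.bits % 2 = 1
    -- The sum is again a mask and so lies below the cap: truncation has no effect.
    · have hm : mask g.inside + 2 ^ (w : ℕ) ≤ 2 ^ n := by
        rw [← mask_insert h₁]; exact (mask_lt _).le
      rw [if_pos (by omega : g.bits % 2 ≠ 0), if_pos hbit]
      refine ⟨((h'.setReg (by norm_num) _).setReg (by norm_num) _), ?_, ?_, ?_, ?_⟩
      · simp [hA]
      · have := h.min_eq hm
        simp [hW, mask_insert h₁, capReg, this, h'.eval_powE ew]
      · simp [hO]
      · simp [hB]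
    · have hm : mask g.outside + 2 ^ (w : ℕ) ≤ 2 ^ n := by
        rw [← mask_insert h₂]; exact (mask_lt _).le
      rw [if_neg (by omega : ¬ g.bits % 2 ≠ 0), if_neg hbit]
      refine ⟨((h'.setReg (by norm_num) _).setReg (by norm_num) _), ?_, ?_, ?_, ?_⟩
      · simp [hA]
      · simp [hW]
      · have := h.min_eq hm
        simp [hO, mask_insert h₂, capReg, this, h'.eval_powE ew]
      · simp [hB]
  · rw [if_neg (fun h => hu (hcond.1 h)), if_neg hu]
    exact ⟨h', by simp [hA], by simp [hW], by simp [hO], by simp [hB]⟩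

theorem run_linkedS_reg {r : ℕ} (h : r ≠ gIn ∧ r ≠ gOut ∧ r ≠ gBits ∧ r ≠ gIdx ∧ r ≠ gAvoid ∧
    r ≠ lIdx ∧ r ≠ lFlag) : (linkedS.run s).reg r = s.reg r :=
  run_reg (by simp [linkedS, growS, writes, h]) s

@[simp] theorem run_linkedS_mem : (linkedS.run s).mem = s.mem := run_mem rfl s

theorem Ready.run_linkedS (h : Ready G X Y k s) : Ready G X Y k (linkedS.run s) :=
  h.of_eq (fun r hr => run_linkedS_reg (by omega)) fun _ _ => by rw [run_linkedS_mem]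

theorem run_linkedS [NeZero n] {Z : Finset (Fin n)} (h : Ready G X Y k s)
    (hZ : s.reg lSet = mask Z) :
    (linkedS.run s).reg lFlag = if Linked G Z then 1 else 0 := by
  rw [linkedS, run_seq, run_asg, run_loop]
  have hc : ((s.setReg lFlag ((Expr.lit 0).eval s)).reg rN) = n := by
    simp [h.regN]
  rw [hc]
  have key := iter_induction (f := fun m s => Stmt.run (.asg gIn (powE (.var lIdx)) ;;
      .asg gAvoid (.var rFull - .var lSet) ;;
      .asg gBits (.var rFull) ;;
      growS ;;
      .ite (.lit 1 - ((.var gIn - .var lSet) + (.var lSet - .var gIn)))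
        (.asg lFlag (.lit 1)) .skip) (s.setReg lIdx m)) (m := n)
    (s := (s.setReg lFlag ((Expr.lit 0).eval s)).setReg lIdx n)
    -- The flag records whether one of the starting vertices tried so far, those from `m` on,
    -- reproduces `Z`.
    (fun m (s : State) => Ready G X Y k s ∧ s.reg lSet = mask Z ∧ s.reg lFlag =
      if ∃ z : Fin n, m ≤ z ∧ (grow G Zᶜ {z} (2 ^ n - 1)).inside = Z then 1 else 0)
    ⟨(h.setReg (by norm_num) _).setReg (by norm_num) _, by simp [hZ], ?_⟩ ?_
  · rw [key.2.2]
    simp [linked_iff_grow]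
  · rw [if_neg]
    · simp
    · rintro ⟨z, hz, -⟩
      exact absurd z.2 (by omega)
  · rintro j hj s ⟨h, hZ, hF⟩
    have h₁ := h.setReg (r := lIdx) (by norm_num) j
    have e₁ := h₁.eval_powE (e := .var lIdx) (v := ⟨j, hj⟩) (by simp)
    simp only [run_seq, run_asg, run_ite, e₁]
    set s₁ := ((((s.setReg lIdx j).setReg gIn (2 ^ ((⟨j, hj⟩ : Fin n) : ℕ))).setReg gAvoid
      ((Expr.var rFull - Expr.var lSet).eval ((s.setReg lIdx j).setReg gIn
        (2 ^ ((⟨j, hj⟩ : Fin n) : ℕ))))).setReg gBits ((Expr.var rFull).eval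
          (((s.setReg lIdx j).setReg gIn (2 ^ ((⟨j, hj⟩ : Fin n) : ℕ))).setReg gAvoid
      ((Expr.var rFull - Expr.var lSet).eval ((s.setReg lIdx j).setReg gIn
        (2 ^ ((⟨j, hj⟩ : Fin n) : ℕ))))))) with hs₁
    have h₂ : Ready G X Y k s₁ :=
      ((h₁.setReg (by norm_num) _).setReg (by norm_num) _).setReg (by norm_num) _
    have h₃ := (run_growS (S := {⟨j, hj⟩}) (A := Zᶜ) (b := 2 ^ n - 1) h₂ (by simp [hs₁])
      (by simp [hs₁, mask_compl, h.regFull, hZ]) (by simp [hs₁, h.regFull])).1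
    have h₄ : (growS.run s₁).reg lSet = mask Z := by
      rw [run_growS_reg (by norm_num)]; simp [hs₁, hZ]
    have h₅ : (growS.run s₁).reg lFlag = s.reg lFlag := by
      rw [run_growS_reg (by norm_num)]; simp [hs₁]
    have h₆ := h₂.run_growS
    set s₂ := growS.run s₁
    -- Both truncated differences vanish iff the two masks are equal.
    have hcond : (Expr.lit 1 - ((Expr.var gIn - Expr.var lSet) +
        (Expr.var lSet - Expr.var gIn))).eval s₂ ≠ 0 ↔
        (grow G Zᶜ {⟨j, hj⟩} (2 ^ n - 1)).inside = Z := by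
      simp only [eval_sub, Expr.eval, h₃, h₄, Op.apply_add]
      rw [← mask_injective.eq_iff]
      omega
    have hex : (∃ z : Fin n, j ≤ z ∧ (grow G Zᶜ {z} (2 ^ n - 1)).inside = Z) ↔
        (grow G Zᶜ {⟨j, hj⟩} (2 ^ n - 1)).inside = Z ∨
        ∃ z : Fin n, j + 1 ≤ z ∧ (grow G Zᶜ {z} (2 ^ n - 1)).inside = Z := by
      constructor
      · rintro ⟨z, hz, hz'⟩
        rcases Nat.eq_or_lt_of_le hz with h' | h'
        · left
          rwa [show (⟨j, hj⟩ : Fin n) = z from Fin.ext h']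
        · exact .inr ⟨z, h', hz'⟩
      · rintro (h' | ⟨z, hz, hz'⟩)
        exacts [⟨⟨j, hj⟩, le_rfl, h'⟩, ⟨z, by omega, hz'⟩]
    by_cases hg : (grow G Zᶜ {⟨j, hj⟩} (2 ^ n - 1)).inside = Z
    · rw [if_pos (hcond.2 hg), if_pos (hex.2 (.inl hg))]
      exact ⟨h₆.setReg (by norm_num) _, by simp [h₄], by simp⟩
    · rw [if_neg (fun h => hg (hcond.1 h)), run_skip, h₅, hF]
      exact ⟨h₆, h₄, by simp only [hex, hg, false_or]⟩

theorem run_meetS_reg {r : ℕ} (h : r ≠ mFlag ∧ r ≠ mIdx) : (meetS.run s).reg r = s.reg r :=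
  run_reg (by simp [meetS, writes, h]) s

@[simp] theorem run_meetS_mem : (meetS.run s).mem = s.mem := run_mem rfl s

theorem Ready.run_meetS (h : Ready G X Y k s) : Ready G X Y k (meetS.run s) :=
  h.of_eq (fun r hr => run_meetS_reg (by omega)) fun _ _ => by rw [run_meetS_mem]

theorem run_meetS {S T : Finset (Fin n)} (h : Ready G X Y k s) (hS : s.reg mLeft = mask S)
    (hT : s.reg mRight = mask T) :
    (meetS.run s).reg mFlag = if Disjoint S T then 0 else 1 := by
  rw [meetS, run_seq, run_asg, run_loop]
  have hc : ((s.setReg mFlag ((Expr.lit 0).eval s)).reg rN) = n := by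
    simp [h.regN]
  rw [hc]
  have key := iter_induction (f := fun m s => Stmt.run (.ite (digitE (.var mLeft) (.var mIdx) *
      digitE (.var mRight) (.var mIdx)) (.asg mFlag (.lit 1)) .skip) (s.setReg mIdx m)) (m := n)
    (s := (s.setReg mFlag ((Expr.lit 0).eval s)).setReg mIdx n)
    (fun m (s : State) => Ready G X Y k s ∧ s.reg mLeft = mask S ∧ s.reg mRight = mask T ∧
      s.reg mFlag = if ∃ z : Fin n, m ≤ z ∧ z ∈ S ∧ z ∈ T then 1 else 0)
    ⟨(h.setReg (by norm_num) _).setReg (by norm_num) _, by simp [hS], by simp [hT], ?_⟩ ?_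
  · rw [key.2.2.2]
    by_cases hd : Disjoint S T
    · rw [if_pos hd, if_neg]
      rintro ⟨z, -, h₁, h₂⟩
      exact Finset.disjoint_left.1 hd h₁ h₂
    · rw [if_neg hd, if_pos]
      obtain ⟨z, h₁, h₂⟩ := Finset.not_disjoint_iff.1 hd
      exact ⟨z, by omega, h₁, h₂⟩
  · rw [if_neg]
    · simp
    · rintro ⟨z, hz, -⟩
      exact absurd z.2 (by omega)
  · rintro j hj s ⟨h, hS, hT, hF⟩
    have h₁ := h.setReg (r := mIdx) (by norm_num) j
    have e₁ := h₁.eval_digitE (a := .var mLeft) (e := .var mIdx) (v := ⟨j, hj⟩) (S := S)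
      (by simp [hS]) (by simp)
    have e₂ := h₁.eval_digitE (a := .var mRight) (e := .var mIdx) (v := ⟨j, hj⟩) (S := T)
      (by simp [hT]) (by simp)
    simp only [run_asg, run_ite, eval_mul, e₁, e₂]
    have hex : (∃ z : Fin n, j ≤ z ∧ z ∈ S ∧ z ∈ T) ↔ ((⟨j, hj⟩ : Fin n) ∈ S ∧
        (⟨j, hj⟩ : Fin n) ∈ T) ∨ ∃ z : Fin n, j + 1 ≤ z ∧ z ∈ S ∧ z ∈ T := by
      constructor
      · rintro ⟨z, hz, hz'⟩
        rcases Nat.eq_or_lt_of_le hz with h' | h'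
        · left
          rwa [show (⟨j, hj⟩ : Fin n) = z from Fin.ext h']
        · exact .inr ⟨z, h', hz'⟩
      · rintro (h' | ⟨z, hz, hz'⟩)
        exacts [⟨⟨j, hj⟩, le_rfl, h'⟩, ⟨z, by omega, hz'⟩]
    by_cases hg : (⟨j, hj⟩ : Fin n) ∈ S ∧ (⟨j, hj⟩ : Fin n) ∈ T
    · rw [if_pos (by simp [hg.1, hg.2]), if_pos (hex.2 (.inl hg))]
      exact ⟨h₁.setReg (by norm_num) _, by simp [hS], by simp [hT], by simp⟩
    · rw [if_neg (by simpa [and_comm] using hg), run_skip]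
      exact ⟨h₁, by simp [hS], by simp [hT], by simp [hex, hg, hF]⟩

/-- The final state is named and described by properties only, so longer programs can be followed
without unfolding this one. -/
theorem exists_run_growS [NeZero n] {S A : Finset (Fin n)} {b : ℕ} (h : Ready G X Y k s)
    (hS : s.reg gIn = mask S) (hA : s.reg gAvoid = mask A) (hb : s.reg gBits = b) :
    ∃ s', growS.run s = s' ∧ Ready G X Y k s' ∧ s'.mem = s.mem ∧
      (∀ r, r ≠ gIn ∧ r ≠ gOut ∧ r ≠ gBits ∧ r ≠ gIdx → s'.reg r = s.reg r) ∧
      s'.reg gIn = mask (grow G A S b).inside ∧ s'.reg gOut = mask (grow G A S b).outside ∧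
      s'.reg gBits = (grow G A S b).bits :=
  ⟨_, rfl, h.run_growS, run_growS_mem, fun _ => run_growS_reg, run_growS h hS hA hb⟩

theorem exists_run_linkedS [NeZero n] {Z : Finset (Fin n)} (h : Ready G X Y k s)
    (hZ : s.reg lSet = mask Z) :
    ∃ s', linkedS.run s = s' ∧ Ready G X Y k s' ∧ s'.mem = s.mem ∧
      (∀ r, r ≠ gIn ∧ r ≠ gOut ∧ r ≠ gBits ∧ r ≠ gIdx ∧ r ≠ gAvoid ∧ r ≠ lIdx ∧ r ≠ lFlag →
        s'.reg r = s.reg r) ∧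
      s'.reg lFlag = if Linked G Z then 1 else 0 :=
  ⟨_, rfl, h.run_linkedS, run_linkedS_mem, fun _ => run_linkedS_reg, run_linkedS h hZ⟩

theorem exists_run_meetS {S T : Finset (Fin n)} (h : Ready G X Y k s)
    (hS : s.reg mLeft = mask S) (hT : s.reg mRight = mask T) :
    ∃ s', meetS.run s = s' ∧ Ready G X Y k s' ∧ s'.mem = s.mem ∧
      (∀ r, r ≠ mFlag ∧ r ≠ mIdx → s'.reg r = s.reg r) ∧
      s'.reg mFlag = if Disjoint S T then 0 else 1 :=
  ⟨_, rfl, h.run_meetS, run_meetS_mem, fun _ => run_meetS_reg, run_meetS h hS hT⟩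

theorem run_clear (a r : ℕ) : (Stmt.ite (.var a) (.asg r (.lit 0)) .skip).run s =
    s.setReg r (if s.reg a = 0 then s.reg r else 0) := by
  by_cases h : s.reg a = 0
  · ext r'
    · by_cases hr : r' = r <;> simp [h, hr]
    · simp [h]
  · simp [h]

/-- The seed for the last set of a prefix, or for its first set if it meets `X`. -/
noncomputable def seed (X : Finset (Fin n)) (v : Fin n) : Finset (Fin n) :=
  if v ∈ X then X else {v}

/-- Prefixes miss `Y`, and `X` belongs to the first set alone. These vertices are excluded without a
bit, which is where `|X| + |Y|` is saved. -/
noncomputable def avoid (X Y : Finset (Fin n)) (v : Fin n) : Finset (Fin n) :=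
  if v ∈ X then Y else X ∪ Y

noncomputable def lastBag [NeZero n] (G : SimpleGraph (Fin n)) (X Y : Finset (Fin n)) (v : Fin n)
    (b : ℕ) : Growth n :=
  grow G (avoid X Y v) (seed X v) b

/-- The union of the sets up to a last one, which is described by `v` and `b`, where `u` is a
vertex of an earlier set, if there is one. -/
noncomputable def prefixSet [NeZero n] (G : SimpleGraph (Fin n)) (X Y : Finset (Fin n))
    (v u : Fin n) (b : ℕ) : Finset (Fin n) :=
  (lastBag G X Y v b).inside ∪ (grow G (lastBag G X Y v b).inside
    ({u} \ (lastBag G X Y v b).inside) (2 ^ n - 1)).inside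

/-- The neighbourhood of a set. -/
noncomputable def boundary [NeZero n] (G : SimpleGraph (Fin n)) (P : Finset (Fin n)) :
    Finset (Fin n) :=
  (grow G ∅ P 0).outside

/-- The set that comes after a prefix `P`, as described by `b`. -/
noncomputable def nextBag [NeZero n] (G : SimpleGraph (Fin n)) (Y P : Finset (Fin n)) (b : ℕ) :
    Finset (Fin n) :=
  (grow G (P ∪ Y) (boundary G P) b).inside

def IsFirst (G : SimpleGraph (Fin n)) (X Y P : Finset (Fin n)) : Prop :=
  Linked G P ∧ Disjoint P Y ∧ X ⊆ P

/-- The boundary has to be tested against `Y` separately, since growing keeps its seed even where it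
meets the avoided set. -/
def IsNext [NeZero n] (G : SimpleGraph (Fin n)) (Y P : Finset (Fin n)) (b : ℕ) : Prop :=
  Disjoint (boundary G P) Y ∧ Linked G (nextBag G Y P b)

/-- The memory cell for the mark of `P` as a union of `ρ` sets. -/
def addr (n ρ : ℕ) (P : Finset (Fin n)) : ℕ :=
  n * n + (n + n) + n + mask P * (n + 2) + ρ

/-- Quotient and remainder modulo `n + 2` recover `mask P` and `ρ`; the round `n` writes marks for
`ρ = n + 1`. -/
theorem addr_inj {ρ ρ' : ℕ} {P P' : Finset (Fin n)} (hρ : ρ < n + 2) (hρ' : ρ' < n + 2) :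
    addr n ρ P = addr n ρ' P' ↔ ρ = ρ' ∧ P = P' := by
  constructor
  · intro h
    have h' : mask P * (n + 2) + ρ = mask P' * (n + 2) + ρ' := by unfold addr at h; omega
    have h₁ := congrArg (· % (n + 2)) h'
    have h₂ := congrArg (· / (n + 2)) h'
    simp only [Nat.mul_add_mod_self_right, Nat.mod_eq_of_lt hρ, Nat.mod_eq_of_lt hρ'] at h₁
    have e : ∀ a b, b < n + 2 → (a * (n + 2) + b) / (n + 2) = a := fun a b hb => by
      rw [mul_comm, Nat.mul_add_div (by omega), Nat.div_eq_of_lt hb, add_zero]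
    simp only [e _ _ hρ, e _ _ hρ'] at h₂
    exact ⟨h₁, mask_injective h₂⟩
  · rintro ⟨rfl, rfl⟩
    rfl

theorem Ready.eval_addrE (h : Ready G X Y k s) {e f : Expr} {P : Finset (Fin n)}
    (hf : f.eval s = mask P) : (addrE e f).eval s = addr n (e.eval s) P := by
  simp [addrE, addr, h.regTable, h.regN, hf]

theorem exists_run_decodeS [NeZero n] (h : Ready G X Y k s) (hXY : Disjoint X Y) {v u : Fin n}
    {b : ℕ} (hv : s.reg rV = v) (hu : s.reg rU = u) (hb : s.reg rB = b) :
    ∃ s', decodeS.run s = s' ∧ Ready G X Y k s' ∧ s'.mem = s.mem ∧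
      (∀ r ≤ rB, s'.reg r = s.reg r) ∧ s'.reg rP = mask (prefixSet G X Y v u b) ∧
      s'.reg rRest = (lastBag G X Y v b).bits := by
  obtain ⟨s₁, e₁, h₁, m₁, r₁, hS, hA⟩ : ∃ s₁, (Stmt.ite (digitE (.var rX) (.var rV))
      (.asg gIn (.var rX) ;; .asg gAvoid (.var rY))
      (.asg gIn (powE (.var rV)) ;; .asg gAvoid (.cap (.var rX + .var rY)))).run s = s₁ ∧
      Ready G X Y k s₁ ∧ s₁.mem = s.mem ∧
      (∀ r, r ≠ gIn ∧ r ≠ gAvoid → s₁.reg r = s.reg r) ∧ s₁.reg gIn = mask (seed X v) ∧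
      s₁.reg gAvoid = mask (avoid X Y v) := by
    refine ⟨_, rfl, ?_⟩
    rw [run_ite, h.eval_digitE (S := X) (v := v) (by simp [h.regX]) (by simp [hv])]
    by_cases hX : v ∈ X
    · simp only [hX, if_true, run_seq, run_asg, seed, avoid]
      refine ⟨(h.setReg (by norm_num) _).setReg (by norm_num) _, rfl, ?_, ?_, ?_⟩
      · rintro r ⟨h₁, h₂⟩
        simp [h₁, h₂]
      · simp [h.regX]
      · simp [h.regY]
    · simp only [hX, if_false, run_seq, run_asg, seed, avoid]
      refine ⟨(h.setReg (by norm_num) _).setReg (by norm_num) _, rfl, ?_, ?_, ?_⟩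
      · rintro r ⟨h₁, h₂⟩
        simp [h₁, h₂]
      · simp [h.eval_powE (e := .var rV) (v := v) (by simp [hv])]
      · have := h.min_eq (mask_lt (X ∪ Y)).le
        rw [mask_union hXY] at this ⊢
        simp [h.regX, h.regY, capReg, this]
  obtain ⟨s₂, e₂, h₂, m₂, r₂, hW, -, hB⟩ := exists_run_growS (S := seed X v) (A := avoid X Y v)
    (b := b) (h₁.setReg (r := gBits) (by norm_num) b) (by simp [hS]) (by simp [hA]) (by simp)
  have hW' : s₂.reg gIn = mask (lastBag G X Y v b).inside := hW
  have hB' : s₂.reg gBits = (lastBag G X Y v b).bits := hB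
  clear hW hB
  set W := (lastBag G X Y v b).inside with hWdef
  obtain ⟨s₃, hs₃⟩ : ∃ s₃, s₃ = (((s₂.setReg rRest (s₂.reg gBits)).setReg rW
    (s₂.reg gIn)).setReg gAvoid (s₂.reg gIn)).setReg gBits (s₂.reg rFull) := ⟨_, rfl⟩
  have h₃ : Ready G X Y k s₃ := by
    rw [hs₃]
    exact (((h₂.setReg (by norm_num) _).setReg (by norm_num) _).setReg (by norm_num) _).setReg
      (by norm_num) _
  have hd := h₃.eval_digitE (a := .var rW) (e := .var rU) (S := W) (v := u)
    (by simp [hs₃, hW']) (by simp [hs₃, r₂, r₁, hu])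
  obtain ⟨s₄, e₄, h₄, m₄, r₄, hS₄⟩ : ∃ s₄, (Stmt.ite (digitE (.var rW) (.var rU))
      (.asg gIn (.lit 0)) (.asg gIn (powE (.var rU)))).run s₃ = s₄ ∧
      Ready G X Y k s₄ ∧ s₄.mem = s₃.mem ∧
      (∀ r, r ≠ gIn → s₄.reg r = s₃.reg r) ∧ s₄.reg gIn = mask ({u} \ W) := by
    refine ⟨_, rfl, ?_⟩
    rw [run_ite, hd]
    by_cases hX : u ∈ W
    · simp only [hX, if_true, run_asg]
      refine ⟨h₃.setReg (by norm_num) _, rfl, ?_, ?_⟩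
      · intro r h₁
        simp [h₁]
      · rw [Finset.sdiff_eq_empty_iff_subset.2 (by simpa using hX)]
        simp
    · simp only [hX, if_false, run_asg]
      refine ⟨h₃.setReg (by norm_num) _, rfl, ?_, ?_⟩
      · intro r h₁
        simp [h₁]
      · rw [Finset.sdiff_eq_self_of_disjoint (by simpa using hX)]
        simp [h₃.eval_powE (e := .var rU) (v := u) (by simp [hs₃, r₂, r₁, hu])]
  obtain ⟨s₅, e₅, h₅, m₅, r₅, hC, -, -⟩ := exists_run_growS (S := {u} \ W) (A := W)
    (b := 2 ^ n - 1) h₄ hS₄ (by simp [r₄, hs₃, hW']) (by simp [r₄, hs₃, h₂.regFull])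
  -- Adding masks yields the mask of the union only for disjoint sets; the seed misses `W` and the
  -- growth avoids it.
  have hdis : Disjoint W (grow G W ({u} \ W) (2 ^ n - 1)).inside :=
    Finset.disjoint_left.2 fun w hw hw' =>
      (Finset.mem_sdiff.1 ((grow_valid _).inside w hw' hw)).2 hw
  refine ⟨_, rfl, ?_⟩
  have e₆ : decodeS.run s = s₅.setReg rP ((Expr.cap (.var rW + .var gIn)).eval s₅) := by
    simp only [decodeS, run_seq]
    rw [e₁]
    simp only [run_asg]
    rw [show (Expr.var rB).eval s₁ = b by simp [r₁, hb], e₂]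
    rw [show ((((s₂.setReg rRest ((Expr.var gBits).eval s₂)).setReg rW _).setReg gAvoid _).setReg
      gBits _) = s₃ by simp [hs₃], e₄, e₅]
  rw [e₆]
  refine ⟨h₅.setReg (by norm_num) _, ?_, ?_, ?_, ?_⟩
  · simp [m₅, m₄, hs₃, m₂, m₁]
  · intro r hr
    have h₁ : r ≠ rP := by omega
    have h₂ : r ≠ gIn := by omega
    have h₃ : r ≠ gOut := by omega
    have h₄ : r ≠ gBits := by omega
    have h₅ : r ≠ gIdx := by omega
    have h₆ : r ≠ gAvoid := by omega
    have h₇ : r ≠ rRest := by omega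
    have h₈ : r ≠ rW := by omega
    simp [h₁, r₅, h₂, h₃, h₄, h₅, r₄, hs₃, r₂, r₁, h₆, h₇, h₈]
  · have h₆ := h₂.min_eq (mask_lt (prefixSet G X Y v u b)).le
    rw [prefixSet, ← hWdef, mask_union hdis] at h₆ ⊢
    simp only [eval, Op.apply_add, State.reg_setReg, if_true, hC, capReg]
    simpa [hC, r₅, r₄, hs₃, hW', capReg] using h₆
  · simp [r₅, r₄, hs₃, hB']

theorem exists_run_firstS [NeZero n] (h : Ready G X Y k s) {P : Finset (Fin n)}
    (hP : s.reg rP = mask P) :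
    ∃ s', firstS.run s = s' ∧ Ready G X Y k s' ∧
      (∀ r, r ≤ rB ∨ rP ≤ r → s'.reg r = s.reg r) ∧
      ∀ a, s'.mem a = if IsFirst G X Y P ∧ a = addr n 1 P then 1 else s.mem a := by
  obtain ⟨s₁, e₁, h₁, m₁, r₁, f₁⟩ := exists_run_linkedS (Z := P)
    (h.setReg (r := lSet) (by norm_num) (s.reg rP)) (by simp [hP])
  obtain ⟨s₂, e₂, h₂, m₂, r₂, f₂⟩ := exists_run_meetS (S := P) (T := Y)
    ((h₁.setReg (r := mLeft) (by norm_num) (s₁.reg rP)).setReg (r := mRight) (by norm_num)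
      (s₁.reg rY)) (by simp [r₁, hP]) (by simp [h₁.regY])
  obtain ⟨s₃, hs₃⟩ : ∃ s₃, s₃ = (((s₂.setReg lFlag (if s₂.reg mFlag = 0 then s₂.reg lFlag
    else 0)).setReg mLeft (s₂.reg rX)).setReg mRight (s₂.reg rFull - s₂.reg rP)) := ⟨_, rfl⟩
  have h₃ : Ready G X Y k s₃ := by
    rw [hs₃]
    exact (((h₂.setReg (by norm_num) _).setReg (by norm_num) _).setReg (by norm_num) _)
  have hP₃ : s₃.reg rP = mask P := by simp [hs₃, r₂, r₁, hP]
  obtain ⟨s₄, e₄, h₄, m₄, r₄, f₄⟩ := exists_run_meetS (S := X) (T := Pᶜ) h₃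
    (by simp [hs₃, h₂.regX]) (by simp [hs₃, mask_compl, h₂.regFull, r₂, r₁, hP])
  have e₅ : firstS.run s = (Stmt.ite (.var lFlag) (.sto (addrE (.lit 1) (.var rP)) (.lit 1))
      .skip).run (s₄.setReg lFlag (if s₄.reg mFlag = 0 then s₄.reg lFlag else 0)) := by
    simp only [firstS, run_seq, run_clear, run_asg]
    rw [show (Expr.var rP).eval s = s.reg rP from rfl, e₁]
    rw [show (((s₁.setReg mLeft ((Expr.var rP).eval s₁)).setReg mRight _)) =
      (s₁.setReg mLeft (s₁.reg rP)).setReg mRight (s₁.reg rY) by simp, e₂]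
    rw [show (((s₂.setReg lFlag _).setReg mLeft _).setReg mRight _) = s₃ by simp [hs₃], e₄]
  have hflag : (if s₄.reg mFlag = 0 then s₄.reg lFlag else 0) =
      if IsFirst G X Y P then 1 else 0 := by
    have : Disjoint X Pᶜ ↔ X ⊆ P := by
      rw [← le_compl_iff_disjoint_right, compl_compl]
    have c : s₂.reg lFlag = if Linked G P then 1 else 0 := by simp [r₂, f₁]
    have c' : s₄.reg lFlag = if s₂.reg mFlag = 0 then s₂.reg lFlag else 0 := by
      simp [r₄, hs₃]
    rw [c', c, f₂, f₄]
    unfold IsFirst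
    by_cases c₁ : Linked G P <;> by_cases c₂ : Disjoint P Y <;> by_cases c₃ : X ⊆ P <;>
      simp [c₁, c₂, c₃, this]
  rw [hflag] at e₅
  have h₅ := h₄.setReg (r := lFlag) (by norm_num) (if IsFirst G X Y P then 1 else 0)
  have hr : ∀ r, r ≤ rB ∨ rP ≤ r → s₄.reg r = s.reg r := by
    intro r hr
    have c₁ : r ≠ gIn := by omega
    have c₂ : r ≠ gOut := by omega
    have c₃ : r ≠ gBits := by omega
    have c₄ : r ≠ gIdx := by omega
    have c₅ : r ≠ gAvoid := by omega
    have c₆ : r ≠ lIdx := by omega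
    have c₇ : r ≠ lFlag := by omega
    have c₈ : r ≠ mFlag := by omega
    have c₉ : r ≠ mIdx := by omega
    have d₁ : r ≠ mLeft := by omega
    have d₂ : r ≠ mRight := by omega
    have d₃ : r ≠ lSet := by omega
    simp [*]
  have hm : s₄.mem = s.mem := by simp [m₄, hs₃, m₂, m₁]
  refine ⟨_, rfl, ?_⟩
  rw [e₅]
  by_cases hF : IsFirst G X Y P
  · simp only [hF, if_true, true_and] at h₅ ⊢
    rw [run_ite, if_pos (by simp), run_sto, h₅.eval_addrE (P := P) (by simp [r₄, hP₃])]
    refine ⟨h₅.setMem (by unfold addr; omega) _, fun r hr' => ?_, fun a => ?_⟩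
    · have : r ≠ lFlag := by omega
      simp [this, hr r hr']
    · simp [hm]
  · simp only [hF, if_false, false_and] at h₅ ⊢
    rw [run_ite, if_neg (by simp), run_skip]
    refine ⟨h₅, fun r hr' => ?_, fun a => ?_⟩
    · have : r ≠ lFlag := by omega
      simp [this, hr r hr']
    · simp [hm]

theorem exists_run_extendS [NeZero n] (h : Ready G X Y k s) {P : Finset (Fin n)} {b ρ : ℕ}
    (hP : s.reg rP = mask P) (hb : s.reg rRest = b) (hρ : n - s.reg rRound = ρ)
    (hPY : Disjoint P Y) :
    ∃ s', extendS.run s = s' ∧ Ready G X Y k s' ∧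
      (∀ r, r ≤ rB ∨ r = rP → s'.reg r = s.reg r) ∧
      ∀ a, s'.mem a = if IsNext G Y P b ∧ a = addr n (ρ + 1) (P ∪ nextBag G Y P b) then 1
        else s.mem a := by
  obtain ⟨s₁, hs₁⟩ : ∃ s₁, s₁ = ((s.setReg gIn (s.reg rP)).setReg gAvoid 0).setReg gBits 0 :=
    ⟨_, rfl⟩
  have h₁ : Ready G X Y k s₁ := by
    rw [hs₁]
    exact (((h.setReg (by norm_num) _).setReg (by norm_num) _).setReg (by norm_num) _)
  obtain ⟨s₂, e₂, h₂, m₂, r₂, -, f₂, -⟩ := exists_run_growS (S := P) (A := ∅) (b := 0) h₁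
    (by simp [hs₁, hP]) (by simp [hs₁]) (by simp [hs₁])
  have f₂' : s₂.reg gOut = mask (boundary G P) := f₂
  clear f₂
  obtain ⟨s₃, e₃, h₃, m₃, r₃, f₃⟩ := exists_run_meetS (S := boundary G P) (T := Y)
    ((h₂.setReg (r := mLeft) (by norm_num) (s₂.reg gOut)).setReg (r := mRight) (by norm_num)
      (s₂.reg rY)) (by simp [f₂']) (by simp [h₂.regY])
  have hPY' : mask P + mask Y = mask (P ∪ Y) := (mask_union hPY).symm
  obtain ⟨s₄, hs₄⟩ : ∃ s₄, s₄ = ((s₃.setReg gIn (s₃.reg gOut)).setReg gAvoid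
    (mask (P ∪ Y))).setReg gBits (s₃.reg rRest) := ⟨_, rfl⟩
  have h₄ : Ready G X Y k s₄ := by
    rw [hs₄]
    exact (((h₃.setReg (by norm_num) _).setReg (by norm_num) _).setReg (by norm_num) _)
  obtain ⟨s₅, e₅, h₅, m₅, r₅, f₅, -, -⟩ := exists_run_growS (S := boundary G P) (A := P ∪ Y)
    (b := b) h₄ (by simp [hs₄, r₃, f₂']) (by simp [hs₄]) (by simp [hs₄, r₃, r₂, hs₁, hb])
  have f₅' : s₅.reg gIn = mask (nextBag G Y P b) := f₅
  clear f₅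
  obtain ⟨s₆, e₆, h₆, m₆, r₆, f₆⟩ := exists_run_linkedS (Z := nextBag G Y P b)
    ((h₅.setReg (r := rW) (by norm_num) (s₅.reg gIn)).setReg (r := lSet) (by norm_num)
      (s₅.reg gIn)) (by simp [f₅'])
  have e₇ : extendS.run s = (Stmt.ite (.var lFlag)
      (.sto (addrE (roundE + .lit 1) (.var rP + .var rW)) (.lit 1))
      .skip).run (s₆.setReg lFlag (if s₆.reg mFlag = 0 then s₆.reg lFlag else 0)) := by
    simp only [extendS, run_seq, run_clear, run_asg]
    rw [show ((s.setReg gIn _).setReg gAvoid _).setReg gBits _ = s₁ by simp [hs₁], e₂]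
    rw [show (((s₂.setReg mLeft ((Expr.var gOut).eval s₂)).setReg mRight _)) =
      (s₂.setReg mLeft (s₂.reg gOut)).setReg mRight (s₂.reg rY) by simp, e₃]
    have hc := h₃.min_eq (mask_lt (P ∪ Y)).le
    have hc' : (Expr.cap (.var rP + .var rY)).eval (s₃.setReg gIn ((Expr.var gOut).eval s₃)) =
        mask (P ∪ Y) := by
      rw [← hc]
      simp [r₃, r₂, hs₁, hP, h.regY, hPY', capReg]
    rw [hc', show ((s₃.setReg gIn _).setReg gAvoid _).setReg gBits _ = s₄ by simp [hs₄], e₅]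
    rw [show (s₅.setReg rW ((Expr.var gIn).eval s₅)).setReg lSet _ =
      (s₅.setReg rW (s₅.reg gIn)).setReg lSet (s₅.reg gIn) by simp, e₆]
  have hflag : (if s₆.reg mFlag = 0 then s₆.reg lFlag else 0) =
      if IsNext G Y P b then 1 else 0 := by
    have c : s₆.reg mFlag = s₃.reg mFlag := by simp [r₆, r₅, hs₄]
    rw [c, f₃, f₆]
    unfold IsNext
    by_cases c₁ : Linked G (nextBag G Y P b) <;> by_cases c₂ : Disjoint (boundary G P) Y <;>
      simp [c₁, c₂]
  rw [hflag] at e₇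
  have h₇ := h₆.setReg (r := lFlag) (by norm_num) (if IsNext G Y P b then 1 else 0)
  have hr : ∀ r, r ≤ rB ∨ r = rP → s₆.reg r = s.reg r := by
    intro r hr
    have c₁ : r ≠ gIn := by omega
    have c₂ : r ≠ gOut := by omega
    have c₃ : r ≠ gBits := by omega
    have c₄ : r ≠ gIdx := by omega
    have c₅ : r ≠ gAvoid := by omega
    have c₆ : r ≠ lIdx := by omega
    have c₇ : r ≠ lFlag := by omega
    have c₈ : r ≠ mFlag := by omega
    have c₉ : r ≠ mIdx := by omega
    have d₁ : r ≠ mLeft := by omega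
    have d₂ : r ≠ mRight := by omega
    have d₃ : r ≠ lSet := by omega
    have d₄ : r ≠ rW := by omega
    clear hr
    simp [*]
  have hm : s₆.mem = s.mem := by simp [m₆, m₅, hs₄, m₃, m₂, hs₁]
  have hW₆ : s₆.reg rW = mask (nextBag G Y P b) := by simp [r₆, f₅']
  have hP₆ : s₆.reg rP = mask P := by rw [hr _ (by norm_num), hP]
  have hR₆ : s₆.reg rRound = s.reg rRound := hr _ (by norm_num)
  refine ⟨_, rfl, ?_⟩
  rw [e₇]
  by_cases hF : IsNext G Y P b
  · have hdis : Disjoint P (nextBag G Y P b) := by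
      refine Finset.disjoint_left.2 fun w hw hw' => ?_
      have := (grow_valid b).inside w hw' (Finset.mem_union_left _ hw)
      exact ((grow_zero.2 w).1 this).1 hw
    simp only [hF, if_true, true_and] at h₇ ⊢
    rw [run_ite, if_pos (by simp), run_sto,
      h₇.eval_addrE (P := P ∪ nextBag G Y P b) (by simp [hP₆, hW₆, mask_union hdis])]
    refine ⟨h₇.setMem (by unfold addr; omega) _, fun r hr' => ?_, fun a => ?_⟩
    · have : r ≠ lFlag := by omega
      simp [this, hr r hr']
    · simp [hm, roundE, h₆.regN, hR₆, hρ]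
  · simp only [hF, if_false, false_and] at h₇ ⊢
    rw [run_ite, if_neg (by simp), run_skip]
    refine ⟨h₇, fun r hr' => ?_, fun a => ?_⟩
    · have : r ≠ lFlag := by omega
      simp [this, hr r hr']
    · simp [hm]

theorem exists_run_finishS [NeZero n] (h : Ready G X Y k s) {P : Finset (Fin n)} {ρ : ℕ}
    (hP : s.reg rP = mask P) (hρ : n - s.reg rRound = ρ) :
    ∃ s', finishS.run s = s' ∧ Ready G X Y k s' ∧ s'.mem = s.mem ∧
      (∀ r, rRound ≤ r ∧ r ≤ rB → s'.reg r = s.reg r) ∧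
      s'.reg rAns = if Linked G Pᶜ ∧ n ≤ ρ + 1 + k then 1 else s.reg rAns := by
  obtain ⟨s₁, e₁, h₁, m₁, r₁, f₁⟩ := exists_run_linkedS (Z := Pᶜ)
    (h.setReg (r := lSet) (by norm_num) (s.reg rFull - s.reg rP))
    (by simp [hP, mask_compl, h.regFull])
  have e₂ : finishS.run s = (Stmt.ite (.var lFlag * (.lit 1 - (.var rN -
      (roundE + .lit 1 + .var rK)))) (.asg rAns (.lit 1)) .skip).run s₁ := by
    simp only [finishS, run_seq, run_asg]
    rw [show (Expr.var rFull - Expr.var rP).eval s = s.reg rFull - s.reg rP from rfl, e₁]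
  have hc : (Expr.var lFlag * (.lit 1 - (.var rN - (roundE + .lit 1 + .var rK)))).eval s₁ ≠ 0 ↔
      Linked G Pᶜ ∧ n ≤ ρ + 1 + k := by
    have : s₁.reg rRound = s.reg rRound := by simp [r₁]
    simp only [eval_sub, Expr.eval, f₁, roundE, h₁.regN, h₁.regK, this, hρ]
    by_cases c : Linked G Pᶜ
    · simp [c]
      omega
    · simp [c]
  have hr : ∀ r, r ≤ rB → s₁.reg r = s.reg r := by
    intro r hr
    rw [r₁ r (by omega)]
    simp [show r ≠ lSet by omega]
  refine ⟨_, rfl, ?_⟩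
  rw [e₂, run_ite]
  by_cases hF : Linked G Pᶜ ∧ n ≤ ρ + 1 + k
  · rw [if_pos (hc.2 hF), if_pos hF, run_asg]
    refine ⟨h₁.setReg (by norm_num) _, by simp [m₁], fun r hr' => ?_, by simp⟩
    simp [show r ≠ rAns by omega, hr r hr'.2]
  · rw [if_neg (fun h => hF (hc.1 h)), if_neg hF, run_skip]
    exact ⟨h₁, by simp [m₁], fun r hr' => hr r hr'.2, hr _ (by norm_num)⟩

end Correct

/-! ### Invariants of the main loop. -/

section Main

open Classical

variable {n : ℕ} {G : SimpleGraph (Fin n)} {X Y : Finset (Fin n)} {k : ℕ} {s : State}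

/-- `P` is the union of the first `ρ` sets of a possible path witness structure, not containing
the last one. -/
inductive IsPrefix (G : SimpleGraph (Fin n)) (X Y : Finset (Fin n)) : ℕ → Finset (Fin n) → Prop
  | first {P : Finset (Fin n)} : IsFirst G X Y P → IsPrefix G X Y 1 P
  | next {ρ : ℕ} {P W : Finset (Fin n)} : IsPrefix G X Y ρ P →
      (∀ j ∈ P, ∀ w, G.Adj j w → w ∉ P → w ∈ W) → Disjoint P W → Disjoint W Y → Linked G W →
      IsPrefix G X Y (ρ + 1) (P ∪ W)

/-- There is a path witness structure with one set, or with more sets. -/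
def Solvable (G : SimpleGraph (Fin n)) (X Y : Finset (Fin n)) (k : ℕ) : Prop :=
  n ≤ k + 1 ∨ ∃ ρ P, IsPrefix G X Y ρ P ∧ Linked G Pᶜ ∧ n ≤ ρ + 1 + k

theorem IsPrefix.disjoint {ρ : ℕ} {P : Finset (Fin n)} (h : IsPrefix G X Y ρ P) :
    Disjoint P Y := by
  induction h with
  | first h => exact h.2.1
  | next _ _ _ hW _ ih => exact Finset.disjoint_union_left.2 ⟨ih, hW⟩

theorem mem_boundary [NeZero n] {P : Finset (Fin n)} {w : Fin n} :
    w ∈ boundary G P ↔ w ∉ P ∧ ∃ j ∈ P, G.Adj j w := by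
  rw [boundary, grow_zero.2]
  simp

theorem IsPrefix.isNext [NeZero n] {ρ b : ℕ} {P : Finset (Fin n)} (h : IsPrefix G X Y ρ P)
    (h' : IsNext G Y P b) : IsPrefix G X Y (ρ + 1) (P ∪ nextBag G Y P b) := by
  have hv := grow_valid (G := G) (A := P ∪ Y) (S := boundary G P) b
  refine h.next (fun j hj w hw hwP => hv.subset (mem_boundary.2 ⟨hwP, j, hj, hw⟩)) ?_ ?_ h'.2
  · refine Finset.disjoint_left.2 fun w hw hw' => ?_
    exact (mem_boundary.1 (hv.inside w hw' (Finset.mem_union_left _ hw))).1 hw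
  · refine Finset.disjoint_left.2 fun w hw hw' => ?_
    exact Finset.disjoint_left.1 h'.1 (hv.inside w hw (Finset.mem_union_right _ hw')) hw'

def Marked {n : ℕ} (s : State) (ρ : ℕ) (P : Finset (Fin n)) : Prop := s.mem (addr n ρ P) ≠ 0

/-- Marks and a positive answer are not deleted. -/
def Later (s s' : State) : Prop :=
  (∀ a, s.mem a ≠ 0 → s'.mem a ≠ 0) ∧ (s.reg rAns = 1 → s'.reg rAns = 1)

theorem Later.refl (s : State) : Later s s := ⟨fun _ => id, id⟩

theorem Later.trans {s s' s'' : State} (h : Later s s') (h' : Later s' s'') : Later s s'' :=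
  ⟨fun a ha => h'.1 a (h.1 a ha), fun ha => h'.2 (h.2 ha)⟩

theorem Later.of_setReg {s s' : State} {r x : ℕ} (hr : r ≠ rAns) (h : Later (s.setReg r x) s') :
    Later s s' :=
  ⟨h.1, fun ha => h.2 (by simpa [hr.symm] using ha)⟩

/-- The constants of the program are computed, all marks are justified, and so is the answer. -/
structure Sound (G : SimpleGraph (Fin n)) (X Y : Finset (Fin n)) (k : ℕ) (s : State) : Prop where
  ready : Ready G X Y k s
  marked : ∀ ρ < n + 2, ∀ P : Finset (Fin n), Marked s ρ P → IsPrefix G X Y ρ P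
  ans_le : s.reg rAns ≤ 1
  ans : s.reg rAns = 1 → Solvable G X Y k

theorem Sound.setReg (h : Sound G X Y k s) {r : ℕ} (hr : 10 ≤ r) (x : ℕ) :
    Sound G X Y k (s.setReg r x) :=
  ⟨h.ready.setReg (by omega) x, h.marked, by simpa [show rAns ≠ r by omega] using h.ans_le,
    by simpa [show rAns ≠ r by omega] using h.ans⟩

/-- One statement serves both directions: `Sound` is preserved unconditionally, and a marked `P`
gets its extension and its final test. In round `1` being a first set suffices, since `firstS` runs
before the mark is read. -/
theorem exists_run_bodyS [NeZero n] (h : Sound G X Y k s) (hXY : Disjoint X Y) {v u : Fin n}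
    {b ρ : ℕ} (hv : s.reg rV = v) (hu : s.reg rU = u) (hb : s.reg rB = b)
    (hρ : n - s.reg rRound = ρ) {P : Finset (Fin n)} (hP : prefixSet G X Y v u b = P) :
    ∃ s', bodyS.run s = s' ∧ Sound G X Y k s' ∧ Later s s' ∧
      (∀ r, rRound ≤ r ∧ r ≤ rB → s'.reg r = s.reg r) ∧
      (Marked s ρ P ∨ ρ = 1 ∧ IsFirst G X Y P →
        (IsNext G Y P (lastBag G X Y v b).bits →
          Marked s' (ρ + 1) (P ∪ nextBag G Y P (lastBag G X Y v b).bits)) ∧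
        (Linked G Pᶜ ∧ n ≤ ρ + 1 + k → s'.reg rAns = 1)) := by
  have hρn : ρ < n + 1 := by omega
  obtain ⟨s₁, e₁, h₁, m₁, r₁, p₁, b₁⟩ := exists_run_decodeS h.ready hXY hv hu hb
  rw [hP] at p₁
  obtain ⟨s₂, e₂, h₂, r₂, m₂⟩ := exists_run_firstS h₁ p₁
  rw [m₁] at m₂
  have hp₂ : s₂.reg rP = mask P := by rw [r₂ _ (by norm_num), p₁]
  have hr₂ : ∀ r ≤ rB, s₂.reg r = s.reg r := fun r hr => by
    rw [r₂ r (.inl hr), r₁ r hr]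
  have hρ₂ : n - s₂.reg rRound = ρ := by rw [hr₂ _ (by norm_num), hρ]
  have hs₂ : Sound G X Y k s₂ := by
    refine ⟨h₂, fun ρ' hρ' P' hm => ?_, ?_, ?_⟩
    · unfold Marked at hm
      rw [m₂] at hm
      split at hm
      · rename_i hc
        obtain ⟨hF, ha⟩ := hc
        obtain ⟨rfl, rfl⟩ := (addr_inj hρ' (by omega)).1 ha
        exact .first hF
      · exact h.marked ρ' hρ' P' hm
    · rw [hr₂ _ (by norm_num)]; exact h.ans_le
    · rw [hr₂ _ (by norm_num)]; exact h.ans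
  have l₂ : Later s s₂ := by
    refine ⟨fun a ha => ?_, fun ha => by rw [hr₂ _ (by norm_num), ha]⟩
    rw [m₂]
    split
    · exact one_ne_zero
    · exact ha
  have hmark : Marked s ρ P ∨ ρ = 1 ∧ IsFirst G X Y P → Marked s₂ ρ P := by
    rintro (hm | ⟨rfl, hF⟩)
    · exact l₂.1 _ hm
    · unfold Marked
      rw [m₂, if_pos ⟨hF, rfl⟩]
      exact one_ne_zero
  have hcond : (Expr.ld (addrE roundE (.var rP))).eval s₂ = s₂.mem (addr n ρ P) := by
    rw [eval, h₂.eval_addrE (P := P) (by simp [hp₂])]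
    simp [roundE, h₂.regN, hρ₂]
  have e₃ : bodyS.run s = if s₂.mem (addr n ρ P) ≠ 0 then finishS.run (extendS.run s₂) else s₂ := by
    rw [bodyS, run_seq, run_seq, e₁, e₂, run_ite, hcond]
    rfl
  by_cases hM : Marked s₂ ρ P
  · rw [if_pos (show s₂.mem (addr n ρ P) ≠ 0 from hM)] at e₃
    have hpre := hs₂.marked ρ (by omega) P hM
    obtain ⟨s₃, e₄, h₃, r₃, m₃⟩ := exists_run_extendS h₂ hp₂ (r₂ rRest (by norm_num)) hρ₂
      hpre.disjoint
    rw [b₁] at m₃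
    obtain ⟨s₄, e₅, h₄, m₄, r₄, a₄⟩ := exists_run_finishS (ρ := ρ) h₃
      ((r₃ rP (by norm_num)).trans hp₂) (by rw [r₃ _ (by norm_num), hρ₂])
    rw [e₄, e₅] at e₃
    refine ⟨s₄, e₃, ⟨h₄, fun ρ' hρ' P' hm => ?_, ?_, ?_⟩, ?_, ?_, fun _ => ⟨?_, ?_⟩⟩
    · unfold Marked at hm
      rw [m₄, m₃] at hm
      split at hm
      · rename_i hc
        obtain ⟨hF, ha⟩ := hc
        obtain ⟨rfl, rfl⟩ := (addr_inj hρ' (by omega)).1 ha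
        exact hpre.isNext hF
      · exact hs₂.marked ρ' hρ' P' hm
    · rw [a₄]
      split
      · exact le_rfl
      · rw [r₃ _ (by norm_num)]; exact hs₂.ans_le
    · rw [a₄]
      split
      · rename_i hc
        exact fun _ => .inr ⟨ρ, P, hpre, hc⟩
      · rw [r₃ _ (by norm_num)]; exact hs₂.ans
    · refine l₂.trans ⟨fun a ha => ?_, fun ha => ?_⟩
      · rw [m₄, m₃]
        split
        · exact one_ne_zero
        · exact ha
      · rw [a₄, r₃ _ (by norm_num), ha, ite_self]
    · intro r hr
      rw [r₄ r hr, r₃ r (.inl hr.2), hr₂ r hr.2]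
    · intro hn
      unfold Marked
      rw [m₄, m₃, if_pos ⟨hn, rfl⟩]
      exact one_ne_zero
    · intro hl
      rw [a₄, if_pos hl]
  · rw [if_neg (show ¬ s₂.mem (addr n ρ P) ≠ 0 from hM)] at e₃
    exact ⟨s₂, e₃, hs₂, l₂, fun r hr => hr₂ r hr.2, fun hm => absurd (hmark hm) hM⟩

/-- A loop keeps the invariant `A` and establishes `Q`, if round `j₀` establishes `Q`. -/
theorem run_loop_hits {i c m j₀ : ℕ} {p : Stmt} {A Q : State → Prop} {hit : Prop} (hi : 10 ≤ i)
    (hA : ∀ s x, A s → A (s.setReg i x)) (hQ : ∀ s s', Later s s' → Q s → Q s')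
    (hp : ∀ j < m, ∀ s, A s → s.reg i = j →
      A (p.run s) ∧ Later s (p.run s) ∧ (hit → j = j₀ → Q (p.run s)))
    {s : State} (hs : A s) (hc : s.reg c = m) :
    A ((Stmt.loop i c p).run s) ∧ Later s ((Stmt.loop i c p).run s) ∧
      (hit → j₀ < m → Q ((Stmt.loop i c p).run s)) := by
  have key := iter_induction (f := fun m s => p.run (s.setReg i m)) (m := m)
    (s := s.setReg i m) (fun j s' => A s' ∧ Later s s' ∧ (hit → j ≤ j₀ → j₀ < m → Q s'))
    ⟨hA s m hs, (Later.refl _).of_setReg (r := i) (x := m) (by omega),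
      fun _ h₁ h₂ => absurd h₁ (by omega)⟩ ?_
  · rw [run_loop, hc]
    exact ⟨key.1, key.2.1, fun h h' => key.2.2 h (Nat.zero_le _) h'⟩
  · rintro j hj s' ⟨h₁, h₂, h₃⟩
    obtain ⟨h₄, h₅, h₆⟩ := hp j hj (s'.setReg i j) (hA _ _ h₁) (by simp)
    have h₇ : Later s' (p.run (s'.setReg i j)) := h₅.of_setReg (by omega)
    refine ⟨h₄, h₂.trans h₇, fun h h' h'' => ?_⟩
    rcases Nat.eq_or_lt_of_le h' with h₈ | h₈
    · exact h₆ h h₈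
    · exact hQ _ _ h₇ (h₃ h h₈ h'')

/-- One round of the main loop. -/
theorem run_round [NeZero n] (h : Sound G X Y k s) (hXY : Disjoint X Y) {R ρ : ℕ}
    (hR : s.reg rBits = R) (hρ : n - s.reg rRound = ρ) {hit : Prop} {v u : Fin n} {b : ℕ}
    (hb : hit → b < R) {P : Finset (Fin n)} (hP : hit → prefixSet G X Y v u b = P)
    (hM : hit → Marked s ρ P ∨ ρ = 1 ∧ IsFirst G X Y P) {s' : State}
    (hs' : (Stmt.loop rV rN (.loop rU rN (.loop rB rBits bodyS))).run s = s') :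
    Sound G X Y k s' ∧ Later s s' ∧ (hit →
      (IsNext G Y P (lastBag G X Y v b).bits →
        Marked s' (ρ + 1) (P ∪ nextBag G Y P (lastBag G X Y v b).bits)) ∧
      (Linked G Pᶜ ∧ n ≤ ρ + 1 + k → s'.reg rAns = 1)) := by
  subst hs'
  -- With `hit` false only soundness is claimed; with `hit` true the triple `(v, u, b)` is met by
  -- the loops, and `Later` preserves its effect.
  set A : State → Prop := fun s => Sound G X Y k s ∧ s.reg rBits = R ∧ n - s.reg rRound = ρ ∧
    (hit → Marked s ρ P ∨ ρ = 1 ∧ IsFirst G X Y P) with hAdef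
  set Q : State → Prop := fun s' => (IsNext G Y P (lastBag G X Y v b).bits →
        Marked s' (ρ + 1) (P ∪ nextBag G Y P (lastBag G X Y v b).bits)) ∧
      (Linked G Pᶜ ∧ n ≤ ρ + 1 + k → s'.reg rAns = 1) with hQdef
  have hA : ∀ s r x, 11 ≤ r → A s → A (s.setReg r x) := by
    rintro s r x hr ⟨h₁, h₂, h₃, h₄⟩
    exact ⟨h₁.setReg (by omega) x, by simpa [show rBits ≠ r by omega] using h₂,
      by simpa [show rRound ≠ r by omega] using h₃, h₄⟩
  have hQ : ∀ s s', Later s s' → Q s → Q s' := by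
    rintro s s' hl ⟨h₁, h₂⟩
    exact ⟨fun h => hl.1 _ (h₁ h), fun h => hl.2 (h₂ h)⟩
  have body : ∀ s, A s → ∀ v' u' : Fin n, s.reg rV = v' → s.reg rU = u' →
      (A (bodyS.run s) ∧ (bodyS.run s).reg rV = v' ∧ (bodyS.run s).reg rU = u') ∧
      Later s (bodyS.run s) ∧ (hit → v' = v → u' = u → s.reg rB = b → Q (bodyS.run s)) := by
    rintro s ⟨h₁, h₂, h₃, h₄⟩ v' u' hv hu
    obtain ⟨s', e, h₅, h₆, h₇, h₈⟩ := exists_run_bodyS h₁ hXY hv hu rfl h₃ rfl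
    have h₉ : s'.reg rBits = R := by
      rw [← e, run_reg (by decide +kernel), h₂]
    rw [e]
    refine ⟨⟨⟨h₅, h₉, by rw [h₇ _ (by norm_num), h₃], fun hh => (h₄ hh).imp (h₆.1 _) id⟩,
      by rw [h₇ _ (by norm_num), hv], by rw [h₇ _ (by norm_num), hu]⟩, h₆, ?_⟩
    rintro hh rfl rfl hb'
    rw [hb', hP hh] at h₈
    exact h₈ (h₄ hh)
  have bits : ∀ s, A s → ∀ v' u' : Fin n, s.reg rV = v' → s.reg rU = u' →
      (A ((Stmt.loop rB rBits bodyS).run s) ∧ ((Stmt.loop rB rBits bodyS).run s).reg rV = v') ∧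
      Later s ((Stmt.loop rB rBits bodyS).run s) ∧
      (hit → v' = v → u' = u → Q ((Stmt.loop rB rBits bodyS).run s)) := by
    intro s hs v' u' hv hu
    have := run_loop_hits (i := rB) (c := rBits) (m := R) (j₀ := b) (p := bodyS) (Q := Q)
      (A := fun s => A s ∧ s.reg rV = v' ∧ s.reg rU = u') (hit := hit ∧ v' = v ∧ u' = u)
      (by norm_num) (fun s x h => ⟨hA s _ x (by norm_num) h.1, by simp [h.2.1], by simp [h.2.2]⟩)
      hQ (fun j hj s h hsj => by
        obtain ⟨h₁, h₂, h₃⟩ := body s h.1 v' u' h.2.1 h.2.2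
        exact ⟨h₁, h₂, fun hh hj => h₃ hh.1 hh.2.1 hh.2.2 (by rw [hsj, hj])⟩)
      ⟨hs, hv, hu⟩ hs.2.1
    exact ⟨⟨this.1.1, this.1.2.1⟩, this.2.1, fun h₁ h₂ h₃ => this.2.2 ⟨h₁, h₂, h₃⟩ (hb h₁)⟩
  have verts : ∀ s, A s → ∀ v' : Fin n, s.reg rV = v' →
      A ((Stmt.loop rU rN (.loop rB rBits bodyS)).run s) ∧
      Later s ((Stmt.loop rU rN (.loop rB rBits bodyS)).run s) ∧
      (hit → v' = v → Q ((Stmt.loop rU rN (.loop rB rBits bodyS)).run s)) := by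
    intro s hs v' hv
    have := run_loop_hits (i := rU) (c := rN) (m := n) (j₀ := u) (p := .loop rB rBits bodyS)
      (Q := Q) (A := fun s => A s ∧ s.reg rV = v') (hit := hit ∧ v' = v)
      (by norm_num) (fun s x h => ⟨hA s _ x (by norm_num) h.1, by simp [h.2]⟩)
      hQ (fun j hj s h hsj => by
        obtain ⟨h₁, h₂, h₃⟩ := bits s h.1 v' ⟨j, hj⟩ h.2 hsj
        exact ⟨h₁, h₂, fun hh hj => h₃ hh.1 hh.2 (Fin.ext hj)⟩)
      ⟨hs, hv⟩ hs.1.ready.regN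
    exact ⟨this.1.1, this.2.1, fun h₁ h₂ => this.2.2 ⟨h₁, h₂⟩ u.2⟩
  have := run_loop_hits (i := rV) (c := rN) (m := n) (j₀ := v)
    (p := .loop rU rN (.loop rB rBits bodyS)) (Q := Q) (A := A) (hit := hit)
    (by norm_num) (fun s x h => hA s _ x (by norm_num) h)
    hQ (fun j hj s h hsj => by
      obtain ⟨h₁, h₂, h₃⟩ := verts s h ⟨j, hj⟩ hsj
      exact ⟨h₁, h₂, fun hh hj => h₃ hh (Fin.ext hj)⟩)
    ⟨h, hR, hρ, hM⟩ h.ready.regN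
  exact ⟨this.1.1, this.2.1, fun hh => this.2.2 hh v.2⟩

/-- A sequence of prefixes that the program finds. -/
structure Found [NeZero n] (G : SimpleGraph (Fin n)) (X Y : Finset (Fin n)) (k R m : ℕ)
    (P : ℕ → Finset (Fin n)) : Prop where
  first : 1 ≤ m → IsFirst G X Y (P 1)
  le : m ≤ n
  last : 1 ≤ m → Linked G (P m)ᶜ ∧ n ≤ m + 1 + k
  step : ∀ i, 1 ≤ i → i ≤ m → ∃ v u b, b < R ∧ prefixSet G X Y v u b = P i ∧
    (i < m → IsNext G Y (P i) (lastBag G X Y v b).bits ∧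
      P i ∪ nextBag G Y (P i) (lastBag G X Y v b).bits = P (i + 1))

/-- The sequence `P` matters only for completeness; `m = 0` gives the statement without a sequence.
-/
theorem run_mainS [NeZero n] (h : Ready G X Y k s) (hXY : Disjoint X Y)
    (hmem : ∀ a, n * n + (n + n) + n ≤ a → s.mem a = 0) {m : ℕ} {P : ℕ → Finset (Fin n)}
    (hF : Found G X Y k (s.reg rBits) m P) :
    (mainS.run s).reg rAns ≤ 1 ∧ ((mainS.run s).reg rAns = 1 → Solvable G X Y k) ∧
      (n ≤ k + 1 ∨ 1 ≤ m → (mainS.run s).reg rAns = 1) := by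
  rw [mainS, run_seq, run_asg, run_loop]
  have e : (Expr.lit 1 - (Expr.var rN - (Expr.var rK + Expr.lit 1))).eval s =
      1 - (n - (k + 1)) := by
    simp [h.regN, h.regK]
  rw [e]
  set s₀ := s.setReg rAns (1 - (n - (k + 1))) with hs₀
  have h₀ : Sound G X Y k s₀ := by
    refine ⟨h.setReg (by norm_num) _, fun ρ _ P hm => ?_, by simp [hs₀], fun ha => .inl ?_⟩
    · exact absurd (hmem _ (by unfold addr; omega)) hm
    · simp [hs₀] at ha
      omega
  have hc : s₀.reg rN = n := h₀.ready.regN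
  rw [hc]
  have key := iter_induction (f := fun m s => (Stmt.loop rV rN (.loop rU rN
      (.loop rB rBits bodyS))).run (s.setReg rRound m)) (m := n) (s := s₀.setReg rRound n)
    -- With `j` rounds left, rounds `1, …, n - j` are done; round `i` marks `P (i + 1)`, and round
    -- `m` finds the answer.
    (fun j s' => Sound G X Y k s' ∧ Later s₀ s' ∧ s'.reg rBits = s.reg rBits ∧
      (∀ i, 1 ≤ i → i ≤ n - j → i < m → Marked s' (i + 1) (P (i + 1))) ∧
      (1 ≤ m → m ≤ n - j → s'.reg rAns = 1))
    ⟨h₀.setReg (by norm_num) _, (Later.refl _).of_setReg (r := rRound) (x := n) (by norm_num),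
      by simp [hs₀], fun i h₁ h₂ => absurd h₁ (by omega), fun h₁ h₂ => absurd h₁ (by omega)⟩ ?_
  · refine ⟨key.1.ans_le, key.1.ans, ?_⟩
    rintro (h₁ | h₁)
    · exact key.2.1.2 (by simp [hs₀]; omega)
    · exact key.2.2.2.2 h₁ (by simpa using hF.le)
  · rintro j hj s' ⟨h₁, h₂, h₃, h₄, h₅⟩
    obtain ⟨s₂, hs₂⟩ : ∃ s₂, (Stmt.loop rV rN (.loop rU rN (.loop rB rBits bodyS))).run
      (s'.setReg rRound j) = s₂ := ⟨_, rfl⟩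
    have hbits : s₂.reg rBits = s.reg rBits := by
      rw [← hs₂, run_reg (by decide +kernel)]
      simp [h₃]
    change _ ∧ _ ∧ _
    rw [hs₂]
    by_cases hm : n - j ≤ m
    · obtain ⟨v, u, b, hb, hP, hN⟩ := hF.step (n - j) (by omega) hm
      have hM : Marked (s'.setReg rRound j) (n - j) (P (n - j)) ∨
          n - j = 1 ∧ IsFirst G X Y (P (n - j)) := by
        by_cases h₉ : n - j = 1
        · right
          rw [h₉]
          exact ⟨rfl, hF.first (by omega)⟩
        · left
          have := h₄ (n - j - 1) (by omega) (by omega) (by omega)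
          rwa [show n - j - 1 + 1 = n - j by omega] at this
      obtain ⟨h₆, h₇, h₈⟩ := run_round (h₁.setReg (r := rRound) (by norm_num) j) hXY
        (R := s.reg rBits) (ρ := n - j) (by simp [h₃]) (by simp) (hit := True)
        (fun _ => hb) (fun _ => hP) (fun _ => hM) hs₂
      · have h₇' : Later s' s₂ := h₇.of_setReg (by norm_num)
        refine ⟨h₆, h₂.trans h₇', hbits, fun i hi hij him => ?_, fun hm₁ hm₂ => ?_⟩
        · rcases Nat.eq_or_lt_of_le hij with h₉ | h₉
          · subst h₉
            obtain ⟨h₁₀, h₁₁⟩ := hN him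
            rw [← h₁₁]
            exact (h₈ trivial).1 h₁₀
          · exact h₇'.1 _ (h₄ i hi (by omega) him)
        · have h₉ : n - j = m := by omega
          rw [h₉] at h₈
          exact (h₈ trivial).2 (hF.last hm₁)
    · obtain ⟨h₆, h₇, -⟩ := run_round (h₁.setReg (r := rRound) (by norm_num) j) hXY
        (R := s.reg rBits) (ρ := n - j) (by simp [h₃]) (by simp) (hit := False)
        (v := ⟨0, NeZero.pos n⟩) (u := ⟨0, NeZero.pos n⟩) (b := 0) (P := ∅)
        (fun h => h.elim) (fun h => h.elim) (fun h => h.elim) hs₂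
      have h₇' : Later s' s₂ := h₇.of_setReg (by norm_num)
      exact ⟨h₆, h₂.trans h₇', hbits, fun i hi hij him => h₇'.1 _ (h₄ i hi (by omega) him),
        fun hm₁ hm₂ => h₇'.2 (h₅ hm₁ (by omega))⟩

end Main

/-! ### Path witness structures -/

section Layering

open Classical

variable {n : ℕ} {G : SimpleGraph (Fin n)} {X Y : Finset (Fin n)} {k : ℕ}

/-- The vertices reachable from a given one form a closed set; conversely a nonempty closed set
contains everything reachable from it. -/
theorem linked_iff {S : Set (Fin n)} {Z : Finset (Fin n)} (hZ : ∀ v, v ∈ Z ↔ v ∈ S) :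
    Linked G Z ↔ (G.induce S).Connected := by
  constructor
  · rintro ⟨⟨a, ha⟩, h⟩
    have key : ∀ w (hw : w ∈ S), (G.induce S).Reachable ⟨a, (hZ a).1 ha⟩ ⟨w, hw⟩ := by
      have := h (Z.filter fun w => ∃ hw : w ∈ S, (G.induce S).Reachable ⟨a, (hZ a).1 ha⟩ ⟨w, hw⟩)
        (Finset.filter_subset _ _) ⟨a, by simpa [ha] using (hZ a).1 ha⟩ ?_
      · intro w hw
        rw [← hZ, ← this, Finset.mem_filter] at hw
        exact hw.2.2
      · intro j hj w hw hjw
        obtain ⟨-, hj, hr⟩ := Finset.mem_filter.1 hj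
        refine Finset.mem_filter.2 ⟨hw, (hZ w).1 hw, hr.trans ?_⟩
        exact SimpleGraph.Adj.reachable (by simpa using hjw)
    have : Nonempty S := ⟨⟨a, (hZ a).1 ha⟩⟩
    exact ⟨fun x y => (key x x.2).symm.trans (key y y.2)⟩
  · intro h
    obtain ⟨⟨a, ha⟩⟩ := h.nonempty
    refine ⟨⟨a, (hZ a).2 ha⟩, fun Q hQ hne hcl => subset_antisymm hQ fun w hw => ?_⟩
    obtain ⟨q, hq⟩ := hne
    have hr := h.preconnected ⟨q, (hZ q).1 (hQ hq)⟩ ⟨w, (hZ w).1 hw⟩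
    rw [SimpleGraph.reachable_iff_reflTransGen] at hr
    suffices ∀ x : S, Relation.ReflTransGen (G.induce S).Adj ⟨q, (hZ q).1 (hQ hq)⟩ x →
        (x : Fin n) ∈ Q from this _ hr
    intro x hx
    induction hx with
    | refl => exact hq
    | tail _ hyz ih => exact hcl _ ih _ ((hZ _).2 (Subtype.coe_prop _)) (by simpa using hyz)

/-- A closed set that meets `A` or `B` contains it, and then reaches the other one through the edge
`ab`. -/
theorem Linked.union {A B : Finset (Fin n)} (hA : Linked G A) (hB : Linked G B) {a b : Fin n}
    (ha : a ∈ A) (hb : b ∈ B) (hab : G.Adj a b) : Linked G (A ∪ B) := by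
  refine ⟨⟨a, Finset.mem_union_left _ ha⟩, fun Q hQ hne hcl => ?_⟩
  have hcA : ∀ w ∈ Q, w ∈ A → A ⊆ Q := fun w hw hwA => by
    have := hA.2 (Q ∩ A) Finset.inter_subset_right ⟨w, Finset.mem_inter.2 ⟨hw, hwA⟩⟩
      fun j hj w hw hjw => Finset.mem_inter.2
        ⟨hcl j (Finset.mem_inter.1 hj).1 w (Finset.mem_union_left _ hw) hjw, hw⟩
    rw [← this]
    exact Finset.inter_subset_left
  have hcB : ∀ w ∈ Q, w ∈ B → B ⊆ Q := fun w hw hwA => by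
    have := hB.2 (Q ∩ B) Finset.inter_subset_right ⟨w, Finset.mem_inter.2 ⟨hw, hwA⟩⟩
      fun j hj w hw hjw => Finset.mem_inter.2
        ⟨hcl j (Finset.mem_inter.1 hj).1 w (Finset.mem_union_right _ hw) hjw, hw⟩
    rw [← this]
    exact Finset.inter_subset_left
  refine subset_antisymm hQ ?_
  obtain ⟨q, hq⟩ := hne
  rcases Finset.mem_union.1 (hQ hq) with h | h
  · have h₁ := hcA q hq h
    exact Finset.union_subset h₁
      (hcB b (hcl a (h₁ ha) b (Finset.mem_union_right _ hb) hab) hb)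
  · have h₁ := hcB q hq h
    exact Finset.union_subset
      (hcA a (hcl b (h₁ hb) a (Finset.mem_union_left _ ha) hab.symm) ha) h₁

/-- The vertices on level `i`. -/
noncomputable def bag (f : Fin n → ℕ) (i : ℕ) : Finset (Fin n) := Finset.univ.filter (f · = i)

/-- The vertices below level `i`. -/
noncomputable def below (f : Fin n → ℕ) (i : ℕ) : Finset (Fin n) := Finset.univ.filter (f · < i)

@[simp] theorem mem_bag {f : Fin n → ℕ} {i : ℕ} {v : Fin n} : v ∈ bag f i ↔ f v = i := by
  simp [bag]

@[simp] theorem mem_below {f : Fin n → ℕ} {i : ℕ} {v : Fin n} : v ∈ below f i ↔ f v < i := by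
  simp [below]

/-- The levels `0`, …, `m` of the vertices form a path witness structure. -/
structure Layering (G : SimpleGraph (Fin n)) (m : ℕ) (f : Fin n → ℕ) : Prop where
  le : ∀ v, f v ≤ m
  linked : ∀ i ≤ m, Linked G (bag f i)
  adj : ∀ u v, G.Adj u v → f u ≤ f v + 1
  edge : ∀ i < m, ∃ u v, G.Adj u v ∧ f u = i ∧ f v = i + 1

/-- Adjacency in a path means consecutive levels. One inequality per ordered edge suffices, because
edges are symmetric. -/
theorem contractibleVia_iff {m : ℕ} {ψ : Fin n → Fin (m + 1)} :
    ContractibleVia G (SimpleGraph.pathGraph (m + 1)) ψ ↔ Layering G m (fun v => ψ v) := by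
  have hbag : ∀ i : Fin (m + 1), ∀ v, v ∈ bag (fun v => (ψ v : ℕ)) i ↔ v ∈ ψ ⁻¹' {i} := by
    intro i v
    simp [Fin.ext_iff]
  constructor
  · rintro ⟨-, h₁, h₂⟩
    refine ⟨fun v => Nat.lt_succ_iff.1 (ψ v).2, fun i hi => ?_, fun u v huv => ?_, fun i hi => ?_⟩
    · exact (linked_iff (hbag ⟨i, by omega⟩)).2 (h₁ _)
    · by_cases h : ψ u = ψ v
      · simp [h]
      · have := (h₂ _ _ h).1 ⟨u, rfl, v, rfl, huv⟩
        rw [SimpleGraph.pathGraph_adj] at this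
        omega
    · obtain ⟨u, hu, v, hv, huv⟩ := (h₂ ⟨i, by omega⟩ ⟨i + 1, by omega⟩ (by simp)).2
        (by simp [SimpleGraph.pathGraph_adj])
      exact ⟨u, v, huv, congrArg Fin.val hu, congrArg Fin.val hv⟩
  · rintro ⟨-, h₁, h₂, h₃⟩
    refine ⟨fun i => ?_, fun i => ?_, fun i j hij => ⟨?_, fun h => ?_⟩⟩
    · obtain ⟨v, hv⟩ := (h₁ i (by omega)).1
      exact ⟨v, (hbag i v).1 hv⟩
    · exact (linked_iff (hbag i)).1 (h₁ i (by omega))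
    · rintro ⟨u, rfl, v, rfl, huv⟩
      have h₄ := h₂ u v huv
      have h₅ := h₂ v u huv.symm
      have : (ψ u : ℕ) ≠ ψ v := fun h => hij (Fin.ext h)
      rw [SimpleGraph.pathGraph_adj]
      omega
    · rw [SimpleGraph.pathGraph_adj] at h
      rcases h with h | h
      · obtain ⟨u, v, huv, hu, hv⟩ := h₃ i (by omega)
        exact ⟨u, Fin.ext hu, v, Fin.ext (hv.trans h), huv⟩
      · obtain ⟨u, v, huv, hu, hv⟩ := h₃ j (by omega)
        exact ⟨v, Fin.ext (hv.trans h), u, Fin.ext hu, huv.symm⟩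

/-! ### Counting contracted edges -/

section Trees

variable {U : Type*} [Fintype U] {ψ : Fin n → U}

/-- The edges of graphs on the fibres. -/
noncomputable def fibreEdges (T : ∀ h : U, SimpleGraph (ψ ⁻¹' {h})) : Finset (Sym2 (Fin n)) :=
  Finset.univ.biUnion fun h => (T h).edgeFinset.map
    ⟨Sym2.map Subtype.val, Sym2.map.injective Subtype.val_injective⟩

theorem mem_fibreEdges {T : ∀ h : U, SimpleGraph (ψ ⁻¹' {h})} {x y : Fin n} :
    s(x, y) ∈ fibreEdges T ↔
      ∃ h, ∃ (hx : x ∈ ψ ⁻¹' {h}) (hy : y ∈ ψ ⁻¹' {h}), (T h).Adj ⟨x, hx⟩ ⟨y, hy⟩ := by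
  simp only [fibreEdges, Finset.mem_biUnion, Finset.mem_univ, true_and, Finset.mem_map,
    Function.Embedding.coeFn_mk, SimpleGraph.mem_edgeFinset]
  constructor
  · rintro ⟨h, e, he, hxy⟩
    induction e with
    | h a b =>
      rw [Sym2.map_mk, Sym2.eq_iff] at hxy
      rcases hxy with ⟨rfl, rfl⟩ | ⟨rfl, rfl⟩
      · exact ⟨h, a.2, b.2, he⟩
      · exact ⟨h, b.2, a.2, SimpleGraph.Adj.symm he⟩
  · rintro ⟨h, hx, hy, hxy⟩
    exact ⟨h, s(⟨x, hx⟩, ⟨y, hy⟩), hxy, rfl⟩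

/-- A tree has one edge fewer than vertices, and the fibres partition the `n` vertices. -/
theorem card_fibreEdges {T : ∀ h : U, SimpleGraph (ψ ⁻¹' {h})} (hT : ∀ h, (T h).IsTree) :
    (fibreEdges T).card + Fintype.card U = n := by
  rw [fibreEdges, Finset.card_biUnion]
  · have h₁ : ∀ h : U, ((T h).edgeFinset.map ⟨Sym2.map Subtype.val,
        Sym2.map.injective Subtype.val_injective⟩).card + 1 =
          (Finset.univ.filter (ψ · = h)).card := by
      intro h
      rw [Finset.card_map, (hT h).card_edgeFinset, ← Fintype.card_subtype]
      exact Fintype.card_congr (Equiv.refl _)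
    have h₂ : ∑ h : U, (Finset.univ.filter (ψ · = h)).card = n := by
      have := Finset.card_eq_sum_card_fiberwise (f := ψ) (s := Finset.univ) (t := Finset.univ)
        (fun _ _ => Finset.mem_coe.2 (Finset.mem_univ _))
      simpa using this.symm
    have h₃ := Finset.sum_congr rfl fun h (_ : h ∈ Finset.univ) => h₁ h
    rw [h₂, Finset.sum_add_distrib] at h₃
    simpa using h₃
  · intro h _ h' _ hne
    rw [Function.onFun, Finset.disjoint_left]
    intro e he he'
    simp only [Finset.mem_map, Function.Embedding.coeFn_mk] at he he'
    obtain ⟨e₁, -, rfl⟩ := he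
    obtain ⟨e₂, -, h₂⟩ := he'
    induction e₁ with
    | h a b =>
      induction e₂ with
      | h c d =>
        rw [Sym2.map_mk, Sym2.map_mk, Sym2.eq_iff] at h₂
        have ha : ψ a = h := a.2
        have hc : ψ c = h' := c.2
        have hd : ψ d = h' := d.2
        rcases h₂ with ⟨h₂, -⟩ | ⟨-, h₂⟩
        · exact hne (by rw [← ha, ← hc, h₂])
        · exact hne (by rw [← ha, ← hd, h₂])

/-- The number of contracted edges depends only on the number of fibres: `F` contains spanning trees
of all of them, and any choice of spanning trees attains the minimum. -/
theorem exists_spanningTrees_iff (h : ∀ h : U, (G.induce (ψ ⁻¹' {h})).Connected) :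
    (∃ F : Set (Sym2 (Fin n)), F.Finite ∧ IsUnionOfSpanningTrees G ψ F ∧ F.ncard ≤ k) ↔
      n ≤ Fintype.card U + k := by
  constructor
  · rintro ⟨F, hF, ⟨h₁, h₂, h₃⟩, hk⟩
    have hc := card_fibreEdges h₃
    have : ((fibreEdges fun h => (SimpleGraph.fromEdgeSet F).induce (ψ ⁻¹' {h}) :
        Finset (Sym2 (Fin n))) : Set (Sym2 (Fin n))) ⊆ F := by
      intro e he
      induction e with
      | h x y =>
        obtain ⟨h, hx, hy, hxy⟩ := mem_fibreEdges.1 (Finset.mem_coe.1 he)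
        exact ((SimpleGraph.fromEdgeSet_adj F).1 hxy).1
    have := Set.ncard_le_ncard this hF
    rw [Set.ncard_coe_finset] at this
    omega
  · intro hn
    choose T hT hT' using fun u => (h u).exists_isTree_le
    refine ⟨fibreEdges T, Finset.finite_toSet _, ⟨?_, ?_, ?_⟩, ?_⟩
    · intro e he
      induction e with
      | h x y =>
        obtain ⟨h, hx, hy, hxy⟩ := mem_fibreEdges.1 (Finset.mem_coe.1 he)
        exact hT h hxy
    · intro e he
      induction e with
      | h x y =>
        obtain ⟨h, hx, hy, hxy⟩ := mem_fibreEdges.1 (Finset.mem_coe.1 he)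
        refine ⟨h, fun v hv => ?_⟩
        rcases Sym2.mem_iff.1 hv with rfl | rfl
        exacts [hx, hy]
    · intro h
      convert hT' h using 1
      ext ⟨x, hx⟩ ⟨y, hy⟩
      simp only [SimpleGraph.comap_adj, Function.Embedding.subtype_apply,
        SimpleGraph.fromEdgeSet_adj, Finset.mem_coe, mem_fibreEdges]
      constructor
      · rintro ⟨⟨h', hx', hy', hxy⟩, -⟩
        obtain rfl : h = h' := hx.symm.trans hx'
        exact hxy
      · intro hxy
        exact ⟨⟨h, hx, hy, hxy⟩, fun he => hxy.ne (Subtype.ext he)⟩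
    · have := card_fibreEdges hT'
      rw [Set.ncard_coe_finset]
      omega

end Trees

theorem constrainedEnds_iff : ConstrainedEnds G X Y k ↔
    ∃ m f, Layering G m f ∧ n ≤ m + 1 + k ∧ X ⊆ bag f 0 ∧ Y ⊆ bag f m := by
  constructor
  · rintro ⟨m, ψ, ⟨h₁, h₂⟩, hX, hY⟩
    rw [exists_spanningTrees_iff h₁.connected, Fintype.card_fin] at h₂
    refine ⟨m, _, contractibleVia_iff.1 h₁, h₂, fun v hv => ?_, fun v hv => ?_⟩
    · simpa using congrArg Fin.val (hX hv)
    · simpa using congrArg Fin.val (hY hv)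
  · rintro ⟨m, f, h₁, h₂, hX, hY⟩
    refine ⟨m, fun v => ⟨f v, Nat.lt_succ_iff.2 (h₁.le v)⟩, ?_, fun v hv => ?_, fun v hv => ?_⟩
    · have h₃ : ContractibleVia G (SimpleGraph.pathGraph (m + 1))
          (fun v => (⟨f v, Nat.lt_succ_iff.2 (h₁.le v)⟩ : Fin (m + 1))) :=
        contractibleVia_iff.2 h₁
      exact ⟨h₃, (exists_spanningTrees_iff h₃.connected).2 (by simpa using h₂)⟩
    · have h₃ := mem_bag.1 (hX hv)
      exact Fin.ext h₃
    · have h₃ := mem_bag.1 (hY hv)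
      exact Fin.ext h₃

/-! ### Soundness of prefixes -/

theorem linked_univ (hG : G.Connected) : Linked G Finset.univ :=
  (linked_iff (S := Set.univ) (by simp)).2 ((SimpleGraph.induceUnivIso G).connected_iff.2 hG)

/-- The levels of the vertices in `P` are those of the first `ρ` sets of a path witness
structure. -/
structure PartialLayering (G : SimpleGraph (Fin n)) (ρ : ℕ) (P : Finset (Fin n)) (f : Fin n → ℕ) :
    Prop where
  pos : 1 ≤ ρ
  lt : ∀ v ∈ P, f v < ρ
  linked : ∀ i < ρ, Linked G (P.filter (f · = i))
  adj : ∀ u ∈ P, ∀ v ∈ P, G.Adj u v → f u ≤ f v + 1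
  edge : ∀ i, i + 1 < ρ → ∃ u ∈ P, ∃ v ∈ P, G.Adj u v ∧ f u = i ∧ f v = i + 1
  border : ∀ u ∈ P, ∀ v, v ∉ P → G.Adj u v → f u + 1 = ρ

/-- `W` becomes level `ρ`. By `border` only the previous level has neighbours in it, and as `W`
takes in all neighbours of `P`, only `W` has neighbours outside afterwards. -/
theorem PartialLayering.next (hG : G.Connected) {ρ : ℕ} {P W : Finset (Fin n)} {f : Fin n → ℕ}
    (h : PartialLayering G ρ P f) (hN : ∀ j ∈ P, ∀ w, G.Adj j w → w ∉ P → w ∈ W)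
    (hd : Disjoint P W) (hW : Linked G W) :
    PartialLayering G (ρ + 1) (P ∪ W) (fun v => if v ∈ W then ρ else f v) := by
  have hPW : ∀ v ∈ P, v ∉ W := fun v hv => Finset.disjoint_left.1 hd hv
  have hpos := h.pos
  refine ⟨by omega, ?_, ?_, ?_, ?_, ?_⟩
  · intro v hv
    by_cases hvW : v ∈ W
    · simp [hvW]
    · have := h.lt v ((Finset.mem_union.1 hv).resolve_right hvW)
      simp only [hvW, if_false]
      omega
  · intro i hi
    rcases Nat.lt_succ_iff_lt_or_eq.1 hi with hi | rfl
    · convert h.linked i hi using 1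
      ext v
      simp only [Finset.mem_filter, Finset.mem_union]
      by_cases hvW : v ∈ W
      · have : v ∉ P := fun hv => hPW v hv hvW
        simp [hvW, this, hi.ne']
      · simp [hvW]
    · convert hW using 1
      ext v
      simp only [Finset.mem_filter, Finset.mem_union]
      by_cases hvW : v ∈ W
      · simp [hvW]
      · simp only [hvW, or_false, if_false, iff_false, not_and]
        intro hv
        exact (h.lt v hv).ne
  · intro u hu v hv huv
    by_cases huW : u ∈ W <;> by_cases hvW : v ∈ W
    · simp [huW, hvW]
    · have := h.border v ((Finset.mem_union.1 hv).resolve_right hvW) u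
        (fun hu => hPW u hu huW) huv.symm
      simp [huW, hvW, this]
    · have := h.lt u ((Finset.mem_union.1 hu).resolve_right huW)
      simp only [huW, hvW, if_true, if_false]
      omega
    · simpa [huW, hvW] using h.adj u ((Finset.mem_union.1 hu).resolve_right huW) v
        ((Finset.mem_union.1 hv).resolve_right hvW) huv
  · intro i hi
    by_cases hi' : i + 1 < ρ
    · obtain ⟨u, hu, v, hv, huv, h₁, h₂⟩ := h.edge i hi'
      exact ⟨u, Finset.mem_union_left _ hu, v, Finset.mem_union_left _ hv, huv,
        by simp [hPW u hu, h₁], by simp [hPW v hv, h₂]⟩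
    -- The new level is joined to the previous one because `G` is connected: some edge leaves `P`,
    -- it starts on the last level of `P` and ends in `W`.
    · obtain ⟨u, hu, v, hv, huv⟩ : ∃ u ∈ P, ∃ v, v ∉ P ∧ G.Adj u v := by
        by_contra! hcon
        have hP : P.Nonempty := (h.linked 0 (by omega)).1.mono (Finset.filter_subset _ _)
        have := (linked_univ hG).2 P (Finset.subset_univ _) hP fun j hj w _ hjw => by
          by_contra hw
          exact hcon j hj w hw hjw
        obtain ⟨w, hw⟩ := hW.1
        exact hPW w (this ▸ Finset.mem_univ w) hw
      have hvW := hN u hu v huv hv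
      have := h.border u hu v hv huv
      exact ⟨u, Finset.mem_union_left _ hu, v, Finset.mem_union_right _ hvW, huv,
        by simp only [hPW u hu, if_false]; omega, by simp only [hvW, if_true]; omega⟩
  · intro u hu v hv huv
    simp only [Finset.mem_union, not_or] at hv
    have huW : u ∈ W := by
      by_contra huW
      exact hv.2 (hN u ((Finset.mem_union.1 hu).resolve_right huW) v huv hv.1)
    simp [huW]

theorem IsPrefix.exists_partialLayering (hG : G.Connected) {ρ : ℕ} {P : Finset (Fin n)}
    (h : IsPrefix G X Y ρ P) :
    ∃ f, PartialLayering G ρ P f ∧ X ⊆ P ∧ ∀ v ∈ X, f v = 0 := by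
  induction h with
  | @first P h =>
    refine ⟨fun _ => 0, ⟨le_rfl, by simp, fun i hi => ?_, by simp, fun i hi => ?_, by simp⟩,
      h.2.2, by simp⟩
    · obtain rfl : i = 0 := by omega
      simpa using h.1
    · omega
  | @next ρ P W _ hN hd _ hW ih =>
    obtain ⟨f, h₁, h₂, h₃⟩ := ih
    refine ⟨_, h₁.next hG hN hd hW, h₂.trans Finset.subset_union_left, fun v hv => ?_⟩
    simp [Finset.disjoint_left.1 hd (h₂ hv), h₃ v hv]

/-- The complement of the prefix is appended as the last level; it contains `Y` since prefixes miss
`Y`. -/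
theorem Solvable.constrainedEnds (hG : G.Connected) (h : Solvable G X Y k) :
    ConstrainedEnds G X Y k := by
  rw [constrainedEnds_iff]
  rcases h with h | ⟨ρ, P, hP, hL, hn⟩
  · refine ⟨0, fun _ => 0, ⟨by simp, fun i hi => ?_, by simp, by simp⟩, by omega, ?_, ?_⟩
    · obtain rfl : i = 0 := by omega
      simpa [bag] using linked_univ hG
    · intro v _
      simp
    · intro v _
      simp
  · obtain ⟨f, h₁, h₂, h₃⟩ := hP.exists_partialLayering hG
    have h₄ := h₁.next hG (W := Pᶜ) (by simp) disjoint_compl_right hL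
    rw [Finset.union_compl] at h₄
    refine ⟨ρ, fun v => if v ∈ Pᶜ then ρ else f v, ⟨fun v => ?_, fun i hi => ?_,
      fun u v huv => ?_, fun i hi => ?_⟩, hn, ?_, ?_⟩
    rotate_left 4
    · intro v hv
      have : v ∉ Pᶜ := by simpa using h₂ hv
      simp only [mem_bag, this, if_false, h₃ v hv]
    · intro v hv
      have : v ∈ Pᶜ := by simpa using Finset.disjoint_right.1 hP.disjoint hv
      simp only [mem_bag, this, if_true]
    · exact Nat.lt_succ_iff.1 (h₄.lt v (Finset.mem_univ v))
    · exact h₄.linked i (by omega)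
    · exact h₄.adj u (Finset.mem_univ u) v (Finset.mem_univ v) huv
    · obtain ⟨u, -, v, -, h₅⟩ := h₄.edge i (by omega)
      exact ⟨u, v, h₅⟩

end Layering

/-! ### Completeness of the search -/

section Completeness

open Classical

variable {n m k : ℕ} {G : SimpleGraph (Fin n)} {X Y : Finset (Fin n)} {f : Fin n → ℕ}

theorem grow_empty [NeZero n] {A : Finset (Fin n)} (b : ℕ) : (grow G A ∅ b).inside = ∅ :=
  Finset.subset_empty.1 ((grow_valid b).closure ∅ subset_rfl (by simp))

theorem below_succ (f : Fin n → ℕ) (i : ℕ) : below f (i + 1) = below f i ∪ bag f i := by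
  ext v
  simp only [mem_below, Finset.mem_union, mem_bag]
  omega

theorem below_one (f : Fin n → ℕ) : below f 1 = bag f 0 := by
  ext v
  simp

theorem Layering.linked_below (h : Layering G m f) {i : ℕ} (hi : i ≤ m) :
    Linked G (below f (i + 1)) := by
  induction i with
  | zero => rw [zero_add, below_one]; exact h.linked 0 hi
  | succ i ih =>
    obtain ⟨u, v, huv, hu, hv⟩ := h.edge i hi
    rw [below_succ f (i + 1)]
    exact (ih (by omega)).union (h.linked _ hi) (a := u) (b := v) (by simp [hu]) (by simp [hv]) huv

theorem Layering.le_card (h : Layering G m f) : m + 1 ≤ n := by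
  have : (Finset.range (m + 1)) ⊆ Finset.univ.image f := fun i hi => by
    obtain ⟨v, hv⟩ := (h.linked i (by simpa [Nat.lt_succ_iff] using hi)).1
    exact Finset.mem_image.2 ⟨v, Finset.mem_univ v, by simpa using hv⟩
  have h₁ := Finset.card_le_card this
  have h₂ := Finset.card_image_le (s := Finset.univ) (f := f)
  simp only [Finset.card_range, Finset.card_univ, Fintype.card_fin] at h₁ h₂
  omega

/-- Most of the levels avoid sets of vertices on the first level, on the last one, and on four
consecutive levels. -/
theorem Layering.card_le (h : Layering G m f) (hX : X ⊆ bag f 0) (hY : Y ⊆ bag f m)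
    (hXY : Disjoint X Y) {D : Finset (Fin n)} {i : ℕ}
    (hD : ∀ v ∈ D, v ∉ X ∧ v ∉ Y ∧ i ≤ f v + 2 ∧ f v ≤ i + 1) :
    D.card + (X.card + Y.card) + (m + 1) ≤ n + 6 := by
  -- Every level not listed has a vertex, which cannot be in `D`, `X` or `Y`. Where truncated
  -- subtraction makes entries coincide, fewer levels are lost.
  have h₁ : Finset.range (m + 1) \ {0, m, i - 2, i - 1, i, i + 1} ⊆
      ((D ∪ (X ∪ Y))ᶜ).image f := by
    intro l hl
    simp only [Finset.mem_sdiff, Finset.mem_range, Finset.mem_insert, Finset.mem_singleton,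
      not_or] at hl
    obtain ⟨v, hv⟩ := (h.linked l (by omega)).1
    rw [mem_bag] at hv
    refine Finset.mem_image.2 ⟨v, ?_, hv⟩
    simp only [Finset.mem_compl, Finset.mem_union, not_or]
    refine ⟨fun hvD => ?_, fun hvX => ?_, fun hvY => ?_⟩
    · have := hD v hvD
      omega
    · have := mem_bag.1 (hX hvX)
      omega
    · have := mem_bag.1 (hY hvY)
      omega
  have h₂ := (Finset.card_le_card h₁).trans Finset.card_image_le
  have h₃ := Finset.le_card_sdiff ({0, m, i - 2, i - 1, i, i + 1} : Finset ℕ)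
    (Finset.range (m + 1))
  have h₄ : ({0, m, i - 2, i - 1, i, i + 1} : Finset ℕ).card ≤ 6 := Finset.card_le_six
  have h₅ : Disjoint D (X ∪ Y) := by
    rw [Finset.disjoint_left]
    intro v hv hv'
    have := hD v hv
    rcases Finset.mem_union.1 hv' with h | h <;> tauto
  rw [Finset.card_compl, Fintype.card_fin, Finset.card_union_of_disjoint h₅,
    Finset.card_union_of_disjoint hXY] at h₂
  have h₆ : D.card + (X.card + Y.card) ≤ n := by
    rw [← Finset.card_union_of_disjoint hXY, ← Finset.card_union_of_disjoint h₅]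
    exact (Finset.card_le_univ _).trans_eq (Fintype.card_fin n)
  rw [Finset.card_range] at h₃
  omega

/-- The set on level `i` can be grown with few bits. -/
theorem Layering.exists_lastBag [NeZero n] (h : Layering G m f) (hX : X ⊆ bag f 0)
    (hY : Y ⊆ bag f m) {i : ℕ} (hi : i < m) :
    ∃ (v u : Fin n) (D : Finset (Fin n)) (b : ℕ), b < 2 ^ D.card ∧
      (∀ c, (lastBag G X Y v (b + 2 ^ D.card * c)).bits = c ∧
        prefixSet G X Y v u (b + 2 ^ D.card * c) = below f (i + 1)) ∧
      ∀ w ∈ D, w ∉ X ∧ w ∉ Y ∧ i ≤ f w + 1 ∧ f w ≤ i + 1 ∧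
        (f w = i + 1 → w ∈ boundary G (below f (i + 1))) := by
  have hne := (h.linked i hi.le).1
  -- On level `0` the start must be in `X` unless `X` is empty, for otherwise `X` would be avoided.
  obtain ⟨v, hv, hvX⟩ : ∃ v ∈ bag f i, v ∉ X → X = ∅ ∨ i ≠ 0 := by
    by_cases hi0 : i = 0
    · subst hi0
      rcases X.eq_empty_or_nonempty with rfl | ⟨v, hv⟩
      · obtain ⟨v, hv⟩ := hne
        exact ⟨v, hv, fun _ => .inl rfl⟩
      · exact ⟨v, hX hv, fun h => absurd hv h⟩
    · obtain ⟨v, hv⟩ := hne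
      exact ⟨v, hv, fun _ => .inr hi0⟩
  rw [mem_bag] at hv
  have hX0 : ∀ w ∈ X, f w = 0 := fun w hw => mem_bag.1 (hX hw)
  have hYm : ∀ w ∈ Y, f w = m := fun w hw => mem_bag.1 (hY hw)
  have hS : seed X v ⊆ bag f i := by
    unfold seed
    split_ifs with h₁
    · have := hX0 v h₁
      obtain rfl : i = 0 := by omega
      exact hX
    · simpa using hv
  have hS' : (seed X v).Nonempty := by
    unfold seed
    split_ifs with h₁
    exacts [⟨v, h₁⟩, ⟨v, by simp⟩]
  have hA : ∀ w ∈ bag f i, w ∈ avoid X Y v → w ∈ seed X v := by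
    intro w hw hwA
    rw [mem_bag] at hw
    unfold avoid at hwA
    unfold seed
    split_ifs at hwA ⊢ with h₁
    · have := hYm w hwA
      omega
    · rcases Finset.mem_union.1 hwA with h₂ | h₂
      · rcases hvX h₁ with rfl | h₃
        · simp at h₂
        · have := hX0 w h₂
          omega
      · have := hYm w h₂
        omega
  obtain ⟨O, d, b, hb, hOT, hOA, hOadj, hd, hg⟩ := exists_grow (h.linked i hi.le) hS hS' hA
  have hlev : ∀ w ∈ O, f w ≠ i ∧ f w ≤ i + 1 ∧ i ≤ f w + 1 ∧
      (f w = i + 1 → w ∈ boundary G (below f (i + 1))) := by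
    intro w hw
    obtain ⟨j, hj, hjw⟩ := hOadj w hw
    rw [mem_bag] at hj
    have h₁ : f w ≠ i := fun h₁ => Finset.disjoint_left.1 hOT hw (mem_bag.2 h₁)
    have h₂ := h.adj _ _ hjw
    have h₃ := h.adj _ _ hjw.symm
    refine ⟨h₁, by omega, by omega, fun h₄ => mem_boundary.2 ⟨?_, j, ?_, hjw⟩⟩
    · rw [mem_below]
      omega
    · rw [mem_below]
      omega
  have hcard : (bag f i \ seed X v ∪ O).card = d := by
    rw [hd, Finset.card_union_of_disjoint]
    exact Finset.disjoint_of_subset_left Finset.sdiff_subset hOT.symm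
  -- For `i = 0` a vertex of the bag itself makes the second growth empty. For `i > 0` any vertex of
  -- level `0` works: the levels below `i` are connected together and all their other neighbours are
  -- on level `i`.
  obtain ⟨u, hu⟩ : ∃ u, bag f i ∪ (grow G (bag f i) ({u} \ bag f i) (2 ^ n - 1)).inside =
      below f (i + 1) := by
    rcases Nat.eq_zero_or_pos i with rfl | hi0
    · refine ⟨v, ?_⟩
      rw [Finset.sdiff_eq_empty_iff_subset.2 (by simpa using hv), grow_empty, below_one,
        Finset.union_empty]
    · obtain ⟨u, hu⟩ := (h.linked 0 (by omega)).1
      rw [mem_bag] at hu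
      have h₁ := h.linked_below (i := i - 1) (by omega)
      rw [show i - 1 + 1 = i by omega] at h₁
      refine ⟨u, ?_⟩
      rw [show ({u} : Finset (Fin n)) \ bag f i = {u} by
          rw [Finset.sdiff_eq_self_iff_disjoint]
          simp only [Finset.disjoint_singleton_left, mem_bag]
          omega,
        grow_component h₁ ?_ ?_ (by rw [mem_below]; omega), below_succ, Finset.union_comm]
      · rw [Finset.disjoint_left]
        intro w hw
        rw [mem_below] at hw
        rw [mem_bag]
        omega
      · intro j hj w hjw hw
        rw [mem_below] at hj hw
        have := h.adj _ _ hjw.symm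
        rw [mem_bag]
        omega
  refine ⟨v, u, bag f i \ seed X v ∪ O, b, by rwa [hcard], fun c => ?_, ?_⟩
  · have h₁ : lastBag G X Y v (b + 2 ^ d * c) = ⟨bag f i, O, c⟩ := hg c
    rw [hcard, prefixSet, h₁]
    exact ⟨rfl, hu⟩
  · intro w hw
    have h₁ : w ∉ X ∧ w ∉ Y := by
      rcases Finset.mem_union.1 hw with hw | hw
      · rw [Finset.mem_sdiff, mem_bag] at hw
        refine ⟨fun hwX => ?_, fun hwY => ?_⟩
        · by_cases hvX' : v ∈ X
          · exact hw.2 (by rwa [seed, if_pos hvX'])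
          · rcases hvX hvX' with rfl | h₃
            · simp at hwX
            · have := hX0 w hwX
              omega
        · have := hYm w hwY
          omega
      · have hw' := Finset.disjoint_left.1 hOA hw
        by_cases hvX' : v ∈ X
        · rw [avoid, if_pos hvX'] at hw'
          refine ⟨fun hwX => ?_, hw'⟩
          have h₂ := hX0 v hvX'
          have h₃ := hX0 w hwX
          have := (hlev w hw).1
          omega
        · rw [avoid, if_neg hvX', Finset.mem_union, not_or] at hw'
          exact hw'
    refine ⟨h₁.1, h₁.2, ?_⟩
    rcases Finset.mem_union.1 hw with hw | hw
    · rw [Finset.mem_sdiff, mem_bag] at hw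
      omega
    · have := hlev w hw
      exact ⟨this.2.2.1, this.2.1, this.2.2.2⟩

/-- The set on level `i` can be grown from its vertices with neighbours on the levels below. -/
theorem Layering.exists_nextBag [NeZero n] (h : Layering G m f) (hX : X ⊆ bag f 0)
    (hY : Y ⊆ bag f m) {i : ℕ} (hi : 1 ≤ i) (him : i < m) :
    ∃ (D : Finset (Fin n)) (b : ℕ), b < 2 ^ D.card ∧ IsNext G Y (below f i) b ∧
      nextBag G Y (below f i) b = bag f i ∧
      ∀ w ∈ D, w ∉ X ∧ w ∉ Y ∧ i ≤ f w ∧ f w ≤ i + 1 ∧ w ∉ boundary G (below f i) := by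
  have hYm : ∀ w ∈ Y, f w = m := fun w hw => mem_bag.1 (hY hw)
  have hS : boundary G (below f i) ⊆ bag f i := by
    intro w hw
    obtain ⟨h₁, j, hj, hjw⟩ := mem_boundary.1 hw
    rw [mem_below] at h₁ hj
    have := h.adj _ _ hjw.symm
    rw [mem_bag]
    omega
  have hS' : (boundary G (below f i)).Nonempty := by
    obtain ⟨u, v, huv, hu, hv⟩ := h.edge (i - 1) (by omega)
    exact ⟨v, mem_boundary.2 ⟨by rw [mem_below]; omega, u, by rw [mem_below]; omega, huv⟩⟩
  have hA : ∀ w ∈ bag f i, w ∈ below f i ∪ Y → w ∈ boundary G (below f i) := by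
    intro w hw hw'
    rw [mem_bag] at hw
    rcases Finset.mem_union.1 hw' with h₁ | h₁
    · rw [mem_below] at h₁
      omega
    · have := hYm w h₁
      omega
  obtain ⟨O, d, b, hb, hOT, hOA, hOadj, hd, hg⟩ := exists_grow (h.linked i him.le) hS hS' hA
  have hcard : (bag f i \ boundary G (below f i) ∪ O).card = d := by
    rw [hd, Finset.card_union_of_disjoint]
    exact Finset.disjoint_of_subset_left Finset.sdiff_subset hOT.symm
  have hnext : nextBag G Y (below f i) b = bag f i := by
    have := hg 0
    rw [mul_zero, add_zero] at this
    rw [nextBag, this]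
  refine ⟨_, b, by rwa [hcard], ⟨?_, by rw [hnext]; exact h.linked i him.le⟩, hnext, ?_⟩
  · rw [Finset.disjoint_left]
    intro w hw hwY
    have h₁ := mem_bag.1 (hS hw)
    have h₂ := hYm w hwY
    omega
  · intro w hw
    have key : w ∉ Y ∧ i ≤ f w ∧ f w ≤ i + 1 ∧ w ∉ boundary G (below f i) := by
      rcases Finset.mem_union.1 hw with hw | hw
      · rw [Finset.mem_sdiff, mem_bag] at hw
        refine ⟨fun hwY => ?_, by omega, by omega, hw.2⟩
        have := hYm w hwY
        omega
      · have hw' := Finset.disjoint_left.1 hOA hw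
        rw [Finset.mem_union, not_or, mem_below] at hw'
        obtain ⟨j, hj, hjw⟩ := hOadj w hw
        rw [mem_bag] at hj
        have := h.adj _ _ hjw.symm
        exact ⟨hw'.2, by omega, by omega, fun h₁ => Finset.disjoint_left.1 hOT hw (hS h₁)⟩
    refine ⟨fun hwX => ?_, key⟩
    have := mem_bag.1 (hX hwX)
    omega

/-- Every round of a solution is described by a number below the bound, because the bits read are
counted by a set `D` as in `Layering.card_le`. -/
theorem Layering.found [NeZero n] (h : Layering G m f) (hm : 1 ≤ m) (hn : n ≤ m + 1 + k)
    (hX : X ⊆ bag f 0) (hY : Y ⊆ bag f m) :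
    Found G X Y k (2 ^ (k + 6) / 2 ^ (X.card + Y.card)) m (below f) := by
  have hXY : Disjoint X Y := by
    rw [Finset.disjoint_left]
    intro v h₁ h₂
    have := mem_bag.1 (hX h₁)
    have := mem_bag.1 (hY h₂)
    omega
  have hR : ∀ {b : ℕ} {D : Finset (Fin n)} {i : ℕ}, b < 2 ^ D.card →
      (∀ v ∈ D, v ∉ X ∧ v ∉ Y ∧ i ≤ f v + 2 ∧ f v ≤ i + 1) →
      b < 2 ^ (k + 6) / 2 ^ (X.card + Y.card) := by
    intro b D i hb hD
    have := h.card_le hX hY hXY hD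
    refine hb.trans_le ((Nat.le_div_iff_mul_le (by positivity)).2 ?_)
    rw [← pow_add]
    exact Nat.pow_le_pow_right (by norm_num) (by omega)
  have hcompl : (below f m)ᶜ = bag f m := by
    ext v
    have := h.le v
    simp only [Finset.mem_compl, mem_below, mem_bag]
    omega
  refine ⟨fun _ => ?_, by have := h.le_card; omega, fun _ => ⟨?_, hn⟩, fun i hi him => ?_⟩
  · refine ⟨h.linked_below (i := 0) (by omega), ?_, by rwa [below_one]⟩
    rw [Finset.disjoint_left]
    intro v h₁ h₂
    have := mem_bag.1 (hY h₂)
    rw [mem_below] at h₁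
    omega
  · rw [hcompl]
    exact h.linked m le_rfl
  · obtain ⟨v, u, D, b, hb, hg, hD⟩ := h.exists_lastBag hX hY (i := i - 1) (by omega)
    rw [show i - 1 + 1 = i by omega] at hD hg
    rcases Nat.lt_or_ge i m with him' | him'
    · obtain ⟨D', b', hb', h₁, h₂, hD'⟩ := h.exists_nextBag hX hY hi him'
      -- A vertex of `D` on the next level is a boundary vertex of the prefix, hence in the seed of
      -- the second growth and not in `D'`.
      have hdis : Disjoint D D' := by
        rw [Finset.disjoint_left]
        intro w hw hw'
        have h₃ := hD w hw
        have h₄ := hD' w hw'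
        exact h₄.2.2.2.2 (h₃.2.2.2.2 (by omega))
      -- The bits of the second growth are placed above those of the first, which leaves exactly
      -- `b'`.
      refine ⟨v, u, b + 2 ^ D.card * b', hR (D := D ∪ D') (i := i) ?_ ?_, (hg b').2, fun _ => ?_⟩
      · rw [Finset.card_union_of_disjoint hdis, pow_add]
        calc b + 2 ^ D.card * b' < 2 ^ D.card * (b' + 1) := by rw [mul_add]; omega
          _ ≤ _ := Nat.mul_le_mul_left _ hb'
      · intro w hw
        rcases Finset.mem_union.1 hw with hw | hw
        · have := hD w hw
          exact ⟨this.1, this.2.1, by omega, by omega⟩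
        · have := hD' w hw
          exact ⟨this.1, this.2.1, by omega, by omega⟩
      · rw [(hg b').1, h₂, ← below_succ]
        exact ⟨h₁, rfl⟩
    · refine ⟨v, u, b + 2 ^ D.card * 0, hR (D := D) (i := i) (by simpa using hb) ?_, (hg 0).2,
        fun h₁ => absurd h₁ (by omega)⟩
      intro w hw
      have := hD w hw
      exact ⟨this.1, this.2.1, by omega, by omega⟩

end Completeness

/-! ### The running time and the result of the program -/

section Input

open Classical

variable {n : ℕ} {G : SimpleGraph (Fin n)} {X Y : Finset (Fin n)} {k : ℕ} {s : State}

theorem inputState_adj (j w : Fin n) :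
    (inputState G X Y k).mem (j * n + w) = if G.Adj j w then 1 else 0 := by
  have h₁ : ∀ u v : Fin n, (u : ℕ) * n + v < n * n := fun u v => by
    have := u.2
    have := v.2
    nlinarith
  have h₂ : ∀ u v : Fin n, (j : ℕ) * n + w = u * n + v ↔ j = u ∧ w = v := by
    intro u v
    refine ⟨fun h => ?_, fun h => by rw [h.1, h.2]⟩
    have hm := congrArg (· % n) h
    have hd := congrArg (· / n) h
    have e : ∀ a b : Fin n, ((a : ℕ) * n + b) / n = a := fun a b => by
      rw [mul_comm, Nat.mul_add_div a.pos, Nat.div_eq_of_lt b.2, add_zero]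
    simp only [Nat.mul_add_mod_self_right, Nat.mod_eq_of_lt w.2, Nat.mod_eq_of_lt v.2] at hm
    simp only [e] at hd
    exact ⟨Fin.ext hd, Fin.ext hm⟩
  refine if_congr ⟨?_, fun h => .inl ⟨j, w, rfl, h⟩⟩ rfl rfl
  rintro (⟨u, v, h, huv⟩ | ⟨u, -, h⟩ | ⟨u, -, h⟩)
  · obtain ⟨rfl, rfl⟩ := (h₂ u v).1 h
    exact huv
  · have := h₁ j w
    omega
  · have := h₁ j w
    omega

theorem inputState_left (v : Fin n) :
    (inputState G X Y k).mem (n * n + v) = if v ∈ X then 1 else 0 := by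
  have h₁ : ∀ u v : Fin n, (u : ℕ) * n + v < n * n := fun u v => by
    have := u.2
    have := v.2
    nlinarith
  refine if_congr ⟨?_, fun h => .inr (.inl ⟨v, h, rfl⟩)⟩ rfl rfl
  rintro (⟨u, w, h, -⟩ | ⟨u, hu, h⟩ | ⟨u, -, h⟩)
  · have := h₁ u w
    omega
  · obtain rfl : v = u := Fin.ext (by omega)
    exact hu
  · have := v.2
    omega

theorem inputState_right (v : Fin n) :
    (inputState G X Y k).mem (n * n + n + v) = if v ∈ Y then 1 else 0 := by
  have h₁ : ∀ u v : Fin n, (u : ℕ) * n + v < n * n := fun u v => by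
    have := u.2
    have := v.2
    nlinarith
  refine if_congr ⟨?_, fun h => .inr (.inr ⟨v, h, rfl⟩)⟩ rfl rfl
  rintro (⟨u, w, h, -⟩ | ⟨u, -, h⟩ | ⟨u, hu, h⟩)
  · have := h₁ u w
    omega
  · have := u.2
    omega
  · obtain rfl : v = u := Fin.ext (by omega)
    exact hu

theorem inputState_mem_eq_zero {a : ℕ} (ha : n * n + (n + n) ≤ a) :
    (inputState G X Y k).mem a = 0 := by
  refine if_neg ?_
  rintro (⟨u, v, h, -⟩ | ⟨u, -, h⟩ | ⟨u, -, h⟩)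
  · have := u.2
    have := v.2
    nlinarith
  · have := u.2
    omega
  · have := u.2
    omega

theorem inputState_mem_le (a : ℕ) : (inputState G X Y k).mem a ≤ 1 := by
  unfold inputState
  dsimp only
  split <;> simp

theorem inputState_short : (inputState G X Y k).Short (n + k.size + 1) := by
  refine ⟨by omega, fun r => ?_, fun a => ?_⟩
  · have := size_lit_le n
    simp only [inputState]
    split_ifs
    · omega
    · omega
    · simp
  · exact (Nat.size_le_size (inputState_mem_le a)).trans (by simp)

/-! ### The table of powers of two and the constants. -/

/-- The body of the loop that stores the powers of `2`. -/
def powerS : Stmt :=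
  .sto (.var rTable + (.var rN - (.var gIdx + .lit 1))) (.var rFull) ;;
  .asg rFull (.var rFull + .var rFull)

/-- What holds after the powers of `2` below `2 ^ (n - j)` are stored. -/
structure Powers (n L : ℕ) (s : State) (j : ℕ) (s' : State) : Prop where
  short : s'.Short L
  reg : ∀ r, r ≠ gIdx → r ≠ rFull → s'.reg r = s.reg r
  idx : s'.reg gIdx = j
  full : s'.reg rFull = 2 ^ (n - j)
  mem : ∀ a, s'.mem a = if s.reg rTable ≤ a ∧ a < s.reg rTable + (n - j) then
    2 ^ (a - s.reg rTable) else s.mem a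

theorem Powers.step {L j : ℕ} {s' : State} (hN : s.reg rN = n) (hL : n + 1 ≤ L) (hj : j < n)
    (h : Powers n L s (j + 1) s') : Powers n L s j (powerS.run (s'.setReg gIdx j)) ∧
      6 + 2 * (j + 1).size + powerS.cost (s'.setReg gIdx j) ≤ (powerS.coeff + 8) * L := by
  have hj' : j.size ≤ L := (size_lit_le j).trans (by omega)
  have h₁ : (s'.setReg gIdx j).Short L := h.short.setReg _ hj'
  have hT : (s'.setReg gIdx j).reg rTable = s.reg rTable := by
    simp [h.reg rTable (by norm_num) (by norm_num)]
  have hN' : (s'.setReg gIdx j).reg rN = n := by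
    simp [h.reg rN (by norm_num) (by norm_num), hN]
  have hF : (s'.setReg gIdx j).reg rFull = 2 ^ (n - (j + 1)) := by simp [h.full]
  have ha : (Expr.var rTable + (Expr.var rN - (Expr.var gIdx + Expr.lit 1))).eval
      (s'.setReg gIdx j) = s.reg rTable + (n - (j + 1)) := by
    rw [eval_add, eval_sub, eval_add]
    simp only [eval, hT, hN']
    simp
  have h₂ : ((s'.setReg gIdx j).setMem (s.reg rTable + (n - (j + 1)))
      (2 ^ (n - (j + 1)))).Short L :=
    h₁.setMem _ (by rw [Nat.size_pow]; omega)
  have e : 2 ^ (n - (j + 1)) + 2 ^ (n - (j + 1)) = 2 ^ (n - j) := by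
    rw [← two_mul, ← pow_succ']
    congr 1
    omega
  have run₁ : (Stmt.sto (.var rTable + (.var rN - (.var gIdx + .lit 1))) (.var rFull)).run
      (s'.setReg gIdx j) =
      (s'.setReg gIdx j).setMem (s.reg rTable + (n - (j + 1))) (2 ^ (n - (j + 1))) := by
    rw [run_sto, ha]
    simp only [eval, hF]
  have run₂ : powerS.run (s'.setReg gIdx j) = ((s'.setReg gIdx j).setMem
      (s.reg rTable + (n - (j + 1))) (2 ^ (n - (j + 1)))).setReg rFull (2 ^ (n - j)) := by
    rw [powerS, run_seq, run₁, run_asg, eval_add]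
    simp only [eval, State.reg_setMem, hF, e]
  constructor
  · rw [run₂]
    refine ⟨h₂.setReg _ (by rw [Nat.size_pow]; omega), fun r hr hr' => ?_, ?_, ?_, fun a => ?_⟩
    · simp [hr, hr', h.reg r hr hr']
    · simp
    · simp
    · simp only [State.mem_setReg, State.mem_setMem, h.mem]
      by_cases h₃ : a = s.reg rTable + (n - (j + 1))
      · rw [if_pos h₃, if_pos (by omega)]
        congr 1
        omega
      · rw [if_neg h₃]
        refine if_congr ?_ rfl rfl
        omega
  · have c₁ := cost_sto_le h₁ (.var rTable + (.var rN - (.var gIdx + .lit 1))) (.var rFull)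
    have c₂ := cost_asg_le h₂ rFull (.var rFull + .var rFull) rfl
    have h₄ : (j + 1).size ≤ L := (size_lit_le _).trans (by omega)
    rw [powerS, Stmt.cost, run₁]
    rw [Stmt.coeff]
    nlinarith

theorem powers_loop {L : ℕ} (h : s.Short L) (hN : s.reg rN = n) (hF : s.reg rFull = 1)
    (hL : n + 1 ≤ L) :
    Powers n L s 0 ((Stmt.loop gIdx rN powerS).run s) ∧
      (Stmt.loop gIdx rN powerS).cost s ≤ (powerS.coeff + 11) * ((n + 1) * L) := by
  have h₀ : Powers n L s n (s.setReg gIdx n) := by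
    refine ⟨h.setReg _ ((size_lit_le n).trans (by omega)), fun r hr hr' => ?_, ?_, ?_, fun a => ?_⟩
    · simp [hr]
    · simp
    · simp [hF]
    · rw [if_neg (by omega)]
      simp
  constructor
  · rw [run_loop, hN]
    exact iter_induction (Powers n L s) h₀ fun j hj s' hs' => (hs'.step hN hL hj).1
  · have := iterCost_le (f := fun m s => powerS.run (s.setReg gIdx m))
      (g := fun m s => 6 + 2 * (m + 1).size + powerS.cost (s.setReg gIdx m))
      (Powers n L s) h₀ fun j hj s' hs' => hs'.step hN hL hj
    have h₁ := size_lit_le n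
    rw [Stmt.cost, hN]
    have h₂ := h.pos
    nlinarith

theorem reg_constants {T a : ℕ} (h : ∀ r, s.reg r = if r = gIdx then 0 else if r = rFull then a else
      if r = rTable then T else if r = rK then k else if r = rN then n else 0) (r : ℕ) :
    ((Stmt.asg rCube (.var rN * .var rN * .var rN)).run ((Stmt.asg rFull (.var rFull - .lit 1)).run
      ((Stmt.asg rCap (.lit 64 * (.var rFull * .var rFull * (.var rFull * .var rFull)))).run
        s))).reg r = if r = rCube then n * n * n else if r = rFull then a - 1 else
      if r = rCap then 64 * a ^ 4 else if r = rTable then T else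
      if r = rK then k else if r = rN then n else 0 := by
  have e : 64 * (a * a * (a * a)) = 64 * a ^ 4 := by ring
  simp only [run_asg, eval_sub, State.reg_setReg, eval, h]
  simp [e]
  split_ifs <;> simp_all

/-- The cap is not available yet, so `Stmt.cost_le` does not apply: lengths are tracked by hand,
each assignment multiplying the bound by the `len` of its expression. -/
theorem run_tableS (s₁ : State) (hs₁ : tableS.run (inputState G X Y k) = s₁) :
    Ready G ∅ ∅ (min k n) s₁ ∧ s₁.Capped ∧
      (∀ a < n * n + (n + n), s₁.mem a = (inputState G X Y k).mem a) ∧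
      (∀ a, n * n + (n + n) + n ≤ a → s₁.mem a = 0) ∧
      tableS.cost (inputState G X Y k) ≤ 1000000 * ((n + 1) * (n + k.size + 1)) := by
  set s := inputState G X Y k with hs
  set L := n + k.size + 1 with hL
  have sh₀ : s.Short L := inputState_short
  have hreg : ∀ r, s.reg r = if r = 0 then n else if r = 1 then k else 0 := fun r => rfl
  obtain ⟨s₂, hs₂⟩ : ∃ s₂, (Stmt.asg rK (.var rK - (.var rK - .var rN))).run s = s₂ := ⟨_, rfl⟩
  have sh₂ : s₂.Short (5 * L) := sh₀.asg hs₂ rfl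
  have c₂ := cost_asg_le sh₀ rK (.var rK - (.var rK - .var rN)) (c := 23) rfl
  obtain ⟨s₃, hs₃⟩ : ∃ s₃, (Stmt.asg rTable (.var rN * .var rN + (.var rN + .var rN))).run s₂ =
    s₃ := ⟨_, rfl⟩
  have sh₃ : s₃.Short (7 * (5 * L)) := sh₂.asg hs₃ rfl
  have c₃ := cost_asg_le sh₂ rTable (.var rN * .var rN + (.var rN + .var rN)) (c := 33) rfl
  obtain ⟨s₄, hs₄⟩ : ∃ s₄, (Stmt.asg rFull (.lit 1)).run s₃ = s₄ := ⟨_, rfl⟩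
  have sh₄ : s₄.Short (2 * (7 * (5 * L))) := sh₃.asg hs₄ rfl
  have c₄ := cost_asg_le sh₃ rFull (.lit 1) (c := 6) rfl
  have hreg₄ : ∀ r, s₄.reg r = if r = rFull then 1 else if r = rTable then n * n + (n + n) else
      if r = rK then min k n else if r = rN then n else 0 := by
    intro r
    rw [← hs₄, ← hs₃, ← hs₂]
    simp only [run_asg, eval_sub, State.reg_setReg, eval, hreg]
    have e : k - (k - n) = min k n := by omega
    simp [e]
    split_ifs <;> simp_all
  have hmem₄ : s₄.mem = s.mem := by
    rw [← hs₄, ← hs₃, ← hs₂]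
    rfl
  obtain ⟨s₅, hs₅⟩ : ∃ s₅, (Stmt.loop gIdx rN powerS).run s₄ = s₅ := ⟨_, rfl⟩
  obtain ⟨p₅, c₅⟩ := powers_loop (n := n) sh₄ (by simp [hreg₄]) (by simp [hreg₄]) (by omega)
  rw [hs₅] at p₅
  have sh₅ := p₅.short
  obtain ⟨s₆, hs₆⟩ : ∃ s₆, (Stmt.asg rCap (.lit 64 * (.var rFull * .var rFull *
    (.var rFull * .var rFull)))).run s₅ = s₆ := ⟨_, rfl⟩
  have sh₆ : s₆.Short (73 * (2 * (7 * (5 * L)))) := sh₅.asg hs₆ rfl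
  have c₆ := cost_asg_le sh₅ rCap (.lit 64 * (.var rFull * .var rFull *
    (.var rFull * .var rFull))) (c := 238) rfl
  obtain ⟨s₇, hs₇⟩ : ∃ s₇, (Stmt.asg rFull (.var rFull - .lit 1)).run s₆ = s₇ := ⟨_, rfl⟩
  have sh₇ : s₇.Short (4 * (73 * (2 * (7 * (5 * L))))) := sh₆.asg hs₇ rfl
  have c₇ := cost_asg_le sh₆ rFull (.var rFull - .lit 1) (c := 15) rfl
  have c₈ := cost_asg_le sh₇ rCube (.var rN * .var rN * .var rN) (c := 23) rfl
  have run : s₁ = (Stmt.asg rCube (.var rN * .var rN * .var rN)).run s₇ := by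
    rw [← hs₁, ← hs₇, ← hs₆, ← hs₅, ← hs₄, ← hs₃, ← hs₂]
    rfl
  have hreg₅ : ∀ r, s₅.reg r = if r = gIdx then 0 else if r = rFull then 2 ^ n else
      if r = rTable then n * n + (n + n) else if r = rK then min k n else if r = rN then n else
      0 := by
    intro r
    by_cases h₁ : r = gIdx
    · rw [if_pos h₁, h₁]
      exact p₅.idx
    · by_cases h₂ : r = rFull
      · rw [if_neg h₁, if_pos h₂, h₂]
        exact p₅.full
      · rw [if_neg h₁, p₅.reg r h₁ h₂, hreg₄, if_neg h₂, if_neg h₂]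
  have hreg₁ : ∀ r, s₁.reg r = if r = rCube then n * n * n else if r = rFull then 2 ^ n - 1 else
      if r = rCap then 64 * (2 ^ n) ^ 4 else if r = rTable then n * n + (n + n) else
      if r = rK then min k n else if r = rN then n else 0 := by
    intro r
    rw [run, ← hs₇, ← hs₆]
    exact reg_constants hreg₅ r
  have hmem₁ : ∀ a, s₁.mem a = if n * n + (n + n) ≤ a ∧ a < n * n + (n + n) + n then
      2 ^ (a - (n * n + (n + n))) else s.mem a := by
    intro a
    have : s₁.mem = s₅.mem := by
      rw [run, ← hs₇, ← hs₆]
      rfl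
    rw [this, p₅.mem, hmem₄]
    simp [hreg₄]
  have hlt : n < 2 ^ n := Nat.lt_two_pow_self
  have h₄ : 2 ^ n ≤ (2 ^ n) ^ 4 := Nat.le_self_pow (by norm_num) _
  have h₃ : n * n * n ≤ (2 ^ n) ^ 4 := by
    calc n * n * n ≤ 2 ^ n * 2 ^ n * 2 ^ n := by gcongr
      _ = (2 ^ n) ^ 3 := by ring
      _ ≤ _ := Nat.pow_le_pow_right (by positivity) (by norm_num)
  have h₂ : n * n ≤ (2 ^ n) ^ 4 := by
    calc n * n ≤ 2 ^ n * 2 ^ n := by gcongr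
      _ = (2 ^ n) ^ 2 := by ring
      _ ≤ _ := Nat.pow_le_pow_right (by positivity) (by norm_num)
  have hcap : s₁.reg capReg = 64 * (2 ^ n) ^ 4 := by
    rw [hreg₁]
    rfl
  refine ⟨⟨?_, ?_, ?_, ?_, ?_, ?_, ?_, ?_, fun j w => ?_, fun v => ?_⟩,
    ⟨?_, fun r => ?_, fun a => ?_⟩, fun a ha => ?_, fun a ha => ?_, ?_⟩
  iterate 8
    · rw [hreg₁]
      simp
  · rw [hmem₁, if_neg, inputState_adj]
    have := j.2
    have := w.2
    intro h
    nlinarith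
  · rw [hmem₁, if_pos (by omega)]
    congr 1
    omega
  · rw [hcap]
    omega
  · rw [hcap, hreg₁]
    split_ifs <;> omega
  · rw [hcap, hmem₁]
    split_ifs with h
    · have : 2 ^ (a - (n * n + (n + n))) ≤ 2 ^ n := Nat.pow_le_pow_right (by norm_num) (by omega)
      omega
    · exact (inputState_mem_le a).trans (by omega)
  · rw [hmem₁, if_neg (by omega)]
  · rw [hmem₁, if_neg (by omega), inputState_mem_eq_zero (by omega)]
  · have hc : tableS.cost s = (Stmt.asg rK (.var rK - (.var rK - .var rN))).cost s +
        ((Stmt.asg rTable (.var rN * .var rN + (.var rN + .var rN))).cost s₂ +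
        ((Stmt.asg rFull (.lit 1)).cost s₃ + ((Stmt.loop gIdx rN powerS).cost s₄ +
        ((Stmt.asg rCap (.lit 64 * (.var rFull * .var rFull *
          (.var rFull * .var rFull)))).cost s₅ + ((Stmt.asg rFull (.var rFull - .lit 1)).cost s₆ +
          (Stmt.asg rCube (.var rN * .var rN * .var rN)).cost s₇))))) := by
      rw [← hs₇, ← hs₆, ← hs₅, ← hs₄, ← hs₃, ← hs₂]
      rfl
    have h₅ : (n + 1) * (2 * (7 * (5 * L))) = 70 * ((n + 1) * L) := by ring
    have h₆ : L ≤ (n + 1) * L := Nat.le_mul_of_pos_left L (by omega)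
    rw [show powerS.coeff + 11 = 67 from rfl, h₅] at c₅
    rw [hc]
    omega

/-! ### The masks of `X` and `Y` and the number of bit sequences. -/

theorem Ready.of_sets (h : Ready G X Y k s) {X' Y' : Finset (Fin n)} {s' : State}
    (hr : ∀ r < 7, r ≠ rBits → s'.reg r = s.reg r) (hm : s'.mem = s.mem)
    (hX : s'.reg rX = mask X') (hY : s'.reg rY = mask Y') : Ready G X' Y' k s' := by
  refine ⟨?_, ?_, ?_, ?_, ?_, ?_, hX, hY, fun j w => ?_, fun v => ?_⟩
  any_goals rw [hr _ (by norm_num) (by norm_num)]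
  exacts [h.regN, h.regK, h.regCap, h.regCube, h.regTable, h.regFull, hm ▸ h.adj j w,
    hm ▸ h.table v]

/-- The vertices of a set from `j` on. -/
noncomputable def upper (S : Finset (Fin n)) (j : ℕ) : Finset (Fin n) := S.filter (j ≤ ·)

theorem upper_zero (S : Finset (Fin n)) : upper S 0 = S := by simp [upper]

theorem upper_self (S : Finset (Fin n)) : upper S n = ∅ := by simp [upper]

theorem upper_of_mem {S : Finset (Fin n)} {v : Fin n} (hv : v ∈ S) :
    mask (upper S v) = mask (upper S (v + 1)) + 2 ^ (v : ℕ) ∧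
      (upper S v).card = (upper S (v + 1)).card + 1 := by
  have h₁ : upper S v = insert v (upper S (v + 1)) := by
    ext w
    simp only [upper, Finset.mem_filter, Finset.mem_insert, Fin.ext_iff]
    by_cases hw : w = v
    · simp [hw, hv]
    · have : (w : ℕ) ≠ v := fun h => hw (Fin.ext h)
      simp only [this, false_or, and_congr_right_iff]
      omega
  have h₂ : v ∉ upper S (v + 1) := by simp [upper]
  rw [h₁, mask_insert h₂, Finset.card_insert_of_notMem h₂]
  exact ⟨rfl, rfl⟩

theorem upper_of_notMem {S : Finset (Fin n)} {v : Fin n} (hv : v ∉ S) :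
    upper S v = upper S (v + 1) := by
  ext w
  simp only [upper, Finset.mem_filter, and_congr_right_iff]
  intro hw
  have : (w : ℕ) ≠ v := fun h => hv (Fin.ext h ▸ hw)
  omega

/-- One round of the loop that computes the numbers for `X` and `Y`. -/
theorem run_member {r a : ℕ} {e : Expr} {v : Fin n} {S : Finset (Fin n)}
    (h : Ready G X Y k s) (he : e.eval s = if v ∈ S then 1 else 0) (hv : s.reg gIdx = v)
    (hr : s.reg r = mask (upper S (v + 1))) (hr' : r ≠ rBits)
    (ha : s.reg rBits = a / 2 ^ (upper S (v + 1)).card) :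
    (Stmt.ite e (.asg r (.cap (.var r + powE (.var gIdx))) ;; .asg rBits (.var rBits / .lit 2))
      .skip).run s = (s.setReg r (mask (upper S v))).setReg rBits (a / 2 ^ (upper S v).card) := by
  rw [run_ite, he]
  by_cases hS : v ∈ S
  · obtain ⟨h₁, h₂⟩ := upper_of_mem hS
    have h₃ := h.min_eq (mask_lt (upper S v)).le
    have h₄ := h.eval_powE (e := .var gIdx) (v := v) hv
    simp only [hS, if_true, run_seq, run_asg, eval_div, eval, State.reg_setReg]
    rw [if_neg (Ne.symm hr'), ha, Nat.div_div_eq_div_mul, ← pow_succ, ← h₂, h₄, hr, Op.apply_add]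
    rw [← h₁, show s.reg capReg = s.reg rCap from rfl, h₃]
    simp
  · rw [upper_of_notMem hS, ← hr, ← ha]
    simp only [hS, if_false]
    ext r'
    · by_cases h₁ : r' = rBits
      · simp [h₁]
      · by_cases h₂ : r' = r <;> simp [h₁, h₂, hr']
    · rfl

/-- Repeated halving with rounding down equals a single division by the product of the divisors. As
`k ≤ n`, the caps are never reached. -/
theorem run_setsS (h : Ready G ∅ ∅ k s) (hk : k ≤ n)
    (hX : ∀ v : Fin n, s.mem (n * n + v) = if v ∈ X then 1 else 0)
    (hY : ∀ v : Fin n, s.mem (n * n + n + v) = if v ∈ Y then 1 else 0) :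
    Ready G X Y k (setsS.run s) ∧ (setsS.run s).mem = s.mem ∧
      (setsS.run s).reg rBits = 2 ^ (k + 6) / 2 ^ (X.card + Y.card) := by
  have hbits : ∀ {s : State} (x : ℕ), Ready G ∅ ∅ k s → Ready G ∅ ∅ k (s.setReg rBits x) :=
    fun x h => h.of_sets (fun r _ hr => by simp [hr]) rfl (by simp [h.regX]) (by simp [h.regY])
  have hcap : 64 * 2 ^ n ≤ 64 * (2 ^ n) ^ 4 :=
    Nat.mul_le_mul_left _ (Nat.le_self_pow (by norm_num) _)
  have hkn : 2 ^ k ≤ 2 ^ n := Nat.pow_le_pow_right (by norm_num) hk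
  obtain ⟨s₁, hs₁⟩ : ∃ s₁, (Stmt.asg rBits (.lit 1)).run s = s₁ := ⟨_, rfl⟩
  have h₁ : Ready G ∅ ∅ k s₁ ∧ s₁.mem = s.mem ∧ s₁.reg rBits = 1 := by
    rw [← hs₁]
    exact ⟨hbits _ h, rfl, by simp⟩
  obtain ⟨s₂, hs₂⟩ : ∃ s₂, (Stmt.loop gIdx rK
      (.asg rBits (.cap (.var rBits + .var rBits)))).run s₁ = s₂ := ⟨_, rfl⟩
  have h₂ : Ready G ∅ ∅ k s₂ ∧ s₂.mem = s.mem ∧ s₂.reg rBits = 2 ^ (k - 0) := by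
    rw [← hs₂, run_loop, h₁.1.regK]
    refine iter_induction (fun j (s' : State) => Ready G ∅ ∅ k s' ∧ s'.mem = s.mem ∧
      s'.reg rBits = 2 ^ (k - j)) ⟨h₁.1.setReg (by norm_num) _, h₁.2.1, by simp [h₁.2.2]⟩ ?_
    rintro j hj s' ⟨h₃, h₄, h₅⟩
    have h₆ := h₃.setReg (r := gIdx) (by norm_num) j
    refine ⟨hbits _ h₆, h₄, ?_⟩
    have e : 2 ^ (k - (j + 1)) + 2 ^ (k - (j + 1)) = 2 ^ (k - j) := by
      rw [← two_mul, ← pow_succ']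
      congr 1
      omega
    have h₇ : 2 ^ (k - j) ≤ 2 ^ n := Nat.pow_le_pow_right (by norm_num) (by omega)
    have h₈ := h₆.min_eq h₇
    rw [run_asg]
    simp only [State.reg_setReg, if_true, eval]
    simp only [State.reg_setReg] at h₈
    simpa [h₅, e] using h₈
  obtain ⟨s₃, hs₃⟩ : ∃ s₃, (Stmt.asg rBits (.cap (.var rBits * .lit 64))).run s₂ = s₃ := ⟨_, rfl⟩
  have h₃ : Ready G ∅ ∅ k s₃ ∧ s₃.mem = s.mem ∧ s₃.reg rBits = 2 ^ (k + 6) := by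
    rw [← hs₃]
    refine ⟨hbits _ h₂.1, h₂.2.1, ?_⟩
    have h₄ := h₂.1.regCap
    have e : 2 ^ (k + 6) = 2 ^ k * 64 := by rw [pow_add]; norm_num
    rw [run_asg]
    simp only [State.reg_setReg, if_true, eval, h₂.2.2, e, Nat.sub_zero]
    rw [show s₂.reg capReg = s₂.reg rCap from rfl, h₄, Op.apply_mul]
    omega
  rw [show setsS.run s = Stmt.run (.loop gIdx rN
    (.ite (.ld (.var rN * .var rN + .var gIdx))
      (.asg rX (.cap (.var rX + powE (.var gIdx))) ;; .asg rBits (.var rBits / .lit 2)) .skip ;;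
    .ite (.ld (.var rN * .var rN + .var rN + .var gIdx))
      (.asg rY (.cap (.var rY + powE (.var gIdx))) ;; .asg rBits (.var rBits / .lit 2)) .skip)) s₃
    by rw [← hs₃, ← hs₂, ← hs₁]; rfl, run_loop, h₃.1.regN]
  have key := iter_induction (f := fun m s => Stmt.run
    (.ite (.ld (.var rN * .var rN + .var gIdx))
      (.asg rX (.cap (.var rX + powE (.var gIdx))) ;; .asg rBits (.var rBits / .lit 2)) .skip ;;
    .ite (.ld (.var rN * .var rN + .var rN + .var gIdx))
      (.asg rY (.cap (.var rY + powE (.var gIdx))) ;; .asg rBits (.var rBits / .lit 2)) .skip)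
      (s.setReg gIdx m)) (m := n) (s := s₃.setReg gIdx n)
    (fun j (s' : State) => Ready G (upper X j) (upper Y j) k s' ∧ s'.mem = s.mem ∧
      s'.reg rBits = 2 ^ (k + 6) / 2 ^ (upper X j).card / 2 ^ (upper Y j).card) ?_ ?_
  · rw [upper_zero, upper_zero, Nat.div_div_eq_div_mul, ← pow_add] at key
    exact key
  · rw [upper_self, upper_self]
    exact ⟨h₃.1.setReg (by norm_num) _, h₃.2.1, by simp [h₃.2.2]⟩
  · rintro j hj s' ⟨h₄, h₅, h₆⟩
    obtain ⟨v, rfl⟩ : ∃ v : Fin n, j = v := ⟨⟨j, hj⟩, rfl⟩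
    have h₇ := h₄.setReg (r := gIdx) (by norm_num) v
    have h₈ : ((s'.setReg gIdx v).mem (n * n + v)) = if v ∈ X then 1 else 0 := by
      rw [State.mem_setReg, h₅, hX]
    have e₁ := run_member (r := rX) (S := X) (v := v) (e := .ld (.var rN * .var rN + .var gIdx))
      (a := 2 ^ (k + 6) / 2 ^ (upper Y (v + 1)).card) h₇ (by
        rw [← h₈]
        simp [h₄.regN]) (by simp) (by simp [h₄.regX]) (by norm_num) (by
        simp [h₆, Nat.div_div_eq_div_mul, mul_comm])
    set s₄ := s'.setReg gIdx v with hs₄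
    set s₅ := (s₄.setReg rX (mask (upper X v))).setReg rBits
      (2 ^ (k + 6) / 2 ^ (upper Y (v + 1)).card / 2 ^ (upper X v).card) with hs₅
    have h₉ : Ready G (upper X v) (upper Y (v + 1)) k s₅ :=
      h₇.of_sets (fun r hr hr' => by simp [hs₅, hr', show r ≠ rX by omega]) rfl (by simp [hs₅])
        (by simp [hs₅, h₇.regY])
    have h₁₀ : s₅.mem (n * n + n + v) = if v ∈ Y then 1 else 0 := by
      rw [← hY, ← h₅]
      rfl
    have e₂ := run_member (r := rY) (S := Y) (v := v)
      (e := .ld (.var rN * .var rN + .var rN + .var gIdx))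
      (a := 2 ^ (k + 6) / 2 ^ (upper X v).card) h₉ (by
        rw [← h₁₀, eval, eval_add, eval_add, eval_mul]
        simp [h₄.regN, hs₅, hs₄]) (by simp [hs₅, hs₄]) (by simp [h₉.regY]) (by norm_num) (by
        simp [hs₅, Nat.div_div_eq_div_mul, mul_comm])
    rw [run_seq, e₁, e₂]
    refine ⟨h₉.of_sets (fun r hr hr' => by simp [hr', show r ≠ rY by omega]) rfl
      (by simp [h₉.regX]) (by simp), h₅, by simp⟩

/-! ### Total time and correctness. -/

theorem Solvable.mono {k' : ℕ} (h : Solvable G X Y k) (hk : k ≤ k') : Solvable G X Y k' := by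
  rcases h with h | ⟨ρ, P, h₁, h₂, h₃⟩
  · exact .inl (by omega)
  · exact .inr ⟨ρ, P, h₁, h₂, by omega⟩

theorem size_cap_le (hn : 1 ≤ n) : (64 * (2 ^ n) ^ 4).size ≤ 11 * n := by
  rw [Nat.size_le]
  calc 64 * (2 ^ n) ^ 4 = 2 ^ (6 + n * 4) := by rw [pow_add, pow_mul]; norm_num
    _ < 2 ^ (11 * n) := Nat.pow_lt_pow_right (by norm_num) (by omega)

theorem cost_setsS_le (h : Ready G X Y k s) (hs : s.Capped) (hk : k ≤ n) (hn : 1 ≤ n) :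
    setsS.cost s ≤ setsS.coeff * n ^ setsS.degree (fun _ => 1) * (11 * n) := by
  have := cost_le (m := 4) (cs := [0, 1]) (n := n) (R := 1) (by norm_num) hn le_rfl (fun _ => 1)
    (fun _ => 0) setsS_capped hs (by
      intro c hc _
      simp only [List.mem_cons, List.not_mem_nil, or_false] at hc
      rcases hc with rfl | rfl
      · simp [h.regN]
      · simpa [h.regK] using hk)
  rw [one_pow, mul_one] at this
  refine this.trans (Nat.mul_le_mul_left _ ?_)
  rw [show s.reg capReg = s.reg rCap from rfl, h.regCap]
  exact size_cap_le hn

theorem cost_mainS_le (h : Ready G X Y k s) (hs : s.Capped) {R : ℕ} (hR : 1 ≤ R)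
    (hbits : s.reg rBits ≤ R) (hn : 1 ≤ n) :
    mainS.cost s ≤ mainS.coeff *
      (n ^ mainS.degree (fun c => if c = 0 then 1 else if c = 3 then 3 else 0) * R) *
        (11 * n) := by
  have := cost_le (m := 9) (cs := [0, 3, 4]) (n := n) (R := R) (by norm_num) hn hR
    (fun c => if c = 0 then 1 else if c = 3 then 3 else 0)
    (fun c => if c = 4 then 1 else 0) mainS_capped hs (by
      intro c hc _
      simp only [List.mem_cons, List.not_mem_nil, or_false] at hc
      rcases hc with rfl | rfl | rfl
      · simp [h.regN]
      · simp [h.regCube, pow_succ]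
      · simpa using hbits)
  rw [mainS_degree, pow_one] at this
  refine this.trans (Nat.mul_le_mul_left _ ?_)
  rw [show s.reg capReg = s.reg rCap from rfl, h.regCap]
  exact size_cap_le hn

theorem solveS_correct (hG : G.Connected) (hXY : Disjoint X Y) :
    ((solveS.run (inputState G X Y k)).reg rN ≤ 1 ∧
      ((solveS.run (inputState G X Y k)).reg rN = 1 ↔ ConstrainedEnds G X Y k)) ∧
    solveS.cost (inputState G X Y k) ≤
      (8000000 + 11 * setsS.coeff + 704 * mainS.coeff + 55) *
        n ^ (setsS.degree (fun _ => 1) +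
          mainS.degree (fun c => if c = 0 then 1 else if c = 3 then 3 else 0) + 2) *
        2 ^ (k - (X.card + Y.card)) := by
  have : NeZero n := by
    obtain ⟨v⟩ := hG.nonempty
    exact ⟨(v.pos).ne'⟩
  have hn : 1 ≤ n := NeZero.pos n
  obtain ⟨s₁, hs₁⟩ : ∃ s₁, tableS.run (inputState G X Y k) = s₁ := ⟨_, rfl⟩
  obtain ⟨r₁, cap₁, m₁, m₁', c₁⟩ := run_tableS s₁ hs₁
  have hsq : ∀ v : Fin n, n * n + (v : ℕ) < n * n + (n + n) ∧
      n * n + n + (v : ℕ) < n * n + (n + n) := fun v => by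
    have := v.2
    omega
  obtain ⟨r₂, m₂, b₂⟩ := run_setsS (X := X) (Y := Y) r₁ (min_le_right _ _)
    (fun v => by rw [m₁ _ (hsq v).1, inputState_left])
    (fun v => by rw [m₁ _ (hsq v).2, inputState_right])
  have c₂ := cost_setsS_le r₁ cap₁ (min_le_right _ _) hn
  have cap₂ := capped_run (by norm_num) setsS_capped cap₁
  obtain ⟨s₂, hs₂⟩ : ∃ s₂, setsS.run s₁ = s₂ := ⟨_, rfl⟩
  rw [hs₂] at r₂ m₂ b₂ cap₂
  have hmem : ∀ a, n * n + (n + n) + n ≤ a → s₂.mem a = 0 := fun a ha => by rw [m₂, m₁' a ha]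
  have run : solveS.run (inputState G X Y k) =
      (mainS.run s₂).setReg rN ((mainS.run s₂).reg rAns) := by
    rw [← hs₂, ← hs₁]
    rfl
  constructor
  · rw [run, State.reg_setReg, if_pos rfl]
    -- The empty sequence is found vacuously; this already gives soundness and the case of a single
    -- witness set.
    have h₀ := run_mainS r₂ hXY hmem (m := 0) (P := fun _ => ∅)
      ⟨by simp, by simp, by simp, fun i h h' => absurd h (by omega)⟩
    refine ⟨h₀.1, fun h => (Solvable.mono (h₀.2.1 h) (min_le_left _ _)).constrainedEnds hG,
      fun h => ?_⟩
    obtain ⟨m, f, hf, hm, hX, hY⟩ := constrainedEnds_iff.1 h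
    rcases Nat.eq_zero_or_pos m with rfl | hm'
    · exact h₀.2.2 (.inl (by omega))
    · have := hf.found (k := min k n) hm' (by omega) hX hY
      rw [← b₂] at this
      exact (run_mainS r₂ hXY hmem this).2.2 (.inr hm')
  · have hxy : X.card + Y.card ≤ n := by
      rw [← Finset.card_union_of_disjoint hXY]
      exact (Finset.card_le_univ _).trans_eq (Fintype.card_fin n)
    set E := 2 ^ (k - (X.card + Y.card)) with hE
    have hE₁ : k - (X.card + Y.card) < E := Nat.lt_two_pow_self
    -- The quotient in `rBits` is at most `64 * E`, even when the exponent in `E` is truncated;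
    -- moreover `64 * E` is positive, while the quotient may be `0`.
    have c₃ := cost_mainS_le r₂ cap₂ (R := 64 * E) (by omega) (by
      rw [b₂, hE]
      refine Nat.div_le_of_le_mul ?_
      rw [show 64 = 2 ^ 6 by norm_num, ← pow_add, ← pow_add]
      exact Nat.pow_le_pow_right (by norm_num) (by omega)) hn
    have cap₃ := capped_run (by norm_num) mainS_capped cap₂
    have c₄ := cost_asg_le cap₃.short rN (.var rAns) (c := 5) rfl
    have h₃ : ((mainS.run s₂).reg capReg).size ≤ 11 * n := by
      rw [run_reg (writes_of_capped mainS_capped (by norm_num)),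
        show s₂.reg capReg = s₂.reg rCap from rfl, r₂.regCap]
      exact size_cap_le hn
    have cost : solveS.cost (inputState G X Y k) = tableS.cost (inputState G X Y k) +
        (setsS.cost s₁ + (mainS.cost s₂ + (Stmt.asg rN (.var rAns)).cost (mainS.run s₂))) := by
      rw [← hs₂, ← hs₁]
      rfl
    rw [cost]
    set dS := setsS.degree (fun _ => 1)
    set dM := mainS.degree (fun c => if c = 0 then 1 else if c = 3 then 3 else 0)
    have pow : ∀ a ≤ dS + dM + 2, n ^ a * 1 ≤ n ^ (dS + dM + 2) * E ∧
        n ^ a * E ≤ n ^ (dS + dM + 2) * E := fun a ha =>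
      ⟨Nat.mul_le_mul (Nat.pow_le_pow_right hn ha) (by omega),
        Nat.mul_le_mul_right _ (Nat.pow_le_pow_right hn ha)⟩
    have hk := size_lit_le k
    -- The length of `k` is absorbed by `k ≤ (k - (|X| + |Y|)) + n < E + n`.
    have t₁ : (n + 1) * (n + k.size + 1) ≤ 8 * (n ^ (dS + dM + 2) * E) := by
      have h₄ : n ≤ n * E := Nat.le_mul_of_pos_right n (by omega)
      have h₅ : E ≤ n * E := Nat.le_mul_of_pos_left E hn
      calc (n + 1) * (n + k.size + 1) ≤ (2 * n) * (4 * (n * E)) :=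
            Nat.mul_le_mul (by omega) (by omega)
        _ = 8 * (n ^ 2 * E) := by ring
        _ ≤ _ := Nat.mul_le_mul_left _ (pow 2 (by omega)).2
    have t₂ : setsS.coeff * n ^ dS * (11 * n) ≤
        11 * setsS.coeff * (n ^ (dS + dM + 2) * E) := by
      calc _ = 11 * setsS.coeff * (n ^ (dS + 1) * 1) := by ring
        _ ≤ _ := Nat.mul_le_mul_left _ (pow _ (by omega)).1
    have t₃ : mainS.coeff * (n ^ dM * (64 * E)) * (11 * n) ≤
        704 * mainS.coeff * (n ^ (dS + dM + 2) * E) := by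
      calc _ = 704 * mainS.coeff * (n ^ (dM + 1) * E) := by ring
        _ ≤ _ := Nat.mul_le_mul_left _ (pow _ (by omega)).2
    have t₄ : n ≤ n ^ (dS + dM + 2) * E := by
      simpa using (pow 1 (by omega)).1
    rw [mul_assoc, add_mul, add_mul, add_mul]
    omega

end Input

end PathContraction

/-- There are one program and constants `C`, `c` such that on every instance `(G, X, Y, k)` of Path
Contraction With Constrained Ends the program halts within time `C * n ^ c * 2 ^ (k - |X| - |Y|)`
(where the exponent is read as `0` if it is negative, as the subtraction is truncated) and leaves
in register `0` the answer, `1` for yes and `0` for no. -/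
theorem theorem1 :
    ∃ (p : RAM.Program) (C c : ℕ),
      ∀ (n : ℕ) (G : SimpleGraph (Fin n)) (X Y : Finset (Fin n)) (k : ℕ),
        G.Connected → Disjoint X Y →
          ∃ (t : ℕ) (s : RAM.State),
            RAM.Exec p (PathContraction.inputState G X Y k) t s ∧
            t ≤ C * n ^ c * 2 ^ (k - (X.card + Y.card)) ∧
            (PathContraction.ConstrainedEnds G X Y k → s.reg 0 = 1) ∧
            (¬ PathContraction.ConstrainedEnds G X Y k → s.reg 0 = 0) := by
  refine ⟨PathContraction.solveS.code,
    8000000 + 11 * PathContraction.setsS.coeff + 704 * PathContraction.mainS.coeff + 55,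
    PathContraction.setsS.degree (fun _ => 1) + PathContraction.mainS.degree
      (fun c => if c = 0 then 1 else if c = 3 then 3 else 0) + 2, fun n G X Y k hG hXY => ?_⟩
  obtain ⟨⟨h₁, h₂⟩, h₃⟩ := PathContraction.solveS_correct (k := k) hG hXY
  obtain ⟨t, ht, h⟩ := RAM.Stmt.exec PathContraction.solveS_wf
    (s := PathContraction.inputState G X Y k) fun r hr => by
      have : 40 ≤ r := hr
      simp only [PathContraction.inputState]
      rw [if_neg (by omega), if_neg (by omega)]
  refine ⟨t, _, h, ht.trans h₃, h₂.2, fun hno => ?_⟩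
  have := mt h₂.1 hno
  omega
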